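/- Let $k$ be a field of characteristic $0$. We work with operads with two colours, $\mathfrak c$ (closed) and $\mathfrak o$ (open), in $\mathbb Z$-graded $k$-vector spaces, with zero differential, and with their algebras in dg vector spaces (differential of degree $-1$). For a binary quadratic operad $\mathcal P=\mathcal F(E)/(R)$ (with $E$ finite dimensional in each degree and each arity-two colour component, and $R\subset\mathcal F^{(2)}(E)$ a sub-$\mathbb S$-module of the weight two part of the free operad), the Koszul dual operad is $\mathcal P^!=\mathcal F(E^\vee)/(R^\perp)$, where $E^\vee=E^*\otimes\mathrm{sgn}_2$ and $R^\perp$ is the orthogonal of $R$ under the induced pairing $\mathcal F^{(2)}(E)\otimes\mathcal F^{(2)}(E^\vee)\to k$. Let $\mathbf{sc}^{\rm vor}=\mathcal F(E_v)/(R_v)$ be the homology operad of Voronov's Swiss-cheese operad in its quadratic presentation: $E_v$ is generated by symmetric operations $f_2,g_2\in E_v(\mathfrak c,\mathfrak c;\mathfrak c)$ of degrees $0$ and $1$, and operations $e_{0,2}\in E_v(\mathfrak o,\mathfrak o;\mathfrak o)$ and $e_{1,1}\in E_v(\mathfrak c,\mathfrak o;\mathfrak o)$ of degree $0$ without symmetry;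 $R_v$ is generated as an $\mathbb S$-module by $$f_2(\mathrm{id}\otimes f_2)=f_2(f_2\otimes\mathrm{id}),\qquad g_2(g_2\otimes\mathrm{id})\cdot((123)+(231)+(312))=0,$$ $$g_2(\mathrm{id}\otimes f_2)=f_2(g_2\otimes\mathrm{id})+f_2(\mathrm{id}\otimes g_2)\cdot(213),\qquad e_{0,2}(\mathrm{id}\otimes e_{0,2})=e_{0,2}(e_{0,2}\otimes\mathrm{id}),$$ $$e_{1,1}(\mathrm{id}\otimes e_{1,1})=e_{1,1}(f_2\otimes\mathrm{id}),\qquad e_{1,1}(\mathrm{id}\otimes e_{0,2})=e_{0,2}(e_{1,1}\otimes\mathrm{id})=e_{0,2}(\mathrm{id}\otimes e_{1,1})\cdot(213).$$ Let $\mathfrak l_2,\mathfrak c_2,\mathfrak n_{0,2},\mathfrak n_{1,1}\in E_v^\vee$ be the elements dual to $f_2,g_2,e_{0,2},e_{1,1}$ in the basis $f_2,\ g_2,\ e_{0,2},\ e_{0,2}\cdot(21),\ e_{1,1},\ e_{1,1}\cdot(21)$ of $E_v$; $\mathfrak c_2$ has degree $-1$ and the others have degree $0$. (1) The operad $(\mathbf{sc}^{\rm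 vor})^!$ has the binary quadratic presentation $\mathcal F(E_{v^!})/(R_{v^!})$, where $E_{v^!}=\langle\mathfrak l_2,\mathfrak c_2,\mathfrak n_{0,2},\mathfrak n_{1,1}\rangle$ ($\mathfrak l_2,\mathfrak c_2$ antisymmetric, $\mathfrak n_{0,2},\mathfrak n_{1,1}$ without symmetry) and $R_{v^!}$ is the sub-$\mathbb S$-module of $\mathcal F^{(2)}(E_{v^!})$ generated by $$\mathfrak c_2(\mathrm{id}\otimes\mathfrak c_2)=-\mathfrak c_2(\mathfrak c_2\otimes\mathrm{id}),\qquad \mathfrak l_2(\mathfrak l_2\otimes\mathrm{id})\cdot((123)+(231)+(312))=0,$$ $$\mathfrak l_2(\mathrm{id}\otimes\mathfrak c_2)=\mathfrak c_2(\mathfrak l_2\otimes\mathrm{id})+\mathfrak c_2(\mathrm{id}\otimes\mathfrak l_2)\cdot(213),\qquad \mathfrak n_{0,2}(\mathrm{id}\otimes\mathfrak n_{0,2})=\mathfrak n_{0,2}(\mathfrak n_{0,2}\otimes\mathrm{id}),$$ $$\mathfrak n_{1,1}(\mathfrak l_2\otimes\mathrm{id})=\mathfrak n_{1,1}(\mathrm{id}\otimes\mathfrak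 n_{1,1})\cdot(\mathrm{id}-(213)),$$ $$\mathfrak n_{1,1}(\mathrm{id}\otimes\mathfrak n_{0,2})=\mathfrak n_{0,2}(\mathfrak n_{1,1}\otimes\mathrm{id})+\mathfrak n_{0,2}(\mathrm{id}\otimes\mathfrak n_{1,1})\cdot(213),\qquad \mathfrak n_{1,1}(\mathfrak c_2\otimes\mathrm{id})=0.$$ (2) For every pair $(H,A)$ of dg vector spaces, evaluation of the structure maps at $\mathfrak l_2,\mathfrak c_2,\mathfrak n_{0,2},\mathfrak n_{1,1}$ is a bijection from the set of $(\mathbf{sc}^{\rm vor})^!$-algebra structures on $(H,A)$ to the set of quadruples $([\,,],\times,\cdot,\rho)$ of operations compatible with the differentials such that: $(H,[\,,],\times)$ is a $\Lambda\mathcal Ger$-algebra, that is, $[\,,]$ has degree $0$ and $\times$ has degree $-1$, both are graded antisymmetric, $[\,,]$ satisfies the graded Jacobi identity, $(-1)^{|x|}x\times(y\times z)=-(x\times y)\times z$ and $(-1)^{|x|}[x,y\times z]=[x,y]\times z+(-1)^{|x||y|}y\times[x,z]$; $(A,\cdot)$ is an associative algebra (not necessarily unital) with product of degree $0$; and $\rho:H\otimes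 A\to A$ has degree $0$ and satisfies $$\rho([h,h'],a)=\rho(h,\rho(h',a))-(-1)^{|h||h'|}\rho(h',\rho(h,a)),$$ $$\rho(h,a\cdot a')=\rho(h,a)\cdot a'+(-1)^{|a||h|}a\cdot\rho(h,a'),\qquad \rho(h\times h',a)=0,$$ i.e. $\rho$ is a morphism of Lie algebras $H\to\mathrm{Der}(A)$ that vanishes on products $h\times h'$. -/

import Mathlib

universe u v w

/-! ### Coloured operads in graded vector spaces

Operads are written in coordinate-free form: the inputs of an operation are labelled by an
arbitrary finite type `X` with a colouring `c : X → C`.  The usual component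
`P(c₁, …, cₙ; d)` is the one with `X = Fin n`, and the right action of `σ ∈ Sₙ` is the relabelling
along `σ⁻¹`. -/

namespace Operads

/-- The identification of labels behind `(p ∘ₓ q) ∘_y r = p ∘ₓ (q ∘_y r)`. -/
def seqEquiv {X Y : Type} (Z : Type) (x : X) (y : Y) :
    {v : {x' : X // x' ≠ x} ⊕ Y // v ≠ Sum.inr y} ⊕ Z ≃
      {x' : X // x' ≠ x} ⊕ ({y' : Y // y' ≠ y} ⊕ Z) where
  toFun
    | Sum.inl ⟨Sum.inl x', _⟩ => Sum.inl x'
    | Sum.inl ⟨Sum.inr y', h⟩ => Sum.inr (Sum.inl ⟨y', fun e => h (e ▸ rfl)⟩)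
    | Sum.inr z => Sum.inr (Sum.inr z)
  invFun
    | Sum.inl x' => Sum.inl ⟨Sum.inl x', Sum.inl_ne_inr⟩
    | Sum.inr (Sum.inl y') => Sum.inl ⟨Sum.inr y'.1, fun e => y'.2 (Sum.inr_injective e)⟩
    | Sum.inr (Sum.inr z) => Sum.inr z
  left_inv := by rintro (⟨_ | _, _⟩ | _) <;> rfl
  right_inv := by rintro (_ | _ | _) <;> rfl

/-- The identification of labels behind `(p ∘ₓ q) ∘_{x'} r = ± (p ∘_{x'} r) ∘ₓ q`. -/
def parEquiv {X : Type} (Y Z : Type) {x x' : X} (hx : x ≠ x') :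
    {v : {i : X // i ≠ x} ⊕ Y // v ≠ Sum.inl ⟨x', hx.symm⟩} ⊕ Z ≃
      {v : {i : X // i ≠ x'} ⊕ Z // v ≠ Sum.inl ⟨x, hx⟩} ⊕ Y where
  toFun
    | Sum.inl ⟨Sum.inl i, h⟩ =>
        Sum.inl ⟨Sum.inl ⟨i.1, fun e => h (congrArg Sum.inl (Subtype.ext e))⟩,
          fun e => i.2 (congrArg Subtype.val (Sum.inl_injective e))⟩
    | Sum.inl ⟨Sum.inr y, _⟩ => Sum.inr y
    | Sum.inr z => Sum.inl ⟨Sum.inr z, Sum.inr_ne_inl⟩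
  invFun
    | Sum.inl ⟨Sum.inl i, h⟩ =>
        Sum.inl ⟨Sum.inl ⟨i.1, fun e => h (congrArg Sum.inl (Subtype.ext e))⟩,
          fun e => i.2 (congrArg Subtype.val (Sum.inl_injective e))⟩
    | Sum.inl ⟨Sum.inr z, _⟩ => Sum.inr z
    | Sum.inr y => Sum.inl ⟨Sum.inr y, Sum.inr_ne_inl⟩
  left_inv := by rintro (⟨_ | _, _⟩ | _) <;> rfl
  right_inv := by rintro (⟨_ | _, _⟩ | _) <;> rfl

/-- The identification of labels behind `id ∘ p = p`. -/
def unitLeftEquiv (X : Type) : {i : Unit // i ≠ ()} ⊕ X ≃ X where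
  toFun
    | Sum.inl i => (i.2 rfl).elim
    | Sum.inr x => x
  invFun x := Sum.inr x
  left_inv := by
    rintro (i | _)
    · exact (i.2 rfl).elim
    · rfl
  right_inv _ := rfl

open Classical in
/-- The identification of labels behind `p ∘ₓ id = p`. -/
noncomputable def unitRightEquiv {X : Type} (x : X) : {i : X // i ≠ x} ⊕ Unit ≃ X where
  toFun
    | Sum.inl i => i.1
    | Sum.inr _ => x
  invFun i := if h : i = x then Sum.inr () else Sum.inl ⟨i, h⟩
  left_inv := by
    rintro (i | _)
    · simp [i.2]
    · simp
  right_inv i := by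
    by_cases h : i = x <;> simp [h]

/-- The effect of relabellings `e`, `f` on the labels of a partial composite. -/
def compEquiv {X X' Y Y' : Type} (e : X ≃ X') (f : Y ≃ Y') (x : X) :
    {i : X // i ≠ x} ⊕ Y ≃ {i : X' // i ≠ e x} ⊕ Y' :=
  Equiv.sumCongr (e.subtypeEquiv fun _ => (not_congr e.apply_eq_iff_eq).symm) f

/-! The relabellings above respect the colours. -/

theorem refl_color {X C : Type} (c : X → C) (x : X) : c (Equiv.refl X x) = c x := rfl

theorem trans_color {X Y Z C : Type} {e : X ≃ Y} {f : Y ≃ Z} {c : X → C} {c' : Y → C}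
    {c'' : Z → C} (hc : ∀ x, c' (e x) = c x) (hc' : ∀ y, c'' (f y) = c' y) (x : X) :
    c'' (e.trans f x) = c x :=
  (hc' (e x)).trans (hc x)

theorem comp_color {X X' Y Y' C : Type} {e : X ≃ X'} {f : Y ≃ Y'} {c : X → C} {c' : X' → C}
    {b : Y → C} {b' : Y' → C} (hc : ∀ x, c' (e x) = c x) (hb : ∀ y, b' (f y) = b y) (x : X)
    (v : {i : X // i ≠ x} ⊕ Y) :
    Sum.elim (fun i => c' i.1) b' (compEquiv e f x v) = Sum.elim (fun i => c i.1) b v := by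
  rcases v with i | y
  · exact hc i.1
  · exact hb y

theorem seq_color {X Y Z C : Type} (c : X → C) (b : Y → C) (g : Z → C) (x : X) (y : Y)
    (v : {v : {x' : X // x' ≠ x} ⊕ Y // v ≠ Sum.inr y} ⊕ Z) :
    Sum.elim (fun i => c i.1) (Sum.elim (fun i => b i.1) g) (seqEquiv Z x y v) =
      Sum.elim (fun i => Sum.elim (fun j => c j.1) b i.1) g v := by
  rcases v with ⟨_ | _, _⟩ | _ <;> rfl

theorem par_color {X Y Z C : Type} (c : X → C) (b : Y → C) (g : Z → C) {x x' : X} (hx : x ≠ x')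
    (v : {v : {i : X // i ≠ x} ⊕ Y // v ≠ Sum.inl ⟨x', hx.symm⟩} ⊕ Z) :
    Sum.elim (fun i => Sum.elim (fun j => c j.1) g i.1) b (parEquiv Y Z hx v) =
      Sum.elim (fun i => Sum.elim (fun j => c j.1) b i.1) g v := by
  rcases v with ⟨_ | _, _⟩ | _ <;> rfl

theorem unitLeft_color {X C : Type} (d : C) (c : X → C) (v : {i : Unit // i ≠ ()} ⊕ X) :
    c (unitLeftEquiv X v) = Sum.elim (fun _ => d) c v := by
  rcases v with i | _
  · exact (i.2 rfl).elim
  · rfl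

theorem unitRight_color {X C : Type} (c : X → C) (x : X) (v : {i : X // i ≠ x} ⊕ Unit) :
    c (unitRightEquiv x v) = Sum.elim (fun i => c i.1) (fun _ => c x) v := by
  rcases v with _ | _ <;> rfl

theorem swap_color {C : Type} (a b : C) (i : Fin 2) :
    ![b, a] (Equiv.swap 0 1 i) = ![a, b] i := by
  fin_cases i <;> rfl

/-- A `C`-coloured symmetric operad in `ℤ`-graded `k`-vector spaces, with partial compositions.
`Op X c d n` is the space of operations of degree `n` with inputs labelled by `X` and coloured
by `c`, and with output colour `d`. -/
structure ColoredOperad (k : Type u) [Field k] (C : Type) where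
  Op : (X : Type) → [Finite X] → (X → C) → C → ℤ → Type v
  [acg : ∀ (X : Type) [Finite X] (c : X → C) (d : C) (n : ℤ), AddCommGroup (Op X c d n)]
  [mod : ∀ (X : Type) [Finite X] (c : X → C) (d : C) (n : ℤ), Module k (Op X c d n)]
  /-- the identity of the colour `d` -/
  unit (d : C) : Op Unit (fun _ => d) d 0
  /-- relabelling of the inputs along a bijection -/
  relabel {X Y : Type} [Finite X] [Finite Y] (e : X ≃ Y) {c : X → C} {c' : Y → C}
    (hc : ∀ x, c' (e x) = c x) {d : C} {n : ℤ} : Op X c d n →ₗ[k] Op Y c' d n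
  /-- the partial composite `p ∘ₓ q` -/
  comp {X Y : Type} [Finite X] [Finite Y] (x : X) {c : X → C} {b : Y → C} {a d : C}
    {m n N : ℤ} (hx : c x = a) (hN : m + n = N) :
    Op X c d m →ₗ[k] Op Y b a n →ₗ[k]
      Op ({i : X // i ≠ x} ⊕ Y) (Sum.elim (fun i => c i.1) b) d N
  relabel_refl {X : Type} [Finite X] {c : X → C} {d : C} {n : ℤ} (p : Op X c d n) :
    relabel (Equiv.refl X) (refl_color c) p = p
  relabel_trans {X Y Z : Type} [Finite X] [Finite Y] [Finite Z] (e : X ≃ Y) (f : Y ≃ Z)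
    {c : X → C} {c' : Y → C} {c'' : Z → C} (hc : ∀ x, c' (e x) = c x)
    (hc' : ∀ y, c'' (f y) = c' y) {d : C} {n : ℤ} (p : Op X c d n) :
    relabel f hc' (relabel e hc p) =
      relabel (e.trans f) (trans_color hc hc') p
  comp_relabel {X X' Y Y' : Type} [Finite X] [Finite X'] [Finite Y] [Finite Y']
    (e : X ≃ X') (f : Y ≃ Y') {c : X → C} {c' : X' → C} {b : Y → C} {b' : Y' → C}
    (hc : ∀ x, c' (e x) = c x) (hb : ∀ y, b' (f y) = b y) {a d : C} {m n N : ℤ} (x : X)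
    (hx : c x = a) (hN : m + n = N) (p : Op X c d m) (q : Op Y b a n) :
    comp (e x) ((hc x).trans hx) hN (relabel e hc p) (relabel f hb q) =
      relabel (compEquiv e f x) (comp_color hc hb x) (comp x hx hN p q)
  comp_seq {X Y Z : Type} [Finite X] [Finite Y] [Finite Z] {c : X → C} {b : Y → C} {g : Z → C}
    {a a' d : C} {l m n lm mn N : ℤ} (x : X) (y : Y) (hx : c x = a) (hy : b y = a')
    (h₁ : l + m = lm) (h₂ : lm + n = N) (h₃ : m + n = mn) (h₄ : l + mn = N)
    (p : Op X c d l) (q : Op Y b a m) (r : Op Z g a' n) :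
    relabel (seqEquiv Z x y) (seq_color c b g x y)
      (comp (Sum.inr y) ((Sum.elim_inr _ _ _).trans hy) h₂ (comp x hx h₁ p q) r) =
        comp x hx h₄ p (comp y hy h₃ q r)
  comp_par {X Y Z : Type} [Finite X] [Finite Y] [Finite Z] {c : X → C} {b : Y → C} {g : Z → C}
    {a a' d : C} {l m n lm ln N : ℤ} {x x' : X} (hxx' : x ≠ x') (hx : c x = a) (hx' : c x' = a')
    (h₁ : l + m = lm) (h₂ : lm + n = N) (h₃ : l + n = ln) (h₄ : ln + m = N)
    (p : Op X c d l) (q : Op Y b a m) (r : Op Z g a' n) :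
    relabel (parEquiv Y Z hxx') (par_color c b g hxx')
      (comp (Sum.inl ⟨x', hxx'.symm⟩) ((Sum.elim_inl _ _ _).trans hx') h₂ (comp x hx h₁ p q) r) =
        (-1 : k) ^ (m * n) •
          comp (Sum.inl ⟨x, hxx'⟩) ((Sum.elim_inl _ _ _).trans hx) h₄ (comp x' hx' h₃ p r) q
  unit_comp {X : Type} [Finite X] {c : X → C} {d : C} {n : ℤ} (p : Op X c d n) :
    relabel (unitLeftEquiv X) (unitLeft_color d c)
      (comp () rfl (zero_add n) (unit d) p) = p
  comp_unit {X : Type} [Finite X] {c : X → C} {d : C} {n : ℤ} (x : X) (p : Op X c d n) :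
    relabel (unitRightEquiv x) (unitRight_color c x)
      (comp x rfl (add_zero n) p (unit (c x))) = p

attribute [instance] ColoredOperad.acg ColoredOperad.mod

/-- An isomorphism of coloured operads. -/
structure ColoredOperad.Iso {k : Type u} [Field k] {C : Type}
    (P : ColoredOperad.{u, v} k C) (Q : ColoredOperad.{u, w} k C) where
  equiv {X : Type} [Finite X] {c : X → C} {d : C} {n : ℤ} : P.Op X c d n ≃ₗ[k] Q.Op X c d n
  map_unit (d : C) : equiv (P.unit d) = Q.unit d
  map_relabel {X Y : Type} [Finite X] [Finite Y] (e : X ≃ Y) {c : X → C} {c' : Y → C}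
    (hc : ∀ x, c' (e x) = c x) {d : C} {n : ℤ} (p : P.Op X c d n) :
    equiv (P.relabel e hc p) = Q.relabel e hc (equiv p)
  map_comp {X Y : Type} [Finite X] [Finite Y] (x : X) {c : X → C} {b : Y → C} {a d : C}
    {m n N : ℤ} (hx : c x = a) (hN : m + n = N) (p : P.Op X c d m) (q : P.Op Y b a n) :
    equiv (P.comp x hx hN p q) = Q.comp x hx hN (equiv p) (equiv q)

/-! ### Algebras over an operad -/

/-- A differential graded vector space: lower grading, differential of degree `-1`. -/
structure DGVec (k : Type u) [Field k] where
  carrier : Type w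
  [acg : AddCommGroup carrier]
  [mod : Module k carrier]
  gr : ℤ → Submodule k carrier
  isInternal : DirectSum.IsInternal gr
  d : carrier →ₗ[k] carrier
  d_mem {n : ℤ} {x : carrier} : x ∈ gr n → d x ∈ gr (n - 1)
  d_d (x : carrier) : d (d x) = 0

attribute [instance] DGVec.acg DGVec.mod

instance {k : Type u} [Field k] : CoeSort (DGVec.{u, w} k) (Type w) := ⟨DGVec.carrier⟩

/-- The total orders on a finite type, as lists. -/
def Enum (X : Type) : Type := {L : List X // L.Nodup ∧ ∀ x, x ∈ L}

open Classical in
/-- An algebra over the operad `P` (with zero differential) on a family `V` of dg vector spaces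
indexed by the colours, i.e. a morphism of dg operads from `P` to the endomorphism operad of `V`.
An element of `End_V(X, c; d)` is a linear map on the unordered tensor product of the `V (c x)`.
It is given by one multilinear map for each total order of `X`, and two orders are related
by the Koszul sign (`act_swap`). -/
structure OperadAlgebra {k : Type u} [Field k] {C : Type} (P : ColoredOperad.{u, v} k C)
    (V : C → DGVec.{u, w} k) where
  act {X : Type} [Finite X] {c : X → C} {d : C} {n : ℤ} (L : Enum X) :
    P.Op X c d n →ₗ[k] MultilinearMap k (fun x => (V (c x)).carrier) (V d).carrier
  act_mem {X : Type} [Finite X] {c : X → C} {d : C} {n : ℤ} (L : Enum X) (p : P.Op X c d n)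
    (a : ∀ x, V (c x)) (g : X → ℤ) (hg : ∀ x, a x ∈ (V (c x)).gr (g x)) :
    act L p a ∈ (V d).gr (n + (L.1.map g).sum)
  /-- Koszul sign rule for a transposition of neighbours in the order of the inputs. -/
  act_swap {X : Type} [Finite X] {c : X → C} {d : C} {n : ℤ} (L L' : Enum X)
    (l₁ l₂ : List X) (x y : X) (hL : L.1 = l₁ ++ x :: y :: l₂) (hL' : L'.1 = l₁ ++ y :: x :: l₂)
    (p : P.Op X c d n) (a : ∀ x, V (c x)) (i j : ℤ)
    (hi : a x ∈ (V (c x)).gr i) (hj : a y ∈ (V (c y)).gr j) :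
    act L' p a = (-1 : k) ^ (i * j) • act L p a
  act_unit {d : C} (L : Enum Unit) (a : V d) : act L (P.unit d) (fun _ => a) = a
  act_relabel {X Y : Type} [Finite X] [Finite Y] (e : X ≃ Y) {c : X → C} {c' : Y → C}
    (hc : ∀ x, c' (e x) = c x) {d : C} {n : ℤ} (p : P.Op X c d n) (L : Enum X) (L' : Enum Y)
    (hL : L'.1 = L.1.map e) (a : ∀ y, V (c' y)) :
    act L' (P.relabel e hc p) a = act L p (fun x => hc x ▸ a (e x))
  /-- `(p ∘ₓ q)(a', b, a'') = (-1)^{|q||a'|} p(a', q(b), a'')`, the orders being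
  `l₁, x, l₂` on the inputs of `p` and `l₁, M, l₂` on those of the composite. -/
  act_comp {X Y : Type} [Finite X] [Finite Y] (x : X) {c : X → C} {b : Y → C} {e d : C}
    {m n N : ℤ} (hx : c x = e) (hN : m + n = N) (p : P.Op X c d m) (q : P.Op Y b e n)
    (L : Enum X) (M : Enum Y) (K : Enum ({i : X // i ≠ x} ⊕ Y))
    (l₁ l₂ : List {i : X // i ≠ x})
    (hL : L.1 = l₁.map Subtype.val ++ x :: l₂.map Subtype.val)
    (hK : K.1 = l₁.map Sum.inl ++ M.1.map Sum.inr ++ l₂.map Sum.inl)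
    (a : ∀ i, V (c i)) (a' : ∀ y, V (b y)) (g : {i : X // i ≠ x} → ℤ)
    (hg : ∀ i ∈ l₁, a i.1 ∈ (V (c i.1)).gr (g i)) :
    act K (P.comp x hx hN p q)
        (fun s => match s with
          | Sum.inl i => a i.1
          | Sum.inr y => a' y) =
      (-1 : k) ^ (n * (l₁.map g).sum) •
        act L p (Function.update a x (hx.symm ▸ act M q a'))
  /-- The structure maps are compatible with the differentials. -/
  act_d {X : Type} [Finite X] {c : X → C} {d : C} {n : ℤ} (L : Enum X) (p : P.Op X c d n)
    (a : ∀ x, V (c x)) (g : X → ℤ) (hg : ∀ x, a x ∈ (V (c x)).gr (g x)) :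
    (V d).d (act L p a) =
      (-1 : k) ^ n • ∑ i : Fin L.1.length, (-1 : k) ^ ((L.1.take i).map g).sum •
        act L p (Function.update a (L.1.get i) ((V (c (L.1.get i))).d (a (L.1.get i))))

/-! ### Binary quadratic data -/

/-- A graded coloured `𝕊`-module concentrated in arity two: `M n a b d` is the degree `n` part of
`E(a, b; d)` and `swap` is the right action of the transposition `(21)`. -/
structure BinSMod (k : Type u) [Field k] (C : Type) where
  M : ℤ → C → C → C → Type u
  [acg : ∀ n a b d, AddCommGroup (M n a b d)]
  [mod : ∀ n a b d, Module k (M n a b d)]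
  swap {n : ℤ} {a b d : C} : M n a b d →ₗ[k] M n b a d
  swap_swap {n : ℤ} {a b d : C} (e : M n a b d) : swap (swap e) = e

attribute [instance] BinSMod.acg BinSMod.mod

section
variable {k : Type u} [Field k] {C : Type}

/-- The `𝕊`-module with basis `G` on which the transposition acts by the signed permutation
`g ↦ ε g • sw g`. -/
noncomputable def BinSMod.ofBasis (G : ℤ → C → C → C → Type)
    (sw : ∀ {n : ℤ} {a b d : C}, G n a b d → G n b a d)
    (ε : ∀ {n : ℤ} {a b d : C}, G n a b d → ℤˣ)
    (sw_sw : ∀ {n : ℤ} {a b d : C} (g : G n a b d), sw (sw g) = g)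
    (ε_sw : ∀ {n : ℤ} {a b d : C} (g : G n a b d), ε (sw g) = ε g) : BinSMod k C where
  M n a b d := G n a b d →₀ k
  swap := Finsupp.linearCombination k fun g => Finsupp.single (sw g) (((ε g : ℤˣ) : ℤ) : k)
  swap_swap e := by
    induction e using Finsupp.induction_linear with
    | zero => simp
    | add x y hx hy => rw [map_add, map_add, hx, hy]
    | single g r =>
      rw [Finsupp.linearCombination_single, map_smul, Finsupp.linearCombination_single, ε_sw,
        sw_sw]
      rcases Int.units_eq_one_or (ε g) with h | h <;> simp [h]

/-- `E^∨ = E^* ⊗ sgn₂`. -/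
def BinSMod.dual (E : BinSMod k C) : BinSMod k C where
  M n a b d := Module.Dual k (E.M (-n) a b d)
  swap := -(LinearMap.lcomp k k E.swap)
  swap_swap e := by
    ext x
    simp [E.swap_swap]

/-- A tree with two vertices and three leaves: the composite `μ(ν ⊗ id)` whose leaves, in planar
order, are labelled `τ 0, τ 1, τ 2`.  The leaf labelled `i` has colour `c i`. -/
structure Comb (E : BinSMod k C) (c : Fin 3 → C) (d : C) (n : ℤ) where
  τ : Equiv.Perm (Fin 3)
  {x : C}
  {y : C}
  {z : C}
  {e : C}
  hx : c (τ 0) = x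
  hy : c (τ 1) = y
  hz : c (τ 2) = z
  {i : ℤ}
  {j : ℤ}
  hn : i + j = n
  μ : E.M i e z d
  ν : E.M j x y e

namespace Comb

variable {E : BinSMod k C} {c c' : Fin 3 → C} {d : C} {n : ℤ}

/-- The right action of `σ ∈ S₃`. -/
def act (σ : Equiv.Perm (Fin 3)) (h : ∀ i, c' i = c (σ i)) (t : Comb E c d n) : Comb E c' d n :=
  { t with
    τ := σ⁻¹ * t.τ
    hx := by simp [h, t.hx]
    hy := by simp [h, t.hy]
    hz := by simp [h, t.hz] }

/-- The relations between two-vertex trees: linearity in the two vertices, and equivariance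
at the upper vertex.  (Equivariance at the root only serves to bring the inner vertex to the
left and has no instance here.) -/
inductive Rel (E : BinSMod k C) (c : Fin 3 → C) (d : C) (n : ℤ) : (Comb E c d n →₀ k) → Prop
  | root_add (τ : Equiv.Perm (Fin 3)) {x y z e : C} (hx : c (τ 0) = x) (hy : c (τ 1) = y)
      (hz : c (τ 2) = z) {i j : ℤ} (hn : i + j = n) (μ μ' : E.M i e z d) (ν : E.M j x y e) :
      Rel E c d n (Finsupp.single ⟨τ, hx, hy, hz, hn, μ + μ', ν⟩ 1
        - Finsupp.single ⟨τ, hx, hy, hz, hn, μ, ν⟩ 1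
        - Finsupp.single ⟨τ, hx, hy, hz, hn, μ', ν⟩ 1)
  | root_smul (τ : Equiv.Perm (Fin 3)) {x y z e : C} (hx : c (τ 0) = x) (hy : c (τ 1) = y)
      (hz : c (τ 2) = z) {i j : ℤ} (hn : i + j = n) (r : k) (μ : E.M i e z d) (ν : E.M j x y e) :
      Rel E c d n (Finsupp.single ⟨τ, hx, hy, hz, hn, r • μ, ν⟩ 1
        - Finsupp.single ⟨τ, hx, hy, hz, hn, μ, ν⟩ r)
  | top_add (τ : Equiv.Perm (Fin 3)) {x y z e : C} (hx : c (τ 0) = x) (hy : c (τ 1) = y)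
      (hz : c (τ 2) = z) {i j : ℤ} (hn : i + j = n) (μ : E.M i e z d) (ν ν' : E.M j x y e) :
      Rel E c d n (Finsupp.single ⟨τ, hx, hy, hz, hn, μ, ν + ν'⟩ 1
        - Finsupp.single ⟨τ, hx, hy, hz, hn, μ, ν⟩ 1
        - Finsupp.single ⟨τ, hx, hy, hz, hn, μ, ν'⟩ 1)
  | top_smul (τ : Equiv.Perm (Fin 3)) {x y z e : C} (hx : c (τ 0) = x) (hy : c (τ 1) = y)
      (hz : c (τ 2) = z) {i j : ℤ} (hn : i + j = n) (r : k) (μ : E.M i e z d) (ν : E.M j x y e) :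
      Rel E c d n (Finsupp.single ⟨τ, hx, hy, hz, hn, μ, r • ν⟩ 1
        - Finsupp.single ⟨τ, hx, hy, hz, hn, μ, ν⟩ r)
  | top_swap (τ : Equiv.Perm (Fin 3)) {x y z e : C} (hx : c (τ 0) = x) (hy : c (τ 1) = y)
      (hz : c (τ 2) = z) {i j : ℤ} (hn : i + j = n) (μ : E.M i e z d) (ν : E.M j x y e) :
      Rel E c d n (Finsupp.single ⟨τ, hx, hy, hz, hn, μ, ν⟩ 1
        - Finsupp.single ⟨τ * Equiv.swap 0 1, by simpa using hy, by simpa using hx,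
            by rw [Equiv.Perm.mul_apply, Equiv.swap_apply_of_ne_of_ne] <;> simp [hz],
            hn, μ, E.swap ν⟩ 1)

end Comb

/-- The weight two part `F⁽²⁾(E)(c₀, c₁, c₂; d)` of the free operad, in degree `n`. -/
abbrev Quad (E : BinSMod k C) (c : Fin 3 → C) (d : C) (n : ℤ) : Type u :=
  (Comb E c d n →₀ k) ⧸ Submodule.span k {r | Comb.Rel E c d n r}

namespace Quad

variable {E : BinSMod k C}

/-- The class of a tree. -/
noncomputable def mk {c : Fin 3 → C} {d : C} {n : ℤ} (t : Comb E c d n) : Quad E c d n :=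
  Submodule.Quotient.mk (Finsupp.single t 1)

/-- `μ(ν ⊗ id)` -/
noncomputable def left {x y z e d : C} {i j n : ℤ} (μ : E.M i e z d) (ν : E.M j x y e)
    (hn : i + j = n) : Quad E ![x, y, z] d n :=
  mk ⟨1, rfl, rfl, rfl, hn, μ, ν⟩

/-- `μ(id ⊗ ν)`, which is `(μ · (21))(ν ⊗ id)` with the leaves of `ν` labelled `1, 2` and the
remaining leaf labelled `0`. -/
noncomputable def right {x y z e d : C} {i j n : ℤ} (μ : E.M i x e d) (ν : E.M j y z e)
    (hn : i + j = n) : Quad E ![x, y, z] d n :=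
  mk ⟨finRotate 3, rfl, rfl, rfl, hn, E.swap μ, ν⟩

/-- The right action of `σ ∈ S₃` on `F⁽²⁾(E)`. -/
noncomputable def act {c c' : Fin 3 → C} {d : C} {n : ℤ} (σ : Equiv.Perm (Fin 3))
    (h : ∀ i, c' i = c (σ i)) : Quad E c d n →ₗ[k] Quad E c' d n :=
  Submodule.mapQ _ _ (Finsupp.lmapDomain k k (Comb.act σ h)) <| by
    rw [Submodule.span_le]
    rintro _ (⟨τ, hx, hy, hz, hn, μ, μ', ν⟩ | ⟨τ, hx, hy, hz, hn, r, μ, ν⟩ |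
      ⟨τ, hx, hy, hz, hn, μ, ν, ν'⟩ | ⟨τ, hx, hy, hz, hn, r, μ, ν⟩ | ⟨τ, hx, hy, hz, hn, μ, ν⟩)
    all_goals
      refine Submodule.subset_span ?_
      simp only [map_sub, Finsupp.lmapDomain_apply, Finsupp.mapDomain_single]
    · exact Comb.Rel.root_add (σ⁻¹ * τ) _ _ _ hn μ μ' ν
    · exact Comb.Rel.root_smul (σ⁻¹ * τ) _ _ _ hn r μ ν
    · exact Comb.Rel.top_add (σ⁻¹ * τ) _ _ _ hn μ ν ν'
    · exact Comb.Rel.top_smul (σ⁻¹ * τ) _ _ _ hn r μ ν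
    · exact Comb.Rel.top_swap (σ⁻¹ * τ) (by simp [h, hx]) (by simp [h, hy]) (by simp [h, hz])
        hn μ ν

/-- Transport between components of `E` with equal indices. -/
def cast {n m : ℤ} {a b d a' b' d' : C} (h : m = n ∧ a' = a ∧ b' = b ∧ d' = d)
    (μ : E.M m a' b' d') : E.M n a b d :=
  h.1 ▸ h.2.1 ▸ h.2.2.1 ▸ h.2.2.2 ▸ μ

open Classical in
/-- The evaluation of `E^∨` on `E`, extended by zero to elements of components that are not dual
to each other. -/
noncomputable def eval {n m : ℤ} {a b d a' b' d' : C} (α : E.dual.M n a b d)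
    (μ : E.M m a' b' d') : k :=
  if h : m = -n ∧ a' = a ∧ b' = b ∧ d' = d then
    (show Module.Dual k (E.M (-n) a b d) from α) (cast h μ)
  else 0

section
variable {n m : ℤ} {a b d a' b' d' : C}

theorem eval_add_right (α : E.dual.M n a b d) (μ μ' : E.M m a' b' d') :
    eval α (μ + μ') = eval α μ + eval α μ' := by
  unfold eval
  split_ifs with h
  · obtain ⟨rfl, rfl, rfl, rfl⟩ := h
    exact map_add _ _ _
  · simp

theorem eval_smul_right (α : E.dual.M n a b d) (r : k) (μ : E.M m a' b' d') :
    eval α (r • μ) = r * eval α μ := by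
  unfold eval
  split_ifs with h
  · obtain ⟨rfl, rfl, rfl, rfl⟩ := h
    exact map_smul (show Module.Dual k (E.M (-n) _ _ _) from α) _ _
  · simp

theorem eval_add_left (α α' : E.dual.M n a b d) (μ : E.M m a' b' d') :
    eval (α + α') μ = eval α μ + eval α' μ := by
  unfold eval
  split_ifs with h
  · rfl
  · simp

theorem eval_smul_left (r : k) (α : E.dual.M n a b d) (μ : E.M m a' b' d') :
    eval (r • α) μ = r * eval α μ := by
  unfold eval
  split_ifs with h
  · rfl
  · simp

theorem eval_swap (α : E.dual.M n a b d) (μ : E.M m a' b' d') :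
    eval (E.dual.swap α) μ = -eval α (E.swap μ) := by
  unfold eval
  by_cases h : m = -n ∧ a' = b ∧ b' = a ∧ d' = d
  · obtain ⟨rfl, rfl, rfl, rfl⟩ := h
    simp only [and_self, dite_true]
    rfl
  · rw [dif_neg h, dif_neg (by tauto), neg_zero]

end

open Classical in
/-- The pairing of two trees.  Trees with different underlying labelled trees pair to zero, and
`⟨μ(ν ⊗ id), α(β ⊗ id)⟩ = (-1)^{|μ||β|} α(μ) β(ν)` for trees with the same labels in a cyclic
order.  The values on the other pairs of trees are forced by equivariance at the upper
vertex; this is where `sgn τ` comes from. -/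
noncomputable def pairComb {c : Fin 3 → C} {d : C} {n m : ℤ} (t : Comb E c d n)
    (s : Comb E.dual c d m) : k :=
  ((Equiv.Perm.sign t.τ : ℤ) : k) * (-1 : k) ^ (t.i * s.j) * eval s.μ t.μ *
    ((if s.τ = t.τ then eval s.ν t.ν else 0) +
      (if s.τ = t.τ * Equiv.swap 0 1 then eval (E.dual.swap s.ν) t.ν else 0))

/-- The pairing `F⁽²⁾(E) ⊗ F⁽²⁾(E^∨) → k`. -/
noncomputable def pairing {c : Fin 3 → C} {d : C} {n m : ℤ} :
    Quad E c d n →ₗ[k] Quad E.dual c d m →ₗ[k] k :=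
  (Submodule.liftQ _ (Submodule.liftQ _
    (Finsupp.linearCombination k fun t : Comb E c d n =>
      (Finsupp.linearCombination k fun s : Comb E.dual c d m => pairComb t s))
    (by
      rw [Submodule.span_le]
      rintro _ (⟨τ, hx, hy, hz, hn, μ, μ', ν⟩ | ⟨τ, hx, hy, hz, hn, r, μ, ν⟩ |
        ⟨τ, hx, hy, hz, hn, μ, ν, ν'⟩ | ⟨τ, hx, hy, hz, hn, r, μ, ν⟩ | ⟨τ, hx, hy, hz, hn, μ, ν⟩)
      all_goals
        rw [SetLike.mem_coe, LinearMap.mem_ker]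
        ext s
        simp only [map_sub, Finsupp.linearCombination_single, LinearMap.comp_apply,
          LinearMap.sub_apply, LinearMap.smul_apply, Finsupp.lsingle_apply, smul_eq_mul, one_mul,
          LinearMap.zero_apply, pairComb]
      · rw [eval_add_right]; ring
      · rw [eval_smul_right]; ring
      · simp only [eval_add_right]; split_ifs <;> ring
      · simp only [eval_smul_right]; split_ifs <;> ring
      · have h1 : τ * Equiv.swap 0 1 * Equiv.swap 0 1 = τ := by simp [mul_assoc]
        simp only [h1, Equiv.Perm.sign_mul, Equiv.Perm.sign_swap (show (0 : Fin 3) ≠ 1 by decide),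
          eval_swap, E.swap_swap]
        split_ifs <;> push_cast <;> ring)).flip
    (by
      rw [Submodule.span_le]
      rintro _ (⟨τ, hx, hy, hz, hn, μ, μ', ν⟩ | ⟨τ, hx, hy, hz, hn, r, μ, ν⟩ |
        ⟨τ, hx, hy, hz, hn, μ, ν, ν'⟩ | ⟨τ, hx, hy, hz, hn, r, μ, ν⟩ | ⟨τ, hx, hy, hz, hn, μ, ν⟩)
      all_goals
        rw [SetLike.mem_coe, LinearMap.mem_ker]
        ext t
        simp only [map_sub, Finsupp.linearCombination_single, LinearMap.comp_apply,
          LinearMap.sub_apply, Finsupp.lsingle_apply, smul_eq_mul, one_mul,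
          LinearMap.zero_apply, LinearMap.flip_apply, Submodule.liftQ_apply,
          Submodule.mkQ_apply, one_smul, pairComb]
      · rw [eval_add_left]; ring
      · rw [eval_smul_left]; ring
      · simp only [map_add, eval_add_left]; split_ifs <;> ring
      · simp only [map_smul, eval_smul_left]; split_ifs <;> ring
      · have h1 : τ * Equiv.swap 0 1 = t.τ ↔ τ = t.τ * Equiv.swap 0 1 := by
          constructor
          · intro h; rw [← h]; simp [mul_assoc]
          · intro h; rw [h]; simp [mul_assoc]
        have h2 : τ * Equiv.swap 0 1 = t.τ * Equiv.swap 0 1 ↔ τ = t.τ := mul_left_inj _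
        simp only [h1, h2, E.dual.swap_swap]
        split_ifs <;> ring)).flip

theorem pairing_act {c c' : Fin 3 → C} {d : C} {n m : ℤ} (σ : Equiv.Perm (Fin 3))
    (h : ∀ i, c' i = c (σ i)) (x : Quad E c d n) (y : Quad E.dual c d m) :
    pairing (act σ h x) (act σ h y) = ((Equiv.Perm.sign σ : ℤ) : k) * pairing x y := by
  obtain ⟨x, rfl⟩ := Submodule.Quotient.mk_surjective _ x
  obtain ⟨y, rfl⟩ := Submodule.Quotient.mk_surjective _ y
  induction x using Finsupp.induction_linear with
  | zero => simp
  | add x x' hx hx' =>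
    simp only [Submodule.Quotient.mk_add, map_add, LinearMap.add_apply, mul_add, hx, hx']
  | single t r =>
    induction y using Finsupp.induction_linear with
    | zero => simp
    | add y y' hy hy' =>
      simp only [Submodule.Quotient.mk_add, map_add, mul_add, hy, hy']
    | single s r' =>
      simp only [act, Submodule.mapQ_apply, Finsupp.lmapDomain_apply, Finsupp.mapDomain_single,
        pairing, LinearMap.flip_apply, Submodule.liftQ_apply, Finsupp.linearCombination_single,
        LinearMap.smul_apply, smul_eq_mul, pairComb, Comb.act, mul_assoc, mul_right_inj,
        Equiv.Perm.sign_mul, Equiv.Perm.sign_inv, Units.val_mul, Int.cast_mul]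
      ring

end Quad

/-- Binary quadratic data `(E, R)`: `R` is a sub-`𝕊`-module of `F⁽²⁾(E)`. -/
structure BinaryQuadraticData (k : Type u) [Field k] (C : Type) where
  E : BinSMod k C
  R (c : Fin 3 → C) (d : C) (n : ℤ) : Submodule k (Quad E c d n)
  act_mem {c c' : Fin 3 → C} {d : C} {n : ℤ} (σ : Equiv.Perm (Fin 3)) (h : ∀ i, c' i = c (σ i))
    {x : Quad E c d n} : x ∈ R c d n → Quad.act σ h x ∈ R c' d n

theorem Quad.act_act {E : BinSMod k C} {c c' c'' : Fin 3 → C} {d : C} {n : ℤ}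
    (σ ρ : Equiv.Perm (Fin 3)) (h : ∀ i, c' i = c (σ i)) (h' : ∀ i, c'' i = c' (ρ i))
    (x : Quad E c d n) :
    Quad.act ρ h' (Quad.act σ h x) = Quad.act (σ * ρ) (fun i => by simp [h, h']) x := by
  obtain ⟨x, rfl⟩ := Submodule.Quotient.mk_surjective _ x
  simp only [Quad.act, Submodule.mapQ_apply, Finsupp.lmapDomain_apply, ← Finsupp.mapDomain_comp]
  congr 2

theorem Quad.act_of_eq_one {E : BinSMod k C} {c : Fin 3 → C} {d : C} {n : ℤ}
    {σ : Equiv.Perm (Fin 3)} (hσ : σ = 1) (h : ∀ i, c i = c (σ i)) (x : Quad E c d n) :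
    Quad.act σ h x = x := by
  subst hσ
  obtain ⟨x, rfl⟩ := Submodule.Quotient.mk_surjective _ x
  have h1 : Comb.act (E := E) (d := d) (n := n) 1 h = id := by
    funext t
    simp [Comb.act]
  simp [Quad.act, h1]

namespace BinaryQuadraticData

/-- The data `(E, R)` where `R` is the sub-`𝕊`-module generated by the set `S` of relators. -/
noncomputable def generated (E : BinSMod k C) (S : ∀ (c : Fin 3 → C) (d : C) (n : ℤ), Quad E c d n → Prop) :
    BinaryQuadraticData k C where
  E := E
  R c d n := Submodule.span k {y | ∃ (c₀ : Fin 3 → C) (σ : Equiv.Perm (Fin 3))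
    (h : ∀ i, c i = c₀ (σ i)) (x : Quad E c₀ d n), S c₀ d n x ∧ y = Quad.act σ h x}
  act_mem {c c' d n} σ h x hx := by
    induction hx using Submodule.span_induction with
    | mem y hy =>
      obtain ⟨c₀, ρ, h', x, hx, rfl⟩ := hy
      exact Submodule.subset_span ⟨c₀, ρ * σ, fun i => by simp [h, h'], x, hx,
        Quad.act_act _ _ _ _ _⟩
    | zero => simp
    | add x y _ _ hx hy => rw [map_add]; exact add_mem hx hy
    | smul r x _ hx => rw [map_smul]; exact Submodule.smul_mem _ _ hx

/-- The quadratic data `(E^∨, R^⊥)` of the Koszul dual operad. -/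
noncomputable def koszulDual (Q : BinaryQuadraticData k C) : BinaryQuadraticData k C where
  E := Q.E.dual
  R c d n :=
    { carrier := {y | ∀ (m : ℤ), ∀ x ∈ Q.R c d m, Quad.pairing x y = 0}
      zero_mem' := fun _ _ _ => map_zero _
      add_mem' := fun hy hy' m x hx => by rw [map_add, hy m x hx, hy' m x hx, add_zero]
      smul_mem' := fun r y hy m x hx => by rw [map_smul, hy m x hx, smul_zero] }
  act_mem {c c' d n} σ h y hy m x hx := by
    have h' : ∀ i, c i = c' (σ⁻¹ i) := fun i => by simp [h]
    have key := Quad.pairing_act σ h (Quad.act σ⁻¹ h' x) y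
    rwa [hy m _ (Q.act_mem σ⁻¹ h' hx), mul_zero, (Quad.act_act σ⁻¹ σ h' h x).trans
      (Quad.act_of_eq_one (inv_mul_cancel σ) _ x)] at key

end BinaryQuadraticData

/-! ### The operad `F(E, R) = F(E)/(R)` -/

/-- Formal operadic monomials in the generators `E`. -/
inductive Term (E : BinSMod k C) : (X : Type) → (X → C) → C → ℤ → Type (max 1 u)
  | unit (d : C) : Term E Unit (fun _ => d) d 0
  | gen {a b d : C} {n : ℤ} (e : E.M n a b d) : Term E (Fin 2) ![a, b] d n
  | relabel {X Y : Type} (e : X ≃ Y) {c : X → C} {c' : Y → C} (hc : ∀ x, c' (e x) = c x)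
      {d : C} {n : ℤ} (t : Term E X c d n) : Term E Y c' d n
  | comp {X Y : Type} (x : X) {c : X → C} {b : Y → C} {a d : C} {m n N : ℤ} (hx : c x = a)
      (hN : m + n = N) (t : Term E X c d m) (s : Term E Y b a n) :
      Term E ({i : X // i ≠ x} ⊕ Y) (Sum.elim (fun i => c i.1) b) d N

/-- The labels of the leaves of `μ(ν ⊗ id)`. -/
def combEquiv : {i : Fin 2 // i ≠ 0} ⊕ Fin 2 ≃ Fin 3 where
  toFun
    | Sum.inl _ => 2
    | Sum.inr j => j.castSucc
  invFun
    | 0 => Sum.inr 0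
    | 1 => Sum.inr 1
    | 2 => Sum.inl ⟨1, by decide⟩
  left_inv := by decide
  right_inv := by decide

/-- The monomial of a two-vertex tree. -/
def Comb.toTerm {E : BinSMod k C} {c : Fin 3 → C} {d : C} {n : ℤ} (t : Comb E c d n) :
    Term E (Fin 3) c d n :=
  Term.relabel (combEquiv.trans t.τ)
    (by
      rintro (⟨i, hi⟩ | j)
      · obtain rfl : i = 1 := by omega
        exact t.hz
      · fin_cases j
        · exact t.hx
        · exact t.hy)
    (Term.comp (0 : Fin 2) rfl t.hn (Term.gen t.μ) (Term.gen t.ν))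

section
variable {E : BinSMod k C}

/-- Relabelling of linear combinations of monomials. -/
noncomputable def rawRelabel {X Y : Type} (e : X ≃ Y) {c : X → C} {c' : Y → C}
    (hc : ∀ x, c' (e x) = c x) {d : C} {n : ℤ} :
    (Term E X c d n →₀ k) →ₗ[k] (Term E Y c' d n →₀ k) :=
  Finsupp.lmapDomain k k (Term.relabel e hc)

/-- Partial composition of linear combinations of monomials. -/
noncomputable def rawComp {X Y : Type} (x : X) {c : X → C} {b : Y → C} {a d : C} {m n N : ℤ}
    (hx : c x = a) (hN : m + n = N) :
    (Term E X c d m →₀ k) →ₗ[k] (Term E Y b a n →₀ k) →ₗ[k]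
      (Term E ({i : X // i ≠ x} ⊕ Y) (Sum.elim (fun i => c i.1) b) d N →₀ k) :=
  Finsupp.linearCombination k fun t => Finsupp.lmapDomain k k (Term.comp x hx hN t)

end

/-- The linear combinations of monomials that vanish in `F(E)/(R)`: the smallest operadic ideal
containing the operad axioms, the relations of the `𝕊`-module `E`, and `R`. -/
inductive Vanish (Q : BinaryQuadraticData k C) : ∀ {X : Type} {c : X → C} {d : C} {n : ℤ},
    (Term Q.E X c d n →₀ k) → Prop
  | zero {X : Type} {c : X → C} {d : C} {n : ℤ} : Vanish Q (0 : Term Q.E X c d n →₀ k)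
  | add {X : Type} {c : X → C} {d : C} {n : ℤ} {p q : Term Q.E X c d n →₀ k} :
      Vanish Q p → Vanish Q q → Vanish Q (p + q)
  | smul {X : Type} {c : X → C} {d : C} {n : ℤ} (r : k) {p : Term Q.E X c d n →₀ k} :
      Vanish Q p → Vanish Q (r • p)
  | relabel {X Y : Type} (e : X ≃ Y) {c : X → C} {c' : Y → C} (hc : ∀ x, c' (e x) = c x)
      {d : C} {n : ℤ} {p : Term Q.E X c d n →₀ k} :
      Vanish Q p → Vanish Q (rawRelabel e hc p)
  | comp_left {X Y : Type} (x : X) {c : X → C} {b : Y → C} {a d : C} {m n N : ℤ}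
      (hx : c x = a) (hN : m + n = N) {p : Term Q.E X c d m →₀ k} (q : Term Q.E Y b a n →₀ k) :
      Vanish Q p → Vanish Q (rawComp x hx hN p q)
  | comp_right {X Y : Type} (x : X) {c : X → C} {b : Y → C} {a d : C} {m n N : ℤ}
      (hx : c x = a) (hN : m + n = N) (p : Term Q.E X c d m →₀ k) {q : Term Q.E Y b a n →₀ k} :
      Vanish Q q → Vanish Q (rawComp x hx hN p q)
  | relabel_refl {X : Type} {c : X → C} {d : C} {n : ℤ} (p : Term Q.E X c d n) :
      Vanish Q (Finsupp.single (Term.relabel (Equiv.refl X) (refl_color c) p) 1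
        - Finsupp.single p 1)
  | relabel_trans {X Y Z : Type} (e : X ≃ Y) (f : Y ≃ Z)
      {c : X → C} {c' : Y → C} {c'' : Z → C} (hc : ∀ x, c' (e x) = c x)
      (hc' : ∀ y, c'' (f y) = c' y) {d : C} {n : ℤ} (p : Term Q.E X c d n) :
      Vanish Q (Finsupp.single (Term.relabel f hc' (Term.relabel e hc p)) 1
        - Finsupp.single (Term.relabel (e.trans f) (trans_color hc hc') p) 1)
  | comp_relabel {X X' Y Y' : Type} (e : X ≃ X') (f : Y ≃ Y') {c : X → C} {c' : X' → C}
      {b : Y → C} {b' : Y' → C} (hc : ∀ x, c' (e x) = c x) (hb : ∀ y, b' (f y) = b y)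
      {a d : C} {m n N : ℤ} (x : X) (hx : c x = a) (hN : m + n = N)
      (p : Term Q.E X c d m) (q : Term Q.E Y b a n) :
      Vanish Q (Finsupp.single (Term.comp (e x) ((hc x).trans hx) hN (Term.relabel e hc p)
            (Term.relabel f hb q)) 1
        - Finsupp.single (Term.relabel (compEquiv e f x) (comp_color hc hb x) (Term.comp x hx hN p q)) 1)
  | comp_seq {X Y Z : Type} {c : X → C} {b : Y → C} {g : Z → C}
      {a a' d : C} {l m n lm mn N : ℤ} (x : X) (y : Y) (hx : c x = a) (hy : b y = a')
      (h₁ : l + m = lm) (h₂ : lm + n = N) (h₃ : m + n = mn) (h₄ : l + mn = N)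
      (p : Term Q.E X c d l) (q : Term Q.E Y b a m) (r : Term Q.E Z g a' n) :
      Vanish Q (Finsupp.single (Term.relabel (seqEquiv Z x y) (seq_color c b g x y)
            (Term.comp (Sum.inr y) ((Sum.elim_inr _ _ _).trans hy) h₂ (Term.comp x hx h₁ p q) r)) 1
        - Finsupp.single (Term.comp x hx h₄ p (Term.comp y hy h₃ q r)) 1)
  | comp_par {X Y Z : Type} {c : X → C} {b : Y → C} {g : Z → C}
      {a a' d : C} {l m n lm ln N : ℤ} {x x' : X} (hxx' : x ≠ x') (hx : c x = a)
      (hx' : c x' = a') (h₁ : l + m = lm) (h₂ : lm + n = N) (h₃ : l + n = ln) (h₄ : ln + m = N)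
      (p : Term Q.E X c d l) (q : Term Q.E Y b a m) (r : Term Q.E Z g a' n) :
      Vanish Q (Finsupp.single (Term.relabel (parEquiv Y Z hxx') (par_color c b g hxx')
            (Term.comp (Sum.inl ⟨x', hxx'.symm⟩) ((Sum.elim_inl _ _ _).trans hx') h₂ (Term.comp x hx h₁ p q) r)) 1
        - Finsupp.single (Term.comp (Sum.inl ⟨x, hxx'⟩) ((Sum.elim_inl _ _ _).trans hx) h₄ (Term.comp x' hx' h₃ p r) q)
            ((-1 : k) ^ (m * n)))
  | unit_comp {X : Type} {c : X → C} {d : C} {n : ℤ} (p : Term Q.E X c d n) :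
      Vanish Q (Finsupp.single (Term.relabel (unitLeftEquiv X) (unitLeft_color d c)
            (Term.comp () rfl (zero_add n) (Term.unit d) p)) 1
        - Finsupp.single p 1)
  | comp_unit {X : Type} {c : X → C} {d : C} {n : ℤ} (x : X) (p : Term Q.E X c d n) :
      Vanish Q (Finsupp.single (Term.relabel (unitRightEquiv x) (unitRight_color c x)
            (Term.comp x rfl (add_zero n) p (Term.unit (c x)))) 1
        - Finsupp.single p 1)
  | gen_add {a b d : C} {n : ℤ} (e e' : Q.E.M n a b d) :
      Vanish Q (Finsupp.single (Term.gen (e + e')) 1 - Finsupp.single (Term.gen e) 1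
        - Finsupp.single (Term.gen e') 1)
  | gen_smul {a b d : C} {n : ℤ} (r : k) (e : Q.E.M n a b d) :
      Vanish Q (Finsupp.single (Term.gen (r • e)) 1 - Finsupp.single (Term.gen e) r)
  | gen_swap {a b d : C} {n : ℤ} (e : Q.E.M n a b d) :
      Vanish Q (Finsupp.single (Term.relabel (Equiv.swap 0 1) (swap_color a b) (Term.gen e)) 1
        - Finsupp.single (Term.gen (Q.E.swap e)) 1)
  | rel {c : Fin 3 → C} {d : C} {n : ℤ} (r : Comb Q.E c d n →₀ k)
      (hr : Submodule.Quotient.mk r ∈ Q.R c d n) :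
      Vanish Q (Finsupp.mapDomain Comb.toTerm r)

namespace BinaryQuadraticData

variable (Q : BinaryQuadraticData k C)

/-- The vanishing combinations as a subspace. -/
def vanishing (X : Type) (c : X → C) (d : C) (n : ℤ) : Submodule k (Term Q.E X c d n →₀ k) where
  carrier := {p | Vanish Q p}
  zero_mem' := Vanish.zero
  add_mem' := Vanish.add
  smul_mem' r _ := Vanish.smul r

/-- The component of `F(E)/(R)` with inputs `(X, c)`, output `d`, in degree `n`. -/
abbrev PresOp (X : Type) (c : X → C) (d : C) (n : ℤ) : Type (max 1 u) :=
  (Term Q.E X c d n →₀ k) ⧸ Q.vanishing X c d n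

/-- Relabelling in `F(E)/(R)`. -/
noncomputable def presRelabel {X Y : Type} (e : X ≃ Y) {c : X → C} {c' : Y → C}
    (hc : ∀ x, c' (e x) = c x) {d : C} {n : ℤ} : Q.PresOp X c d n →ₗ[k] Q.PresOp Y c' d n :=
  Submodule.mapQ _ _ (rawRelabel e hc) fun _ hp => Vanish.relabel e hc hp

/-- Partial composition in `F(E)/(R)`. -/
noncomputable def presComp {X Y : Type} (x : X) {c : X → C} {b : Y → C} {a d : C} {m n N : ℤ}
    (hx : c x = a) (hN : m + n = N) :
    Q.PresOp X c d m →ₗ[k] Q.PresOp Y b a n →ₗ[k]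
      Q.PresOp ({i : X // i ≠ x} ⊕ Y) (Sum.elim (fun i => c i.1) b) d N :=
  (Submodule.liftQ _ (Submodule.liftQ _ ((rawComp x hx hN).compr₂ (Submodule.mkQ _))
    (fun p hp => by
      rw [LinearMap.mem_ker]
      refine LinearMap.ext fun q => ?_
      exact (Submodule.Quotient.mk_eq_zero (Q.vanishing _ _ _ _)).2
        (Vanish.comp_left x hx hN q hp))).flip
    (fun q hq => by
      rw [LinearMap.mem_ker]
      refine LinearMap.ext fun p => ?_
      obtain ⟨p, rfl⟩ := Submodule.Quotient.mk_surjective _ p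
      exact (Submodule.Quotient.mk_eq_zero (Q.vanishing _ _ _ _)).2 (Vanish.comp_right x hx hN p hq))).flip

/-- The class of a monomial. -/
noncomputable def cls {X : Type} {c : X → C} {d : C} {n : ℤ} (t : Term Q.E X c d n) :
    Q.PresOp X c d n :=
  Submodule.Quotient.mk (Finsupp.single t 1)

theorem presOp_induction {X : Type} {c : X → C} {d : C} {n : ℤ} {motive : Q.PresOp X c d n → Prop}
    (p : Q.PresOp X c d n) (zero : motive 0) (add : ∀ p q, motive p → motive q → motive (p + q))
    (smul : ∀ (r : k) p, motive p → motive (r • p)) (cls : ∀ t, motive (Q.cls t)) : motive p := by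
  obtain ⟨p, rfl⟩ := Submodule.Quotient.mk_surjective _ p
  induction p using Finsupp.induction_linear with
  | zero => exact zero
  | add x y hx hy => exact add _ _ hx hy
  | single t r =>
    have := smul r _ (cls t)
    rwa [BinaryQuadraticData.cls, ← Submodule.Quotient.mk_smul, Finsupp.smul_single, smul_eq_mul,
      mul_one] at this

theorem presRelabel_cls {X Y : Type} (e : X ≃ Y) {c : X → C} {c' : Y → C}
    (hc : ∀ x, c' (e x) = c x) {d : C} {n : ℤ} (t : Term Q.E X c d n) :
    Q.presRelabel e hc (Q.cls t) = Q.cls (Term.relabel e hc t) := by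
  simp [presRelabel, cls, rawRelabel]

theorem presComp_cls {X Y : Type} (x : X) {c : X → C} {b : Y → C} {a d : C} {m n N : ℤ}
    (hx : c x = a) (hN : m + n = N) (t : Term Q.E X c d m) (s : Term Q.E Y b a n) :
    Q.presComp x hx hN (Q.cls t) (Q.cls s) = Q.cls (Term.comp x hx hN t s) := by
  simp [presComp, cls, rawComp]

theorem cls_eq_cls {X : Type} {c : X → C} {d : C} {n : ℤ} {t s : Term Q.E X c d n}
    (h : Vanish Q (Finsupp.single t 1 - Finsupp.single s 1)) : Q.cls t = Q.cls s :=
  (Submodule.Quotient.eq (Q.vanishing _ _ _ _)).2 h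

/-- The operad `F(E, R) = F(E)/(R)`. -/
noncomputable def operad : ColoredOperad.{u, max 1 u} k C where
  Op X _ c d n := Q.PresOp X c d n
  unit d := Q.cls (Term.unit d)
  relabel e _ _ hc _ _ := Q.presRelabel e hc
  comp x _ _ _ _ _ _ _ hx hN := Q.presComp x hx hN
  relabel_refl p := by
    induction p using Q.presOp_induction with
    | zero => simp
    | add p q hp hq => simp only [map_add, hp, hq]
    | smul r p hp => simp only [map_smul, hp]
    | cls t => rw [presRelabel_cls]; exact Q.cls_eq_cls (Vanish.relabel_refl t)
  relabel_trans e f _ _ _ hc hc' _ _ p := by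
    induction p using Q.presOp_induction with
    | zero => simp
    | add p q hp hq => simp only [map_add, hp, hq]
    | smul r p hp => simp only [map_smul, hp]
    | cls t => simp only [presRelabel_cls]; exact Q.cls_eq_cls (Vanish.relabel_trans e f hc hc' t)
  comp_relabel e f _ _ _ _ hc hb _ _ _ _ _ x hx hN p q := by
    induction p using Q.presOp_induction with
    | zero => simp
    | add p p' hp hp' => simp only [map_add, LinearMap.add_apply, hp, hp']
    | smul r p hp => simp only [map_smul, LinearMap.smul_apply, hp]
    | cls t =>
      induction q using Q.presOp_induction with
      | zero => simp
      | add q q' hq hq' => simp only [map_add, hq, hq']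
      | smul r q hq => simp only [map_smul, hq]
      | cls s =>
        simp only [presRelabel_cls, presComp_cls]
        exact Q.cls_eq_cls (Vanish.comp_relabel e f hc hb x hx hN t s)
  comp_seq x y hx hy h₁ h₂ h₃ h₄ p q r := by
    induction p using Q.presOp_induction with
    | zero => simp
    | add p p' hp hp' => simp only [map_add, LinearMap.add_apply, hp, hp']
    | smul r p hp => simp only [map_smul, LinearMap.smul_apply, hp]
    | cls t =>
      induction q using Q.presOp_induction with
      | zero => simp
      | add q q' hq hq' => simp only [map_add, LinearMap.add_apply, hq, hq']
      | smul r q hq => simp only [map_smul, LinearMap.smul_apply, hq]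
      | cls s =>
        induction r using Q.presOp_induction with
        | zero => simp
        | add q q' hq hq' => simp only [map_add, hq, hq']
        | smul r q hq => simp only [map_smul, hq]
        | cls s' =>
          simp only [presComp_cls, presRelabel_cls]
          exact Q.cls_eq_cls (Vanish.comp_seq x y hx hy h₁ h₂ h₃ h₄ t s s')
  comp_par {X Y Z _ _ _ c b g a a' d l m n lm ln N x x'} hxx' hx hx' h₁ h₂ h₃ h₄ p q r := by
    induction p using Q.presOp_induction with
    | zero => simp
    | add p p' hp hp' => simp only [map_add, LinearMap.add_apply, smul_add, hp, hp']
    | smul r p hp =>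
      simp only [map_smul, LinearMap.smul_apply, hp]
      rw [smul_comm]
    | cls t =>
      induction q using Q.presOp_induction with
      | zero => simp
      | add q q' hq hq' => simp only [map_add, LinearMap.add_apply, smul_add, hq, hq']
      | smul r q hq =>
        simp only [map_smul, LinearMap.smul_apply, hq]
        rw [smul_comm]
      | cls s =>
        induction r using Q.presOp_induction with
        | zero => simp
        | add q q' hq hq' => simp only [map_add, LinearMap.add_apply, smul_add, hq, hq']
        | smul r q hq =>
          simp only [map_smul, LinearMap.smul_apply, hq]
          rw [smul_comm]
        | cls s' =>
          simp only [presComp_cls, presRelabel_cls]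
          rw [cls, cls, ← Submodule.Quotient.mk_smul, Finsupp.smul_single, smul_eq_mul, mul_one]
          exact (Submodule.Quotient.eq (Q.vanishing _ _ _ _)).2
            (Vanish.comp_par hxx' hx hx' h₁ h₂ h₃ h₄ t s s')
  unit_comp p := by
    induction p using Q.presOp_induction with
    | zero => simp
    | add p q hp hq => simp only [map_add, hp, hq]
    | smul r p hp => simp only [map_smul, hp]
    | cls t =>
      simp only [presComp_cls, presRelabel_cls]
      exact Q.cls_eq_cls (Vanish.unit_comp t)
  comp_unit x p := by
    induction p using Q.presOp_induction with
    | zero => simp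
    | add p q hp hq => simp only [map_add, LinearMap.add_apply, hp, hq]
    | smul r p hp => simp only [map_smul, LinearMap.smul_apply, hp]
    | cls t =>
      simp only [presComp_cls, presRelabel_cls]
      exact Q.cls_eq_cls (Vanish.comp_unit x t)

/-- The generator `e ∈ E(a, b; d)` as an operation of `F(E)/(R)`. -/
noncomputable def gen {a b d : C} {n : ℤ} (e : Q.E.M n a b d) :
    Q.operad.Op (Fin 2) ![a, b] d n :=
  Q.cls (Term.gen e)

end BinaryQuadraticData

end

end Operads

namespace SwissCheese

open Operads

/-- The colours: closed and open. -/
inductive Color : Type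
  | cl
  | op

open Color

/-! ### The operad `sc^vor` -/

/-- The basis of `E_v = ⟨f₂, g₂, e₀₂, e₁₁⟩`; the primed elements are `e₀₂ · (21)` and
`e₁₁ · (21)`.  The indices are the degree, the two input colours and the output colour. -/
inductive GenV : ℤ → Color → Color → Color → Type
  | f₂ : GenV 0 cl cl cl
  | g₂ : GenV 1 cl cl cl
  | e₀₂ : GenV 0 op op op
  | e₀₂' : GenV 0 op op op
  | e₁₁ : GenV 0 cl op op
  | e₁₁' : GenV 0 op cl op

/-- The permutation `g ↦ ± g · (21)` of the basis. -/
def GenV.swap {n : ℤ} {a b d : Color} : GenV n a b d → GenV n b a d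
  | f₂ => f₂
  | g₂ => g₂
  | e₀₂ => e₀₂'
  | e₀₂' => e₀₂
  | e₁₁ => e₁₁'
  | e₁₁' => e₁₁

/-- The `𝕊`-module `E_v = ⟨f₂, g₂, e₀₂, e₁₁⟩`. -/
noncomputable def Ev (k : Type u) [Field k] : BinSMod k Color :=
  BinSMod.ofBasis GenV GenV.swap (fun _ => 1) (by rintro _ _ _ _ ⟨⟩ <;> rfl) (fun _ => rfl)

section
variable (k : Type u) [Field k]

/-- A basis element as an element of `E_v`. -/
noncomputable def GenV.el {n : ℤ} {a b d : Color} (g : GenV n a b d) : (Ev k).M n a b d :=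
  (Finsupp.single g 1 : GenV n a b d →₀ k)

variable {k}

/-- `x · (213)` for `x ∈ F⁽²⁾(E)(a, b, c; d)` -/
noncomputable def act213 {E : BinSMod k Color} {a b c d : Color} {n : ℤ}
    (x : Quad E ![a, b, c] d n) : Quad E ![b, a, c] d n :=
  Quad.act (Equiv.swap 0 1) (by intro i; fin_cases i <;> rfl) x

/-- `x · (231)` for `x ∈ F⁽²⁾(E)(a, b, c; d)` -/
noncomputable def act231 {E : BinSMod k Color} {a b c d : Color} {n : ℤ}
    (x : Quad E ![a, b, c] d n) : Quad E ![b, c, a] d n :=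
  Quad.act (finRotate 3) (by intro i; fin_cases i <;> rfl) x

/-- `x · (312)` for `x ∈ F⁽²⁾(E)(a, b, c; d)` -/
noncomputable def act312 {E : BinSMod k Color} {a b c d : Color} {n : ℤ}
    (x : Quad E ![a, b, c] d n) : Quad E ![c, a, b] d n :=
  Quad.act (finRotate 3)⁻¹ (by intro i; fin_cases i <;> rfl) x

variable (k)

/-- `μ(ν ⊗ id)` for basis elements of `E_v`, of total degree `n` -/
noncomputable def GenV.l {i j : ℤ} {x y z e d : Color} (n : ℤ) (μ : GenV i e z d)
    (ν : GenV j x y e) (h : i + j = n := by norm_num) : Quad (Ev k) ![x, y, z] d n :=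
  Quad.left (μ.el k) (ν.el k) h

/-- `μ(id ⊗ ν)` for basis elements of `E_v`, of total degree `n` -/
noncomputable def GenV.r {i j : ℤ} {x y z e d : Color} (n : ℤ) (μ : GenV i x e d)
    (ν : GenV j y z e) (h : i + j = n := by norm_num) : Quad (Ev k) ![x, y, z] d n :=
  Quad.right (μ.el k) (ν.el k) h

open GenV in
/-- The relators of `sc^vor`. -/
inductive RelV : ∀ (c : Fin 3 → Color) (d : Color) (n : ℤ), Quad (Ev k) c d n → Prop
  /-- `f₂(id ⊗ f₂) = f₂(f₂ ⊗ id)` -/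
  | f_assoc : RelV ![cl, cl, cl] cl 0 (f₂.r k 0 f₂ - f₂.l k 0 f₂)
  /-- `g₂(g₂ ⊗ id) · ((123) + (231) + (312)) = 0` -/
  | g_jacobi : RelV ![cl, cl, cl] cl 2
      (g₂.l k 2 g₂ + act231 (g₂.l k 2 g₂) + act312 (g₂.l k 2 g₂))
  /-- `g₂(id ⊗ f₂) = f₂(g₂ ⊗ id) + f₂(id ⊗ g₂) · (213)` -/
  | leibniz : RelV ![cl, cl, cl] cl 1
      (g₂.r k 1 f₂ - (f₂.l k 1 g₂ + act213 (f₂.r k 1 g₂)))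
  /-- `e₀₂(id ⊗ e₀₂) = e₀₂(e₀₂ ⊗ id)` -/
  | e_assoc : RelV ![op, op, op] op 0 (e₀₂.r k 0 e₀₂ - e₀₂.l k 0 e₀₂)
  /-- `e₁₁(id ⊗ e₁₁) = e₁₁(f₂ ⊗ id)` -/
  | action : RelV ![cl, cl, op] op 0 (e₁₁.r k 0 e₁₁ - e₁₁.l k 0 f₂)
  /-- `e₁₁(id ⊗ e₀₂) = e₀₂(e₁₁ ⊗ id)` -/
  | action_mul_left : RelV ![cl, op, op] op 0 (e₁₁.r k 0 e₀₂ - e₀₂.l k 0 e₁₁)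
  /-- `e₀₂(e₁₁ ⊗ id) = e₀₂(id ⊗ e₁₁) · (213)` -/
  | action_mul_right : RelV ![cl, op, op] op 0 (e₀₂.l k 0 e₁₁ - act213 (e₀₂.r k 0 e₁₁))

/-- The quadratic presentation `F(E_v, R_v)` of `sc^vor`, the homology of Voronov's Swiss-cheese
operad. -/
noncomputable def scvor : BinaryQuadraticData k Color :=
  BinaryQuadraticData.generated (Ev k) (RelV k)

/-- The element of `E_v^∨`, of degree `n = -|g|`, dual to the basis element `g` with respect to the
basis `f₂, g₂, e₀₂, e₀₂ · (21), e₁₁, e₁₁ · (21)` of `E_v`. -/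
noncomputable def GenV.dualEl {m : ℤ} {a b d : Color} (n : ℤ) (g : GenV m a b d)
    (h : m = -n := by norm_num) : (scvor k).koszulDual.E.M n a b d :=
  (Finsupp.lapply (h ▸ g) : (GenV (-n) a b d →₀ k) →ₗ[k] k)

/-- `𝔩₂`, dual to `f₂` -/
noncomputable def 𝔩₂ : (scvor k).koszulDual.E.M 0 cl cl cl := GenV.f₂.dualEl k 0

/-- `𝔠₂`, dual to `g₂` -/
noncomputable def 𝔠₂ : (scvor k).koszulDual.E.M (-1) cl cl cl := GenV.g₂.dualEl k (-1)

/-- `𝔫₀₂`, dual to `e₀₂` -/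
noncomputable def 𝔫₀₂ : (scvor k).koszulDual.E.M 0 op op op := GenV.e₀₂.dualEl k 0

/-- `𝔫₁₁`, dual to `e₁₁` -/
noncomputable def 𝔫₁₁ : (scvor k).koszulDual.E.M 0 cl op op := GenV.e₁₁.dualEl k 0

/-! ### The explicit presentation -/

/-- The basis of `E_{v^!} = ⟨𝔩₂, 𝔠₂, 𝔫₀₂, 𝔫₁₁⟩`; the primed elements are `𝔫₀₂ · (21)` and
`𝔫₁₁ · (21)`. -/
inductive GenD : ℤ → Color → Color → Color → Type
  | l₂ : GenD 0 cl cl cl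
  | c₂ : GenD (-1) cl cl cl
  | n₀₂ : GenD 0 op op op
  | n₀₂' : GenD 0 op op op
  | n₁₁ : GenD 0 cl op op
  | n₁₁' : GenD 0 op cl op

/-- The permutation `g ↦ ± g · (21)` of the basis. -/
def GenD.swap {n : ℤ} {a b d : Color} : GenD n a b d → GenD n b a d
  | l₂ => l₂
  | c₂ => c₂
  | n₀₂ => n₀₂'
  | n₀₂' => n₀₂
  | n₁₁ => n₁₁'
  | n₁₁' => n₁₁

/-- `𝔩₂` and `𝔠₂` span signature representations. -/
def GenD.sign {n : ℤ} {a b d : Color} : GenD n a b d → ℤˣ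
  | l₂ => -1
  | c₂ => -1
  | _ => 1

/-- The `𝕊`-module `E_{v^!} = ⟨𝔩₂, 𝔠₂, 𝔫₀₂, 𝔫₁₁⟩`. -/
noncomputable def Ed : BinSMod k Color :=
  BinSMod.ofBasis GenD GenD.swap GenD.sign (by rintro _ _ _ _ ⟨⟩ <;> rfl)
    (by rintro _ _ _ _ ⟨⟩ <;> rfl)

/-- A basis element as an element of `E_{v^!}`. -/
noncomputable def GenD.el {n : ℤ} {a b d : Color} (g : GenD n a b d) : (Ed k).M n a b d :=
  (Finsupp.single g 1 : GenD n a b d →₀ k)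

/-- `μ(ν ⊗ id)` for basis elements of `E_{v^!}`, of total degree `n` -/
noncomputable def GenD.l {i j : ℤ} {x y z e d : Color} (n : ℤ) (μ : GenD i e z d)
    (ν : GenD j x y e) (h : i + j = n := by norm_num) : Quad (Ed k) ![x, y, z] d n :=
  Quad.left (μ.el k) (ν.el k) h

/-- `μ(id ⊗ ν)` for basis elements of `E_{v^!}`, of total degree `n` -/
noncomputable def GenD.r {i j : ℤ} {x y z e d : Color} (n : ℤ) (μ : GenD i x e d)
    (ν : GenD j y z e) (h : i + j = n := by norm_num) : Quad (Ed k) ![x, y, z] d n :=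
  Quad.right (μ.el k) (ν.el k) h

open GenD in
/-- The relators of the dual presentation. -/
inductive RelD : ∀ (c : Fin 3 → Color) (d : Color) (n : ℤ), Quad (Ed k) c d n → Prop
  /-- `𝔠₂(id ⊗ 𝔠₂) = -𝔠₂(𝔠₂ ⊗ id)` -/
  | c_assoc : RelD ![cl, cl, cl] cl (-2) (c₂.r k (-2) c₂ + c₂.l k (-2) c₂)
  /-- `𝔩₂(𝔩₂ ⊗ id) · ((123) + (231) + (312)) = 0` -/
  | l_jacobi : RelD ![cl, cl, cl] cl 0
      (l₂.l k 0 l₂ + act231 (l₂.l k 0 l₂) + act312 (l₂.l k 0 l₂))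
  /-- `𝔩₂(id ⊗ 𝔠₂) = 𝔠₂(𝔩₂ ⊗ id) + 𝔠₂(id ⊗ 𝔩₂) · (213)` -/
  | leibniz : RelD ![cl, cl, cl] cl (-1)
      (l₂.r k (-1) c₂ - (c₂.l k (-1) l₂ + act213 (c₂.r k (-1) l₂)))
  /-- `𝔫₀₂(id ⊗ 𝔫₀₂) = 𝔫₀₂(𝔫₀₂ ⊗ id)` -/
  | n_assoc : RelD ![op, op, op] op 0 (n₀₂.r k 0 n₀₂ - n₀₂.l k 0 n₀₂)
  /-- `𝔫₁₁(𝔩₂ ⊗ id) = 𝔫₁₁(id ⊗ 𝔫₁₁) · (id - (213))` -/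
  | lie_action : RelD ![cl, cl, op] op 0
      (n₁₁.l k 0 l₂ - (n₁₁.r k 0 n₁₁ - act213 (n₁₁.r k 0 n₁₁)))
  /-- `𝔫₁₁(id ⊗ 𝔫₀₂) = 𝔫₀₂(𝔫₁₁ ⊗ id) + 𝔫₀₂(id ⊗ 𝔫₁₁) · (213)` -/
  | derivation : RelD ![cl, op, op] op 0
      (n₁₁.r k 0 n₀₂ - (n₀₂.l k 0 n₁₁ + act213 (n₀₂.r k 0 n₁₁)))
  /-- `𝔫₁₁(𝔠₂ ⊗ id) = 0` -/
  | kills_product : RelD ![cl, cl, op] op (-1) (n₁₁.l k (-1) c₂)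

/-- The quadratic data `(E_{v^!}, R_{v^!})`. -/
noncomputable def scvorDual : BinaryQuadraticData k Color :=
  BinaryQuadraticData.generated (Ed k) (RelD k)

end

/-! ### The explicit description of the algebras -/

section
variable {k : Type u} [Field k]

/-- Two inputs, as a family indexed by `Fin 2`. -/
def pair {V : Color → DGVec.{u, w} k} {a b : Color} (x : V a) (y : V b) :
    ∀ i : Fin 2, V (![a, b] i)
  | 0 => x
  | 1 => y

/-- The standard order on `Fin 2`. -/
def stdOrder : Enum (Fin 2) := ⟨[0, 1], by decide, by decide⟩

/-- A dg `ΛGer`-algebra: a bracket of degree `0` and a product `×` of degree `-1`. -/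
structure IsLambdaGer (H : DGVec.{u, w} k) (bracket times : H →ₗ[k] H →ₗ[k] H) : Prop where
  bracket_mem {i j : ℤ} {x y : H} :
    x ∈ H.gr i → y ∈ H.gr j → bracket x y ∈ H.gr (i + j)
  times_mem {i j : ℤ} {x y : H} :
    x ∈ H.gr i → y ∈ H.gr j → times x y ∈ H.gr (i + j - 1)
  bracket_d {i : ℤ} {x : H} (y : H) : x ∈ H.gr i →
    H.d (bracket x y) = bracket (H.d x) y + (-1 : k) ^ i • bracket x (H.d y)
  times_d {i : ℤ} {x : H} (y : H) : x ∈ H.gr i →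
    H.d (times x y) = -(times (H.d x) y + (-1 : k) ^ i • times x (H.d y))
  bracket_antisymm {i j : ℤ} {x y : H} : x ∈ H.gr i → y ∈ H.gr j →
    bracket x y = -((-1 : k) ^ (i * j) • bracket y x)
  times_antisymm {i j : ℤ} {x y : H} : x ∈ H.gr i → y ∈ H.gr j →
    times x y = -((-1 : k) ^ (i * j) • times y x)
  jacobi {i j l : ℤ} {x y z : H} : x ∈ H.gr i → y ∈ H.gr j → z ∈ H.gr l →
    bracket (bracket x y) z + (-1 : k) ^ (l * (i + j)) • bracket (bracket z x) y
      + (-1 : k) ^ (i * (j + l)) • bracket (bracket y z) x = 0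
  times_assoc {i : ℤ} {x : H} (y z : H) : x ∈ H.gr i →
    (-1 : k) ^ i • times x (times y z) = -times (times x y) z
  leibniz {i j : ℤ} {x y : H} (z : H) : x ∈ H.gr i → y ∈ H.gr j →
    (-1 : k) ^ i • bracket x (times y z) =
      times (bracket x y) z + (-1 : k) ^ (i * j) • times y (bracket x z)

/-- A dg associative algebra (without unit). -/
structure IsAssoc (A : DGVec.{u, w} k) (mul : A →ₗ[k] A →ₗ[k] A) : Prop where
  mul_mem {i j : ℤ} {a b : A} : a ∈ A.gr i → b ∈ A.gr j → mul a b ∈ A.gr (i + j)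
  mul_d {i : ℤ} {a : A} (b : A) : a ∈ A.gr i →
    A.d (mul a b) = mul (A.d a) b + (-1 : k) ^ i • mul a (A.d b)
  assoc (a b c : A) : mul (mul a b) c = mul a (mul b c)

/-- The triples `(H, A, ρ)`: `H` is a `ΛGer`-algebra, `A` is an associative algebra, and
`ρ : H ⊗ A → A` is of degree `0`, acts by derivations, is a morphism of Lie algebras and vanishes
on products. -/
structure DualTriple (H A : DGVec.{u, w} k) where
  bracket : H →ₗ[k] H →ₗ[k] H
  times : H →ₗ[k] H →ₗ[k] H
  mul : A →ₗ[k] A →ₗ[k] A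
  ρ : H →ₗ[k] A →ₗ[k] A
  isLambdaGer : IsLambdaGer H bracket times
  isAssoc : IsAssoc A mul
  ρ_mem {i j : ℤ} {h : H} {a : A} : h ∈ H.gr i → a ∈ A.gr j → ρ h a ∈ A.gr (i + j)
  ρ_d {i : ℤ} {h : H} (a : A) : h ∈ H.gr i →
    A.d (ρ h a) = ρ (H.d h) a + (-1 : k) ^ i • ρ h (A.d a)
  ρ_bracket {i j : ℤ} {h h' : H} (a : A) : h ∈ H.gr i → h' ∈ H.gr j →
    ρ (bracket h h') a = ρ h (ρ h' a) - (-1 : k) ^ (i * j) • ρ h' (ρ h a)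
  ρ_mul {i j : ℤ} {h : H} {a : A} (a' : A) : h ∈ H.gr i → a ∈ A.gr j →
    ρ h (mul a a') = mul (ρ h a) a' + (-1 : k) ^ (j * i) • mul a (ρ h a')
  ρ_times (h h' : H) (a : A) : ρ (times h h') a = 0

end

end SwissCheese

/-! Part (2) rests on a general fact: an algebra over `F(E)/(R)` on `V` is the same thing as a
family of binary operations indexed by `E`, compatible with degrees, symmetry and differentials, on
which the elements of `R` vanish. Since `F(E)/(R)` is built from formal monomials modulo the ideal
`Vanish`, the proof evaluates a monomial directly. `Term.eval` takes a monomial, a total order of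
its inputs, a parity for each input and the inputs themselves, and produces a value with its Koszul
sign. Each operad axiom then becomes an identity between shuffle signs (`Term.eval_comp_seq`,
`Term.eval_comp_par` and their companions), so evaluation kills the whole ideal as soon as it kills
`R` (`linEval_eq_zero_of_vanish`). The resulting action is defined on homogeneous inputs and is
extended to all inputs through projections to the even and odd parts (`BinAction.toAlgebra`).
Conversely, the axioms of an algebra force every monomial to act by `Term.eval`, so the operations
of the generators determine the algebra (`OperadAlgebra.act_cls`, `OperadAlgebra.ext_of_gen`).

For the dual presentation the basis of generators gives four basic operations and two flipped ones,
and the flips are forced by the Koszul symmetry. Evaluating the seven relators on three homogeneous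
inputs gives exactly the identities of a `DualTriple`. In a composite `μ(id ⊗ ν)` the operation `ν`
moves past the first input `x` and creates the sign `(-1)^{|ν||x|}` (`tripleEval_right`). For `ν =
𝔠₂`, of degree `-1`, this is the sign `(-1)^{|x|}` in the axioms of a `ΛGer`-algebra.

Part (1) is the equality `R_{v^!} = R_v^⊥` (`mem_relD_iff`), read through the equivariant
isomorphism `toDual` from `E_{v^!}` to `E_v^∨`. On trees with basis labels the pairing is an integer
that depends only on two permutations of three letters and on the positions of the labels in a list
of six, so each value can be computed. The inclusion `⊆` is such a computation for every pair of
relators and every permutation (`pairing_relV_relD`). For `⊇` no dimension is counted. In each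
component one exhibits trees that span modulo `R_{v^!}`, together with elements of `R_v` whose
matrix of pairings with these trees is diagonal with nonzero entries. An element orthogonal to `R_v`
then has all its coordinates on these trees equal to zero, hence lies in `R_{v^!}`
(`mem_relD_of_orthogonal`). Isomorphic quadratic data present isomorphic operads, which gives the
isomorphism of part (1) and lets part (2) be proved over the explicit presentation. -/

namespace Operads

/-! ### Signs -/

/-- The sign `(-1)^z`. -/
def paritySign (k : Type u) [Field k] (z : ZMod 2) : k := if z = 0 then 1 else -1

section Sign
variable (k : Type u) [Field k]

@[simp] theorem paritySign_zero : paritySign k 0 = 1 := rfl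

theorem paritySign_add (a b : ZMod 2) :
    paritySign k (a + b) = paritySign k a * paritySign k b := by
  have h : ∀ a : ZMod 2, a = 0 ∨ a = 1 := by decide
  rcases h a with rfl | rfl <;> rcases h b with rfl | rfl <;>
    simp [paritySign, show (1 + 1 : ZMod 2) = 0 from rfl]

/-- Sign exponents are moved to `ZMod 2`, where comparing two signs is an identity in a commutative
ring of characteristic two. -/
theorem neg_one_zpow_eq_paritySign (z : ℤ) : (-1 : k) ^ z = paritySign k (z : ZMod 2) := by
  rcases Int.even_or_odd z with h | h
  · rw [h.neg_one_zpow, paritySign, if_pos]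
    exact (ZMod.intCast_zmod_eq_zero_iff_dvd z 2).2 (by exact_mod_cast h.two_dvd)
  · rw [h.neg_one_zpow, paritySign, if_neg]
    intro h0
    have := (ZMod.intCast_zmod_eq_zero_iff_dvd z 2).1 h0
    exact (Int.not_even_iff_odd.2 h) (even_iff_two_dvd.2 (by exact_mod_cast this))

theorem paritySign_smul_smul {M : Type*} [AddCommGroup M] [Module k M] (a b : ZMod 2) (v : M) :
    paritySign k a • paritySign k b • v = paritySign k (a + b) • v := by
  rw [paritySign_add, mul_smul]

end Sign

/-! ### Shuffles -/

section Shuffle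
variable {A B : Type}

/-- The letters of the first kind in a word. -/
def lefts : List (A ⊕ B) → List A
  | [] => []
  | Sum.inl a :: l => a :: lefts l
  | Sum.inr _ :: l => lefts l

/-- The letters of the second kind in a word. -/
def rights : List (A ⊕ B) → List B
  | [] => []
  | Sum.inl _ :: l => rights l
  | Sum.inr b :: l => b :: rights l

/-- The total parity of a word. -/
def weight {X : Type} (g : X → ZMod 2) (l : List X) : ZMod 2 := (l.map g).sum

/-- The parity of the Koszul sign for moving the letters of the second kind to the front. -/
def shuffleParity (g : A ⊕ B → ZMod 2) : List (A ⊕ B) → ZMod 2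
  | [] => 0
  | Sum.inl a :: l => g (Sum.inl a) * weight (g ∘ Sum.inr) (rights l) + shuffleParity g l
  | Sum.inr _ :: l => shuffleParity g l

@[simp] theorem weight_nil {X : Type} (g : X → ZMod 2) : weight g [] = 0 := rfl

@[simp] theorem weight_cons {X : Type} (g : X → ZMod 2) (x : X) (l : List X) :
    weight g (x :: l) = g x + weight g l := by simp [weight]

@[simp] theorem weight_append {X : Type} (g : X → ZMod 2) (l l' : List X) :
    weight g (l ++ l') = weight g l + weight g l' := by simp [weight]

theorem weight_map {X Y : Type} (f : X → Y) (g : Y → ZMod 2) (l : List X) :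
    weight g (l.map f) = weight (g ∘ f) l := by simp [weight]

@[simp] theorem lefts_nil : lefts ([] : List (A ⊕ B)) = [] := rfl
@[simp] theorem lefts_inl (a : A) (l : List (A ⊕ B)) :
    lefts (Sum.inl a :: l) = a :: lefts l := rfl
@[simp] theorem lefts_inr (b : B) (l : List (A ⊕ B)) : lefts (Sum.inr b :: l) = lefts l := rfl
@[simp] theorem rights_nil : rights ([] : List (A ⊕ B)) = [] := rfl
@[simp] theorem rights_inl (a : A) (l : List (A ⊕ B)) :
    rights (Sum.inl a :: l) = rights l := rfl
@[simp] theorem rights_inr (b : B) (l : List (A ⊕ B)) :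
    rights (Sum.inr b :: l) = b :: rights l := rfl
@[simp] theorem shuffleParity_nil (g : A ⊕ B → ZMod 2) : shuffleParity g [] = 0 := rfl
@[simp] theorem shuffleParity_inl (g : A ⊕ B → ZMod 2) (a : A) (l : List (A ⊕ B)) :
    shuffleParity g (Sum.inl a :: l) =
      g (Sum.inl a) * weight (g ∘ Sum.inr) (rights l) + shuffleParity g l := rfl
@[simp] theorem shuffleParity_inr (g : A ⊕ B → ZMod 2) (b : B) (l : List (A ⊕ B)) :
    shuffleParity g (Sum.inr b :: l) = shuffleParity g l := rfl

@[simp] theorem lefts_append (l l' : List (A ⊕ B)) : lefts (l ++ l') = lefts l ++ lefts l' := by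
  induction l with
  | nil => rfl
  | cons s l ih => rcases s with a | b <;> simp [ih]

@[simp] theorem rights_append (l l' : List (A ⊕ B)) :
    rights (l ++ l') = rights l ++ rights l' := by
  induction l with
  | nil => rfl
  | cons s l ih => rcases s with a | b <;> simp [ih]

@[simp] theorem lefts_map_inl (l : List A) : lefts (l.map (Sum.inl : A → A ⊕ B)) = l := by
  induction l with
  | nil => rfl
  | cons s l ih => simp [ih]

@[simp] theorem lefts_map_inr (l : List B) : lefts (l.map (Sum.inr : B → A ⊕ B)) = [] := by
  induction l with
  | nil => rfl
  | cons s l ih => simp [ih]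

@[simp] theorem rights_map_inl (l : List A) : rights (l.map (Sum.inl : A → A ⊕ B)) = [] := by
  induction l with
  | nil => rfl
  | cons s l ih => simp [ih]

@[simp] theorem rights_map_inr (l : List B) : rights (l.map (Sum.inr : B → A ⊕ B)) = l := by
  induction l with
  | nil => rfl
  | cons s l ih => simp [ih]

@[simp] theorem mem_lefts {l : List (A ⊕ B)} {a : A} : a ∈ lefts l ↔ Sum.inl a ∈ l := by
  induction l with
  | nil => simp
  | cons s l ih => rcases s with a | b <;> simp [ih]

@[simp] theorem mem_rights {l : List (A ⊕ B)} {b : B} : b ∈ rights l ↔ Sum.inr b ∈ l := by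
  induction l with
  | nil => simp
  | cons s l ih => rcases s with a | b <;> simp [ih]

theorem nodup_lefts {l : List (A ⊕ B)} (h : l.Nodup) : (lefts l).Nodup := by
  induction l with
  | nil => simp
  | cons s l ih => rcases s with a | b <;> simp_all

theorem nodup_rights {l : List (A ⊕ B)} (h : l.Nodup) : (rights l).Nodup := by
  induction l with
  | nil => simp
  | cons s l ih => rcases s with a | b <;> simp_all

/-- The middle term pairs the first-kind letters of `l` with the second-kind letters of `l'`; these
are the only crossings that are not internal to one of the two words. -/
theorem shuffleParity_append (g : A ⊕ B → ZMod 2) (l l' : List (A ⊕ B)) :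
    shuffleParity g (l ++ l') = shuffleParity g l +
      weight (g ∘ Sum.inl) (lefts l) * weight (g ∘ Sum.inr) (rights l') +
        shuffleParity g l' := by
  induction l with
  | nil => simp
  | cons s l ih => rcases s with a | b <;> simp [ih]; ring

@[simp] theorem shuffleParity_map_inl (g : A ⊕ B → ZMod 2) (l : List A) :
    shuffleParity g (l.map Sum.inl) = 0 := by
  induction l with
  | nil => rfl
  | cons s l ih => simp [ih]

@[simp] theorem shuffleParity_map_inr (g : A ⊕ B → ZMod 2) (l : List B) :
    shuffleParity g (l.map Sum.inr) = 0 := by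
  induction l with
  | nil => rfl
  | cons s l ih => simp [ih]

variable {A' B' : Type}

theorem lefts_map_sumMap (f : A → A') (h : B → B') (l : List (A ⊕ B)) :
    lefts (l.map (Sum.map f h)) = (lefts l).map f := by
  induction l with
  | nil => rfl
  | cons s l ih => rcases s with a | b <;> simp [ih]

theorem rights_map_sumMap (f : A → A') (h : B → B') (l : List (A ⊕ B)) :
    rights (l.map (Sum.map f h)) = (rights l).map h := by
  induction l with
  | nil => rfl
  | cons s l ih => rcases s with a | b <;> simp [ih]

theorem shuffleParity_map_sumMap (f : A → A') (h : B → B') (g : A' ⊕ B' → ZMod 2)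
    (l : List (A ⊕ B)) :
    shuffleParity g (l.map (Sum.map f h)) = shuffleParity (g ∘ Sum.map f h) l := by
  induction l with
  | nil => rfl
  | cons s l ih =>
    rcases s with a | b <;> simp [ih, rights_map_sumMap, weight_map, Function.comp_def]

theorem weight_sum_eq (g : A ⊕ B → ZMod 2) (l : List (A ⊕ B)) :
    weight g l = weight (g ∘ Sum.inl) (lefts l) + weight (g ∘ Sum.inr) (rights l) := by
  induction l with
  | nil => rfl
  | cons s l ih => rcases s with a | b <;> simp [ih] <;> ring

theorem sum_map_eq_lefts_add_rights {M : Type*} [AddCommMonoid M] (f : A ⊕ B → M)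
    (l : List (A ⊕ B)) :
    (l.map f).sum = ((lefts l).map (f ∘ Sum.inl)).sum + ((rights l).map (f ∘ Sum.inr)).sum := by
  induction l with
  | nil => simp
  | cons s l ih => rcases s with a | b <;> simp [ih] <;> abel

end Shuffle

/-! ### Enumerations of finite label sets. -/

/-- `l` lists every element of `X` once. -/
def IsEnum {X : Type} (l : List X) : Prop := l.Nodup ∧ ∀ x, x ∈ l

theorem IsEnum.map {X Y : Type} {l : List X} (h : IsEnum l) (e : X ≃ Y) : IsEnum (l.map e) :=
  ⟨h.1.map e.injective, fun y => List.mem_map.2 ⟨e.symm y, h.2 _, by simp⟩⟩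

theorem IsEnum.rights {A B : Type} {l : List (A ⊕ B)} (h : IsEnum l) : IsEnum (rights l) :=
  ⟨nodup_rights h.1, fun _ => mem_rights.2 (h.2 _)⟩

theorem nodup_cons_lefts {X Y : Type} {x : X} {l : List ({i : X // i ≠ x} ⊕ Y)} (h : l.Nodup) :
    (x :: (lefts l).map Subtype.val).Nodup :=
  List.nodup_cons.2 ⟨by simp, (nodup_lefts h).map Subtype.val_injective⟩

theorem IsEnum.cons_lefts {X Y : Type} {x : X} {l : List ({i : X // i ≠ x} ⊕ Y)}
    (h : IsEnum l) : IsEnum (x :: (Operads.lefts l).map Subtype.val) :=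
  ⟨nodup_cons_lefts h.1, fun i => by
    by_cases hi : i = x
    · simp [hi]
    · exact List.mem_cons_of_mem _ (List.mem_map.2 ⟨⟨i, hi⟩, mem_lefts.2 (h.2 _), rfl⟩)⟩

theorem isEnum_fin_two {l : List (Fin 2)} (h : IsEnum l) : l = [0, 1] ∨ l = [1, 0] := by
  have hp : l.Perm [0, 1] :=
    (List.perm_ext_iff_of_nodup h.1 (by decide)).2 fun x =>
      ⟨fun _ => (by decide : ∀ x : Fin 2, x ∈ [0, 1]) x, fun _ => h.2 x⟩
  obtain ⟨p, q, rfl⟩ := List.length_eq_two.1 hp.length_eq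
  have hpq : p ≠ q := by simpa using h.1
  revert hpq
  clear h hp
  revert p q
  decide

/-! ### Families of inputs, plugging a value into a slot, and the value of a monomial. -/

section Eval

variable {k : Type u} [Field k] {C : Type} {V : C → DGVec.{u, w} k}

/-- Transport along an equality of colours. -/
def colorCast {a b : C} (h : a = b) (v : V a) : V b := h ▸ v

@[simp] theorem colorCast_rfl {a : C} (v : V a) : colorCast (rfl : a = a) v = v := rfl

theorem colorCast_mem {a b : C} (h : a = b) {v : V a} {n : ℤ} (hv : v ∈ (V a).gr n) :
    colorCast h v ∈ (V b).gr n := by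
  subst h; exact hv

theorem colorCast_add {a b : C} (h : a = b) (v v' : V a) :
    colorCast h (v + v') = colorCast h v + colorCast h v' := by
  subst h; rfl

theorem colorCast_smul {a b : C} (h : a = b) (r : k) (v : V a) :
    colorCast h (r • v) = r • colorCast h v := by
  subst h; rfl

theorem colorCast_d {a b : C} (h : a = b) (v : V a) :
    (V b).d (colorCast h v) = colorCast h ((V a).d v) := by
  subst h; rfl

open Classical in
/-- The inputs of `p` in `p ∘ₓ q`: the value `v` of `q` at `x`, and `a` elsewhere. -/
noncomputable def plug {X : Type} {x : X} {c : X → C} {e : C} (hx : c x = e)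
    (a : ∀ i : {i : X // i ≠ x}, V (c i)) (v : V e) (i : X) : V (c i) :=
  if h : i = x then colorCast (by rw [h, hx]) v else a ⟨i, h⟩

open Classical in
/-- The parities of the inputs of `p` in `p ∘ₓ q`. -/
noncomputable def plugParity {X : Type} {x : X} (g : {i : X // i ≠ x} → ZMod 2) (z : ZMod 2)
    (i : X) : ZMod 2 :=
  if h : i = x then z else g ⟨i, h⟩

section plug
variable {X : Type} {x : X} {c : X → C} {e : C} (hx : c x = e)

theorem plug_self (a : ∀ i : {i : X // i ≠ x}, V (c i)) (v : V e) :
    plug hx a v x = colorCast hx.symm v := by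
  simp [plug]

theorem plug_of_ne (a : ∀ i : {i : X // i ≠ x}, V (c i)) (v : V e) {i : X} (h : i ≠ x) :
    plug hx a v i = a ⟨i, h⟩ := by
  simp [plug, h]

theorem plugParity_self (g : {i : X // i ≠ x} → ZMod 2) (z : ZMod 2) : plugParity g z x = z := by
  simp [plugParity]

theorem plugParity_of_ne (g : {i : X // i ≠ x} → ZMod 2) (z : ZMod 2) {i : X} (h : i ≠ x) :
    plugParity g z i = g ⟨i, h⟩ := by
  simp [plugParity, h]

/-- Linearity in the plugged slot is stated for `Function.update`. The value `v'` is overwritten and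
may be anything; in applications it is `0`. -/
theorem plug_eq_update [DecidableEq X] (a : ∀ i : {i : X // i ≠ x}, V (c i)) (v v' : V e) :
    plug hx a v = Function.update (plug hx a v') x (colorCast hx.symm v) := by
  funext i
  by_cases h : i = x
  · subst h; simp [plug_self]
  · simp [plug_of_ne hx _ _ h, h]

theorem plug_update [DecidableEq X] [DecidableEq {i : X // i ≠ x}]
    (a : ∀ i : {i : X // i ≠ x}, V (c i)) (v : V e) (i : {i : X // i ≠ x}) (w : V (c i)) :
    plug hx (Function.update a i w) v = Function.update (plug hx a v) i.1 w := by
  funext j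
  by_cases h : j = i.1
  · subst h; simp [plug_of_ne hx _ _ i.2]
  · by_cases hj : j = x
    · subst hj; simp [plug_self, h]
    · have : (⟨j, hj⟩ : {i : X // i ≠ x}) ≠ i := fun e => h (congrArg Subtype.val e)
      simp [plug_of_ne hx _ _ hj, h, this]

theorem plugParity_update [DecidableEq X] [DecidableEq {i : X // i ≠ x}]
    (g : {i : X // i ≠ x} → ZMod 2) (z : ZMod 2) (i : {i : X // i ≠ x}) (w : ZMod 2) :
    plugParity (Function.update g i w) z = Function.update (plugParity g z) i.1 w := by
  funext j
  by_cases h : j = i.1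
  · subst h; simp [plugParity_of_ne _ _ i.2]
  · by_cases hj : j = x
    · subst hj; simp [plugParity_self, h]
    · have : (⟨j, hj⟩ : {i : X // i ≠ x}) ≠ i := fun e => h (congrArg Subtype.val e)
      simp [plugParity_of_ne _ _ hj, h, this]

theorem plugParity_eq_update [DecidableEq X]
    (g : {i : X // i ≠ x} → ZMod 2) (z z' : ZMod 2) :
    plugParity g z = Function.update (plugParity g z') x z := by
  funext i
  by_cases h : i = x
  · subst h; simp [plugParity_self]
  · simp [plugParity_of_ne _ _ h, h]

theorem weight_plugParity (g : {i : X // i ≠ x} → ZMod 2) (z : ZMod 2)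
    (l : List {i : X // i ≠ x}) :
    weight (plugParity g z) (l.map Subtype.val) = weight g l := by
  rw [weight_map]
  congr 1
  funext i
  exact plugParity_of_ne _ _ i.2

end plug

/-- The inputs with labels in the first summand. -/
def inlInputs {A B : Type} {c : A → C} {b : B → C} (a : ∀ s, V (Sum.elim c b s)) (i : A) :
    V (c i) :=
  colorCast (Sum.elim_inl c b i) (a (Sum.inl i))

/-- The inputs with labels in the second summand. -/
def inrInputs {A B : Type} {c : A → C} {b : B → C} (a : ∀ s, V (Sum.elim c b s)) (i : B) :
    V (b i) :=
  colorCast (Sum.elim_inr c b i) (a (Sum.inr i))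

/-- The first of two inputs. -/
def fstInput {a b : C} (x : ∀ i, V (![a, b] i)) : V a :=
  colorCast (show ![a, b] 0 = a from rfl) (x 0)

/-- The second of two inputs. -/
def sndInput {a b : C} (x : ∀ i, V (![a, b] i)) : V b :=
  colorCast (show ![a, b] 1 = b from rfl) (x 1)

section inputs
variable {A B : Type} {c : A → C} {b : B → C} [DecidableEq (A ⊕ B)] (a : ∀ s, V (Sum.elim c b s))

theorem inlInputs_update_inl [DecidableEq A] (i : A) (v : V (Sum.elim c b (Sum.inl i))) :
    inlInputs (Function.update a (Sum.inl i) v) =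
      Function.update (inlInputs a) i (colorCast (Sum.elim_inl c b i) v) := by
  funext j
  by_cases h : j = i
  · subst h; simp [inlInputs]
  · simp [inlInputs, h]

theorem inlInputs_update_inr (i : B) (v : V (Sum.elim c b (Sum.inr i))) :
    inlInputs (Function.update a (Sum.inr i) v) = inlInputs a := by
  funext j
  simp [inlInputs]

theorem inrInputs_update_inr [DecidableEq B] (i : B) (v : V (Sum.elim c b (Sum.inr i))) :
    inrInputs (Function.update a (Sum.inr i) v) =
      Function.update (inrInputs a) i (colorCast (Sum.elim_inr c b i) v) := by
  funext j
  by_cases h : j = i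
  · subst h; simp [inrInputs]
  · simp [inrInputs, h]

theorem inrInputs_update_inl (i : A) (v : V (Sum.elim c b (Sum.inl i))) :
    inrInputs (Function.update a (Sum.inl i) v) = inrInputs a := by
  funext j
  simp [inrInputs]

end inputs

section inputs
variable {a b : C} [DecidableEq (Fin 2)] (x : ∀ i, V (![a, b] i))

theorem fstInput_update_zero (v : V (![a, b] 0)) :
    fstInput (Function.update x 0 v) = colorCast (show ![a, b] 0 = a from rfl) v := by
  simp [fstInput]

theorem fstInput_update_one (v : V (![a, b] 1)) :
    fstInput (Function.update x 1 v) = fstInput x := by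
  simp [fstInput]

theorem sndInput_update_one (v : V (![a, b] 1)) :
    sndInput (Function.update x 1 v) = colorCast (show ![a, b] 1 = b from rfl) v := by
  simp [sndInput]

theorem sndInput_update_zero (v : V (![a, b] 0)) :
    sndInput (Function.update x 0 v) = sndInput x := by
  simp [sndInput]

end inputs

variable (V) in
/-- Binary operations on `V` indexed by `E`, compatible with the degrees, the symmetries and the
differentials. -/
structure BinAction (E : BinSMod k C) where
  op {n : ℤ} {a b d : C} : E.M n a b d →ₗ[k] V a →ₗ[k] V b →ₗ[k] V d
  op_mem {n : ℤ} {a b d : C} (e : E.M n a b d) {i j : ℤ} {x : V a} {y : V b} :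
    x ∈ (V a).gr i → y ∈ (V b).gr j → op e x y ∈ (V d).gr (n + (i + j))
  op_swap {n : ℤ} {a b d : C} (e : E.M n a b d) {i j : ℤ} {x : V a} {y : V b} :
    x ∈ (V a).gr i → y ∈ (V b).gr j → op (E.swap e) y x = (-1 : k) ^ (i * j) • op e x y
  op_d {n : ℤ} {a b d : C} (e : E.M n a b d) {i : ℤ} {x : V a} (y : V b) :
    x ∈ (V a).gr i → (V d).d (op e x y) =
      (-1 : k) ^ n • (op e ((V a).d x) y + (-1 : k) ^ i • op e x ((V b).d y))

variable {E : BinSMod k C} (A : BinAction V E)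

/-- The value of a monomial on the inputs `a`, put in the order `l`, with the signs computed as if
`a x` had parity `g x`. -/
noncomputable def Term.eval : ∀ {X : Type} {c : X → C} {d : C} {n : ℤ}, Term E X c d n →
    List X → (X → ZMod 2) → (∀ x, V (c x)) → V d
  | _, _, _, _, .unit _, _, _, a => a ()
  -- Every list other than `[1, 0]` gets the trivial sign; among enumerations of `Fin 2` the only
  -- other one is `[0, 1]`.
  | _, _, _, _, .gen e, l, g, a =>
      paritySign k (if l = [1, 0] then g 0 * g 1 else 0) • A.op e (fstInput a) (sndInput a)
  | _, _, _, _, .relabel e hc t, l, g, a =>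
      t.eval (l.map e.symm) (g ∘ e) fun x => colorCast (hc x) (a (e x))
  -- The inputs of `s` are gathered in a block at the front, at the cost of the shuffle sign, so
  -- that `s` moves past no input and its slot `x` comes first in the order for `t`. The plugged
  -- value has parity `|s|` plus the parity of its inputs. Parities are a separate argument, not
  -- read off from `a`, so the value stays multilinear in `a`.
  | _, _, _, _, .comp (n := n) x hx _ t s, l, g, a =>
      paritySign k (shuffleParity g l) •
        t.eval (x :: (lefts l).map Subtype.val)
          (plugParity (fun i => g (Sum.inl i)) (n + weight (g ∘ Sum.inr) (rights l)))
          (plug hx (inlInputs a) (s.eval (rights l) (g ∘ Sum.inr) (inrInputs a)))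

end Eval

end Operads
-- Multilinearity, Koszul symmetry and degree of the value of a monomial.
namespace Operads

section Eval

variable {k : Type u} [Field k] {C : Type} {V : C → DGVec.{u, w} k}
  {E : BinSMod k C} (A : BinAction V E)

/-- `Term` does not record finiteness of the labels, while the components of an operad require it.
-/
theorem Term.finite {X : Type} {c : X → C} {d : C} {n : ℤ} (t : Term E X c d n) : Finite X := by
  induction t with
  | unit => infer_instance
  | gen => infer_instance
  | relabel e _ _ ih => exact Finite.of_equiv _ e
  | comp => infer_instance

section update

variable {X : Type} {c : X → C}

theorem colorCast_update {Y : Type} [DecidableEq X] [DecidableEq Y] (e : X ≃ Y) {c' : Y → C}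
    (hc : ∀ x, c' (e x) = c x) (a : ∀ y, V (c' y)) (x : X) (v : V (c' (e x))) :
    (fun x' => colorCast (hc x') (Function.update a (e x) v (e x'))) =
      Function.update (fun x' => colorCast (hc x') (a (e x'))) x (colorCast (hc x) v) := by
  funext x'
  by_cases h : x' = x
  · subst h; simp
  · simp [h]

end update

open Classical in
theorem Term.eval_update_add {X : Type} {c : X → C} {d : C} {n : ℤ} (t : Term E X c d n)
    (l : List X) (g : X → ZMod 2) (a : ∀ x, V (c x)) (x : X) (v v' : V (c x)) :
    t.eval A l g (Function.update a x (v + v')) =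
      t.eval A l g (Function.update a x v) + t.eval A l g (Function.update a x v') := by
  induction t with
  | unit =>
    cases x
    simp [Term.eval]
  | gen e =>
    match x with
    | 0 => simp only [Term.eval, fstInput_update_zero, sndInput_update_zero, colorCast_add,
        map_add, LinearMap.add_apply, smul_add]
    | 1 => simp only [Term.eval, fstInput_update_one, sndInput_update_one, colorCast_add,
        map_add, smul_add]
  | relabel e hc t ih =>
    obtain ⟨x, rfl⟩ := e.surjective x
    simp only [Term.eval, colorCast_update, colorCast_add, ih]
  | comp x₀ hx hN t s iht ihs =>
    rcases x with x | y
    · simp only [Term.eval, inlInputs_update_inl, inrInputs_update_inl, colorCast_add,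
        plug_update hx, iht, smul_add]
    · simp only [Term.eval, inlInputs_update_inr, inrInputs_update_inr, colorCast_add, ihs]
      rw [plug_eq_update hx _ (_ + _) 0, colorCast_add, iht, smul_add, ← plug_eq_update,
        ← plug_eq_update]

open Classical in
theorem Term.eval_update_smul {X : Type} {c : X → C} {d : C} {n : ℤ} (t : Term E X c d n)
    (l : List X) (g : X → ZMod 2) (a : ∀ x, V (c x)) (x : X) (r : k) (v : V (c x)) :
    t.eval A l g (Function.update a x (r • v)) = r • t.eval A l g (Function.update a x v) := by
  induction t with
  | unit =>
    cases x
    simp [Term.eval]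
  | gen e =>
    match x with
    | 0 =>
      simp only [Term.eval, fstInput_update_zero, sndInput_update_zero, colorCast_smul,
        map_smul, LinearMap.smul_apply]
      rw [smul_comm]
    | 1 =>
      simp only [Term.eval, fstInput_update_one, sndInput_update_one, colorCast_smul,
        map_smul]
      rw [smul_comm]
  | relabel e hc t ih =>
    obtain ⟨x, rfl⟩ := e.surjective x
    simp only [Term.eval, colorCast_update, colorCast_smul, ih]
  | comp x₀ hx hN t s iht ihs =>
    rcases x with x | y
    · simp only [Term.eval, inlInputs_update_inl, inrInputs_update_inl, colorCast_smul,
        plug_update hx, iht]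
      rw [smul_comm]
    · simp only [Term.eval, inlInputs_update_inr, inrInputs_update_inr, colorCast_smul, ihs]
      rw [plug_eq_update hx _ (_ • _) 0, colorCast_smul, iht, smul_comm, ← plug_eq_update]

/-- The value of a monomial as a multilinear map. -/
noncomputable def Term.evalMultilinear {X : Type} {c : X → C} {d : C} {n : ℤ}
    (t : Term E X c d n) (l : List X) (g : X → ZMod 2) :
    MultilinearMap k (fun x => (V (c x)).carrier) (V d).carrier where
  toFun := t.eval A l g
  map_update_add' a x v v' := by
    convert t.eval_update_add A l g a x v v'
  map_update_smul' a x r v := by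
    convert t.eval_update_smul A l g a x r v

theorem Term.evalMultilinear_apply {X : Type} {c : X → C} {d : C} {n : ℤ}
    (t : Term E X c d n) (l : List X) (g : X → ZMod 2) (a : ∀ x, V (c x)) :
    t.evalMultilinear A l g a = t.eval A l g a := rfl

/-- `Term.eval` as a linear function of one input. -/
noncomputable def Term.evalPlug {X : Type} {c : X → C} {d e : C} {n : ℤ} (t : Term E X c d n)
    (l : List X) (g : X → ZMod 2) {x : X} (hx : c x = e) (a : ∀ i : {i : X // i ≠ x}, V (c i)) :
    V e →ₗ[k] V d where
  toFun v := t.eval A l g (plug hx a v)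
  map_add' v v' := by
    classical
    rw [plug_eq_update hx _ (_ + _) 0, colorCast_add, eval_update_add, ← plug_eq_update,
        ← plug_eq_update]
  map_smul' r v := by
    classical
    rw [plug_eq_update hx _ (_ • _) 0, colorCast_smul, eval_update_smul, ← plug_eq_update]
    rfl

theorem Term.evalPlug_apply {X : Type} {c : X → C} {d e : C} {n : ℤ} (t : Term E X c d n)
    (l : List X) (g : X → ZMod 2) {x : X} (hx : c x = e) (a : ∀ i : {i : X // i ≠ x}, V (c i))
    (v : V e) : t.evalPlug A l g hx a v = t.eval A l g (plug hx a v) := rfl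

/-- In a composite, two neighbours that belong to the same factor remain neighbours in the word of
that factor, and induction applies there. Neighbours from different factors change only the shuffle
sign. The identity is formal in `g`, so no homogeneity of the inputs is needed. -/
theorem Term.eval_swap {X : Type} {c : X → C} {d : C} {n : ℤ} (t : Term E X c d n)
    (l₁ l₂ : List X) (x y : X) (h : (l₁ ++ x :: y :: l₂).Nodup) (g : X → ZMod 2)
    (a : ∀ x, V (c x)) :
    t.eval A (l₁ ++ y :: x :: l₂) g a =
      paritySign k (g x * g y) • t.eval A (l₁ ++ x :: y :: l₂) g a := by
  induction t with
  | unit =>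
    have := h.length_le_card
    simp only [List.length_append, List.length_cons, Fintype.card_unit] at this
    omega
  | gen e =>
    have hl : (l₁ ++ x :: y :: l₂).length ≤ 2 := by
      simpa using h.length_le_card
    simp only [List.length_append, List.length_cons] at hl
    obtain rfl : l₁ = [] := List.eq_nil_of_length_eq_zero (by omega)
    obtain rfl : l₂ = [] := List.eq_nil_of_length_eq_zero (by omega)
    have hxy : x ≠ y := by rintro rfl; simp at h
    simp only [Term.eval, paritySign_smul_smul]
    congr 2
    clear hl h a e
    have : (x = 0 ∧ y = 1) ∨ (x = 1 ∧ y = 0) := by revert x y; decide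
    rcases this with ⟨rfl, rfl⟩ | ⟨rfl, rfl⟩
    · simp
    · simp [mul_comm (g 1), CharTwo.add_self_eq_zero]
  | relabel e hc t ih =>
    simp only [Term.eval, List.map_append, List.map_cons]
    rw [ih]
    · simp
    · simpa using h.map e.symm.injective
  | @comp X Y x₀ c b e d m n N hx hN t s iht ihs =>
    have hn := nodup_cons_lefts h
    have hn' := nodup_rights h
    have hs : shuffleParity g (l₁ ++ y :: x :: l₂) = shuffleParity g (l₁ ++ x :: y :: l₂) +
        (match x, y with
          | Sum.inl x, Sum.inr y => g (Sum.inl x) * g (Sum.inr y)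
          | Sum.inr x, Sum.inl y => g (Sum.inr x) * g (Sum.inl y)
          | _, _ => 0) := by
      simp only [shuffleParity_append]
      rcases x with x | x <;> rcases y with y | y <;> simp <;> grind
    simp only [Term.eval, hs]
    clear hs
    simp only [lefts_append, rights_append] at hn hn' ⊢
    rcases x with x | x <;> rcases y with y | y <;>
      simp only [lefts_inl, lefts_inr, rights_inl, rights_inr, List.map_append, List.map_cons,
        add_zero] at hn hn' ⊢
    · rw [← List.cons_append, iht _ _ _ _ hn, plugParity_of_ne _ _ x.2, plugParity_of_ne _ _ y.2,
        smul_comm]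
      rfl
    · rw [paritySign_smul_smul, add_comm]
    · rw [paritySign_smul_smul, add_comm]
    · rw [ihs _ _ _ _ hn']
      have h1 : weight (g ∘ Sum.inr) (rights l₁ ++ y :: x :: rights l₂) =
          weight (g ∘ Sum.inr) (rights l₁ ++ x :: y :: rights l₂) := by
        simp; ring
      simp only [h1, ← Term.evalPlug_apply, map_smul]
      rw [smul_comm]
      rfl

/-- Bridges two conventions: `Term.eval` puts the slot of a composite first, while the axioms of an
algebra and the unit axiom leave it in the middle of the word. -/
theorem Term.eval_move {X : Type} {c : X → C} {d : C} {n : ℤ} (t : Term E X c d n)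
    (l₀ l₁ l₂ : List X) (x : X) (h : (l₀ ++ l₁ ++ x :: l₂).Nodup) (g : X → ZMod 2)
    (a : ∀ x, V (c x)) :
    t.eval A (l₀ ++ l₁ ++ x :: l₂) g a =
      paritySign k (g x * weight g l₁) • t.eval A (l₀ ++ x :: l₁ ++ l₂) g a := by
  induction l₁ generalizing l₀ with
  | nil => simp
  | cons y l ih =>
    have := ih (l₀ ++ [y]) (by simpa using h)
    simp only [List.append_assoc, List.cons_append, List.nil_append] at this ⊢
    rw [this, eval_swap A t l₀ (l ++ l₂) x y, paritySign_smul_smul]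
    · congr 2
      simp
      ring
    · refine (List.Perm.nodup_iff ?_).1 h
      simp only [List.append_assoc, List.cons_append]
      refine List.Perm.append_left _ ?_
      refine (List.Perm.cons y List.perm_middle).trans ?_
      exact List.Perm.swap _ _ _

theorem Term.eval_mem {X : Type} {c : X → C} {d : C} {n : ℤ} (t : Term E X c d n)
    {l : List X} (hl : IsEnum l) (g : X → ZMod 2) {a : ∀ x, V (c x)} {G : X → ℤ}
    (ha : ∀ x, a x ∈ (V (c x)).gr (G x)) :
    t.eval A l g a ∈ (V d).gr (n + (l.map G).sum) := by
  induction t with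
  | unit d =>
    have hl1 : l = [()] := by
      have h1 : l.length ≤ 1 := by simpa using hl.1.length_le_card
      match l, h1 with
      | [], _ => simpa using hl.2 ()
      | [x], _ => rfl
    simpa [Term.eval, hl1] using ha ()
  | gen e =>
    refine Submodule.smul_mem _ _ ?_
    convert A.op_mem e (x := fstInput a) (y := sndInput a) (ha 0) (ha 1) using 3
    rcases isEnum_fin_two hl with rfl | rfl
    · simp
    · simp [add_comm]
  | relabel e hc t ih =>
    have h := ih (hl.map e.symm) (g ∘ e) (a := fun x => colorCast (hc x) (a (e x))) (G := G ∘ e)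
      (fun x => colorCast_mem _ (ha (e x)))
    have h2 : ((G ∘ e) ∘ e.symm) = G := by funext; simp
    simpa [Term.eval, h2] using h
  | @comp X Y x₀ c b e d m n N hx hN t s iht ihs =>
    refine Submodule.smul_mem _ _ ?_
    have hs := ihs hl.rights (g ∘ Sum.inr) (a := inrInputs a) (G := fun y => G (Sum.inr y))
      (fun y => ha (Sum.inr y))
    classical
    have ht := iht hl.cons_lefts
      (plugParity (fun i => g (Sum.inl i)) (n + weight (g ∘ Sum.inr) (rights l)))
      (a := plug hx (inlInputs a) (s.eval A (rights l) (g ∘ Sum.inr) (inrInputs a)))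
      (G := fun i => if h : i = x₀ then n + ((rights l).map fun y => G (Sum.inr y)).sum
        else G (Sum.inl ⟨i, h⟩)) (fun i => by
          by_cases h : i = x₀
          · subst h; subst hx; simpa only [plug_self, colorCast_rfl, dite_true] using hs
          · simp only [plug_of_ne hx _ _ h, h, dite_false]
            exact ha (Sum.inl ⟨i, h⟩))
    convert ht using 2
    rw [sum_map_eq_lefts_add_rights, ← hN]
    simp only [List.map_cons, List.map_map, List.sum_cons, dite_true]
    have : (fun i => if h : i = x₀ then n + ((rights l).map fun y => G (Sum.inr y)).sum
        else G (Sum.inl ⟨i, h⟩)) ∘ Subtype.val = G ∘ (Sum.inl : {i : X // i ≠ x₀} → _) := by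
      funext i; simp [i.2]
    rw [this, Function.comp_def G Sum.inr]
    ring

end Eval

end Operads
-- The differential of the value of a monomial.
namespace Operads

section Before

variable {A B X : Type}

open Classical in
/-- The total parity of the letters before `x` in a word. -/
noncomputable def beforeParity (g : X → ZMod 2) : List X → X → ZMod 2
  | [], _ => 0
  | z :: l, x => if z = x then 0 else g z + beforeParity g l x

theorem weight_congr {g g' : X → ZMod 2} {l : List X} (h : ∀ x ∈ l, g x = g' x) :
    weight g l = weight g' l := by
  rw [weight, weight, List.map_congr_left h]

theorem shuffleParity_congr {g g' : A ⊕ B → ZMod 2} {l : List (A ⊕ B)}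
    (h : ∀ x ∈ l, g x = g' x) : shuffleParity g l = shuffleParity g' l := by
  induction l with
  | nil => rfl
  | cons s l ih =>
    have ih' := ih fun x hx => h x (List.mem_cons_of_mem _ hx)
    rcases s with a | b
    · rw [shuffleParity_inl, shuffleParity_inl, ih', h _ List.mem_cons_self]
      congr 2
      exact weight_congr fun b hb => h _ (List.mem_cons_of_mem _ (mem_rights.1 hb))
    · rw [shuffleParity_inr, shuffleParity_inr, ih']

section
variable [DecidableEq (A ⊕ B)] (g : A ⊕ B → ZMod 2) (z : ZMod 2)

theorem update_inl_comp_inr (a : A) :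
    Function.update g (Sum.inl a) z ∘ Sum.inr = g ∘ Sum.inr := by
  funext; simp

theorem update_inr_comp_inl (b : B) :
    (fun i => Function.update g (Sum.inr b) z (Sum.inl i)) = fun i => g (Sum.inl i) := by
  funext; simp

theorem update_inl_comp_inl [DecidableEq A] (a : A) :
    (fun i => Function.update g (Sum.inl a) z (Sum.inl i)) =
      Function.update (fun i => g (Sum.inl i)) a z := by
  funext i
  by_cases hi : i = a
  · subst hi; simp
  · simp [hi]

theorem update_inr_comp_inr [DecidableEq B] (b : B) :
    Function.update g (Sum.inr b) z ∘ Sum.inr = Function.update (g ∘ Sum.inr) b z := by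
  funext i
  by_cases hi : i = b
  · subst hi; simp
  · simp [hi]

end

theorem weight_update_of_notMem [DecidableEq X] (g : X → ZMod 2) {l : List X} {x : X} (z : ZMod 2)
    (h : x ∉ l) : weight (Function.update g x z) l = weight g l :=
  weight_congr fun y hy => Function.update_of_ne (by rintro rfl; exact h hy) _ _

theorem weight_update_add_one [DecidableEq X] (g : X → ZMod 2) {l : List X} {x : X}
    (hl : l.Nodup) (h : x ∈ l) :
    weight (Function.update g x (g x + 1)) l = weight g l + 1 := by
  induction l with
  | nil => simp at h
  | cons z l ih =>
    rw [List.nodup_cons] at hl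
    by_cases hz : z = x
    · subst hz
      simp [weight_update_of_notMem g _ hl.1]
      ring
    · rw [weight_cons, weight_cons, ih hl.2 (by simpa [Ne.symm hz] using h),
        Function.update_of_ne hz]
      ring

theorem beforeParity_map {Y : Type} {f : X → Y} (hf : f.Injective) (g : Y → ZMod 2) (l : List X)
    (x : X) : beforeParity g (l.map f) (f x) = beforeParity (g ∘ f) l x := by
  induction l with
  | nil => rfl
  | cons z l ih =>
    by_cases h : z = x
    · simp [beforeParity, h]
    · simp [beforeParity, h, ih, hf.ne h]

/-- Differentiating `b` flips its parity. The first-kind letters before `b` are then counted twice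
on the left, once by `beforeParity` and once by the change of the shuffle sign, and cancel modulo
two. The second-kind letters before `b` remain. -/
theorem beforeParity_inr_add [DecidableEq (A ⊕ B)] (g : A ⊕ B → ZMod 2) {l : List (A ⊕ B)}
    (hl : l.Nodup) {b : B} (h : Sum.inr b ∈ l) :
    beforeParity g l (Sum.inr b) +
        shuffleParity (Function.update g (Sum.inr b) (g (Sum.inr b) + 1)) l =
      shuffleParity g l + beforeParity (g ∘ Sum.inr) (rights l) b := by
  classical
  induction l with
  | nil => simp at h
  | cons s l ih =>
    rw [List.nodup_cons] at hl
    rcases s with a | b'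
    · have hb : Sum.inr b ∈ l := by simpa using h
      have hw : weight (Function.update g (Sum.inr b) (g (Sum.inr b) + 1) ∘ Sum.inr) (rights l) =
          weight (g ∘ Sum.inr) (rights l) + 1 := by
        rw [← weight_update_add_one _ (nodup_rights hl.2) (mem_rights.2 hb), update_inr_comp_inr]
        rfl
      simp only [beforeParity, shuffleParity_inl, rights_inl, reduceCtorEq, if_false, hw]
      rw [Function.update_of_ne (by simp)]
      have := ih hl.2 hb
      grind
    · by_cases hb : b' = b
      · subst hb
        simp only [beforeParity, shuffleParity_inr, rights_inr, if_true]
        rw [shuffleParity_congr (g' := g), zero_add, add_zero]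
        intro x hx
        exact Function.update_of_ne (by rintro rfl; exact hl.1 hx) _ _
      · have hb' : Sum.inr b ∈ l := by simpa [Ne.symm hb] using h
        have := ih hl.2 hb'
        simp only [beforeParity, shuffleParity_inr, rights_inr, Sum.inr.injEq, hb, if_false,
          Function.comp_apply]
        grind

/-- The second-kind letters before `a` are counted by `beforeParity`, those after `a` by the change
of the shuffle sign. Together they give the weight of all second-kind letters, which is what the
differential passes when the inner block stands in front. -/
theorem beforeParity_inl_add [DecidableEq (A ⊕ B)] (g : A ⊕ B → ZMod 2) {l : List (A ⊕ B)}
    (hl : l.Nodup) {a : A} (h : Sum.inl a ∈ l) :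
    beforeParity g l (Sum.inl a) +
        shuffleParity (Function.update g (Sum.inl a) (g (Sum.inl a) + 1)) l =
      shuffleParity g l + beforeParity (g ∘ Sum.inl) (lefts l) a +
        weight (g ∘ Sum.inr) (rights l) := by
  induction l with
  | nil => simp at h
  | cons s l ih =>
    rw [List.nodup_cons] at hl
    have hr : Function.update g (Sum.inl a) (g (Sum.inl a) + 1) ∘ Sum.inr = g ∘ Sum.inr := by
      funext i; simp
    rcases s with a' | b
    · by_cases ha : a' = a
      · subst ha
        simp only [beforeParity, shuffleParity_inl, rights_inl, lefts_inl, if_true, hr,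
          Function.update_self]
        rw [shuffleParity_congr (g' := g)]
        · ring
        · intro x hx
          exact Function.update_of_ne (by rintro rfl; exact hl.1 hx) _ _
      · have ha' : Sum.inl a ∈ l := by simpa [Ne.symm ha] using h
        have := ih hl.2 ha'
        simp only [beforeParity, shuffleParity_inl, lefts_inl, rights_inl, Sum.inl.injEq, ha,
          if_false, Function.comp_apply, hr]
        rw [Function.update_of_ne (by simpa using ha)]
        grind
    · have ha' : Sum.inl a ∈ l := by simpa using h
      have := ih hl.2 ha'
      simp only [beforeParity, shuffleParity_inr, lefts_inr, rights_inr, reduceCtorEq,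
        if_false, Function.comp_apply, weight_cons]
      grind

end Before

section Eval

variable {k : Type u} [Field k] {C : Type} {V : C → DGVec.{u, w} k}
  {E : BinSMod k C} (A : BinAction V E)

theorem plug_mem {X : Type} {x : X} {c : X → C} {e : C} (hx : c x = e) [DecidableEq X]
    {a : ∀ i : {i : X // i ≠ x}, V (c i)} {v : V e} {G : {i : X // i ≠ x} → ℤ} {n : ℤ}
    (ha : ∀ i : {i : X // i ≠ x}, a i ∈ (V (c i)).gr (G i)) (hv : v ∈ (V e).gr n) (i : X) :
    plug hx a v i ∈ (V (c i)).gr (if h : i = x then n else G ⟨i, h⟩) := by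
  by_cases h : i = x
  · subst h; subst hx; simpa only [plug_self, colorCast_rfl, dite_true] using hv
  · simp only [plug_of_ne hx _ _ h, h, dite_false]
    exact ha ⟨i, h⟩

theorem plugParity_intCast {X : Type} {x : X} [DecidableEq X] (G : {i : X // i ≠ x} → ℤ) (n : ℤ) :
    (fun i => ((if h : i = x then n else G ⟨i, h⟩ : ℤ) : ZMod 2)) =
      plugParity (fun i : {i : X // i ≠ x} => (G i : ZMod 2)) (n : ZMod 2) := by
  funext i
  by_cases h : i = x
  · subst h; simp [plugParity_self]
  · simp [plugParity_of_ne _ _ h, h]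

theorem weight_intCast {X : Type} (G : X → ℤ) (l : List X) :
    weight (fun x => (G x : ZMod 2)) l = ((l.map G).sum : ℤ) := by
  induction l with
  | nil => simp
  | cons x l ih => simp [ih]

-- The Leibniz rule with Koszul signs. A differentiated input drops by one in degree, so its
-- recorded parity is flipped along with the input. For a composite, the rule for the outer monomial
-- contains one term in the plugged slot, and that term is expanded by the rule for the inner
-- monomial.
open Classical in
theorem Term.eval_d {X : Type} {c : X → C} {d : C} {n : ℤ} (t : Term E X c d n)
    {l : List X} (hl : IsEnum l) {a : ∀ x, V (c x)} {G : X → ℤ}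
    (ha : ∀ x, a x ∈ (V (c x)).gr (G x)) {g : X → ZMod 2} (hg : g = fun x => (G x : ZMod 2)) :
    (V d).d (t.eval A l g a) = paritySign k n • (l.map fun x =>
      paritySign k (beforeParity g l x) • t.eval A l (Function.update g x (g x + 1))
        (Function.update a x ((V (c x)).d (a x)))).sum := by
  induction t with
  | unit d =>
    have hl1 : l = [()] := by
      have h1 : l.length ≤ 1 := by simpa using hl.1.length_le_card
      match l, h1 with
      | [], _ => simpa using hl.2 ()
      | [x], _ => rfl
    simp [Term.eval, hl1, beforeParity]
  | @gen a' b' d n e =>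
    have h := A.op_d e (x := fstInput a) (sndInput a) (ha 0)
    have h0 : colorCast (show ![a', b'] 0 = a' from rfl) ((V (![a', b'] 0)).d (a 0)) =
        (V a').d (fstInput a) := rfl
    have h1 : colorCast (show ![a', b'] 1 = b' from rfl) ((V (![a', b'] 1)).d (a 1)) =
        (V b').d (sndInput a) := rfl
    rw [neg_one_zpow_eq_paritySign, neg_one_zpow_eq_paritySign,
      show ((G 0 : ℤ) : ZMod 2) = g 0 by rw [hg]] at h
    rcases isEnum_fin_two hl with rfl | rfl <;>
      simp only [Term.eval, map_smul, h, List.map_cons, List.map_nil, List.sum_cons, List.sum_nil,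
        fstInput_update_zero, sndInput_update_one, h0, h1, fstInput_update_one,
        sndInput_update_zero, beforeParity]
    · simp [smul_add]
    -- In the order `[1, 0]` the sum starts with the second input, so the two terms trade places;
    -- flipping one parity changes the exponent `g 0 * g 1` by the other parity, which accounts for
    -- the signs.
    · simp only [smul_add, paritySign_smul_smul, add_zero, if_true]
      rw [add_comm]
      congr 3 <;> simp <;> grind
  | @relabel X Y e c c' hc d n t ih =>
    have h := ih (hl.map e.symm) (a := fun x => colorCast (hc x) (a (e x))) (G := G ∘ e)
      (g := g ∘ e) (fun x => colorCast_mem _ (ha (e x))) (by rw [hg]; rfl)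
    simp only [Term.eval]
    rw [h, List.map_map]
    congr 2
    refine List.map_congr_left fun y _ => ?_
    obtain ⟨x, rfl⟩ := e.surjective y
    have h1 := beforeParity_map e.symm.injective (g ∘ e) l (e x)
    have h2 : (g ∘ e) ∘ e.symm = g := by funext; simp
    have h3 : Function.update g (e x) (g (e x) + 1) ∘ e =
        Function.update (g ∘ e) x (g (e x) + 1) := by
      funext x'
      by_cases hx : x' = x
      · subst hx; simp
      · simp [hx]
    rw [Equiv.symm_apply_apply, h2] at h1
    simp only [Function.comp_apply, colorCast_update]
    rw [Equiv.symm_apply_apply, h1, h3, colorCast_d]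
  | @comp X Y x₀ c b e d m n N hx hN t s iht ihs =>
    have hs := s.eval_mem A hl.rights (g ∘ Sum.inr) (a := inrInputs a)
      (G := fun y => G (Sum.inr y)) (fun y => ha (Sum.inr y))
    -- The recorded parities of the inputs of `t` are the reductions of actual degrees, as the
    -- induction hypothesis for `t` demands.
    have hgp : plugParity (fun i => g (Sum.inl i)) (n + weight (g ∘ Sum.inr) (rights l)) =
        fun i => ((if h : i = x₀ then n + ((rights l).map fun y => G (Sum.inr y)).sum
          else G (Sum.inl ⟨i, h⟩) : ℤ) : ZMod 2) := by
      rw [plugParity_intCast (fun i : {i : X // i ≠ x₀} => G (Sum.inl i))]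
      rw [hg]
      congr 1
      rw [Function.comp_def, weight_intCast]
      push_cast
      rfl
    have ht := iht hl.cons_lefts
      (plug_mem hx (a := inlInputs a) (G := fun i => G (Sum.inl i))
        (fun i => ha (Sum.inl i)) hs) hgp
    have hS := ihs hl.rights (a := inrInputs a) (G := fun y => G (Sum.inr y))
      (g := g ∘ Sum.inr) (fun y => ha (Sum.inr y)) (by rw [hg]; rfl)
    simp only [Term.eval]
    -- The head of the outer sum is the plugged slot and corresponds to the second-kind letters, the
    -- tail to the first-kind ones; on the right they come in the opposite order.
    rw [map_smul, ht, List.map_cons, List.sum_cons, sum_map_eq_lefts_add_rights, smul_add,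
      smul_add, smul_add, add_comm]
    congr 1
    · rw [List.map_map, smul_smul, List.smul_sum, List.smul_sum, List.map_map, List.map_map]
      congr 1
      refine List.map_congr_left fun i hi => ?_
      simp only [Function.comp_apply, inlInputs_update_inl, inrInputs_update_inl, plug_update,
        update_inl_comp_inr, update_inl_comp_inl, plugParity_update]
      have h3 := beforeParity_inl_add g hl.1 (mem_lefts.1 hi)
      have h4 : beforeParity (plugParity (fun i => g (Sum.inl i))
          (n + weight (g ∘ Sum.inr) (rights l))) (x₀ :: (lefts l).map Subtype.val) i.1 =
            n + weight (g ∘ Sum.inr) (rights l) + beforeParity (g ∘ Sum.inl) (lefts l) i := by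
        rw [beforeParity, if_neg (Ne.symm i.2), plugParity_self,
          beforeParity_map Subtype.val_injective]
        congr 2
        funext j
        exact plugParity_of_ne _ _ j.2
      rw [h4, plugParity_of_ne _ _ i.2, plug_of_ne hx _ _ i.2,
        smul_smul, smul_smul, smul_smul]
      simp only [← paritySign_add]
      congr 2
      rw [← hN]
      push_cast
      grind
    · rw [← plugParity_eq_update, plugParity_self, plug_self, colorCast_d, ← plug_eq_update, hS,
        ← Term.evalPlug_apply, map_smul, map_list_sum]
      simp only [List.smul_sum, List.map_map]
      congr 1
      refine List.map_congr_left fun y hy => ?_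
      have h3 := beforeParity_inr_add g hl.1 (mem_rights.1 hy)
      simp only [Function.comp_apply, inlInputs_update_inr, inrInputs_update_inr,
        update_inr_comp_inl, update_inr_comp_inr, map_smul, Term.evalPlug_apply]
      have h4 := weight_update_add_one (g ∘ Sum.inr) hl.rights.1 hy
      rw [Function.comp_apply] at h4
      rw [h4]
      simp only [smul_smul, ← paritySign_add]
      congr 2
      · rw [← hN]
        simp only [beforeParity, if_true]
        push_cast
        grind
      · rw [add_assoc]

end Eval

end Operads
-- The operad axioms hold for values of monomials.
namespace Operads

section Words

variable {X Y Z : Type} {x x' : X} {y : Y}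

/-- The last clause is the cocycle identity for shuffle signs: bringing the `Z`-letters to the front
and then the `Y`-letters before the `X`-letters crosses the same pairs as bringing `Y` and `Z`
together before `X` and then sorting them. The number `z` is arbitrary because the slot `y` is not a
letter of these words. -/
theorem map_seqEquiv_symm (K : List ({i : X // i ≠ x} ⊕ ({j : Y // j ≠ y} ⊕ Z)))
    (g : {i : X // i ≠ x} ⊕ ({j : Y // j ≠ y} ⊕ Z) → ZMod 2) (z : ZMod 2) :
    rights (K.map (seqEquiv Z x y).symm) = rights (rights K) ∧
    lefts ((lefts (K.map (seqEquiv Z x y).symm)).map Subtype.val) = lefts K ∧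
    rights ((lefts (K.map (seqEquiv Z x y).symm)).map Subtype.val) =
      (lefts (rights K)).map Subtype.val ∧
    shuffleParity (g ∘ seqEquiv Z x y) (K.map (seqEquiv Z x y).symm) +
        shuffleParity (plugParity (fun i => g (seqEquiv Z x y (Sum.inl i))) z)
          ((lefts (K.map (seqEquiv Z x y).symm)).map Subtype.val) =
      shuffleParity g K + shuffleParity (g ∘ Sum.inr) (rights K) := by
  induction K with
  | nil => simp
  | cons s K ih =>
    obtain ⟨h1, h2, h3, h4⟩ := ih
    rcases s with i | j | l
    · have e1 : (seqEquiv Z x y).symm (Sum.inl i) = Sum.inl ⟨Sum.inl i, Sum.inl_ne_inr⟩ := rfl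
      refine ⟨by simpa [e1] using h1, by simpa [e1] using h2, by simpa [e1] using h3, ?_⟩
      have e2 : plugParity (fun i => g (seqEquiv Z x y (Sum.inl i))) z (Sum.inl i) =
          g (Sum.inl i) := plugParity_of_ne _ _ Sum.inl_ne_inr
      have e3 : weight (plugParity (fun i => g (seqEquiv Z x y (Sum.inl i))) z ∘ Sum.inr)
          ((lefts (rights K)).map Subtype.val) = weight (g ∘ Sum.inr ∘ Sum.inl)
            (lefts (rights K)) := by
        rw [weight_map]
        congr 1
        funext j
        simp only [Function.comp_apply]
        rw [plugParity_of_ne _ _ (fun e => j.2 (Sum.inr_injective e))]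
        rfl
      have e4 : g ((seqEquiv Z x y) (Sum.inl ⟨Sum.inl i, Sum.inl_ne_inr⟩)) = g (Sum.inl i) := rfl
      have e5 : (g ∘ seqEquiv Z x y) ∘ Sum.inr = g ∘ Sum.inr ∘ Sum.inr := rfl
      have e6 := weight_sum_eq (g ∘ Sum.inr) (rights K)
      simp only [Function.comp_assoc] at e6
      simp only [List.map_cons, e1, shuffleParity_inl, lefts_inl, rights_inl, h1, h3, e2, e3,
        Function.comp_apply, e4, e5, e6]
      grind
    · have e1 : (seqEquiv Z x y).symm (Sum.inr (Sum.inl j)) =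
        Sum.inl ⟨Sum.inr j.1, fun e => j.2 (Sum.inr_injective e)⟩ := rfl
      refine ⟨by simpa [e1] using h1, by simpa [e1] using h2, by simpa [e1] using h3, ?_⟩
      have e4 : g ((seqEquiv Z x y) (Sum.inl ⟨Sum.inr j.1,
        fun e => j.2 (Sum.inr_injective e)⟩)) = g (Sum.inr (Sum.inl j)) := rfl
      have e5 : (g ∘ seqEquiv Z x y) ∘ Sum.inr = g ∘ Sum.inr ∘ Sum.inr := rfl
      simp only [List.map_cons, e1, shuffleParity_inl, shuffleParity_inr, lefts_inl, rights_inr,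
        h1, Function.comp_apply, e4, e5, Function.comp_assoc]
      grind
    · have e1 : (seqEquiv Z x y).symm (Sum.inr (Sum.inr l)) = Sum.inr l := rfl
      refine ⟨by simpa [e1] using h1, by simpa [e1] using h2, by simpa [e1] using h3, ?_⟩
      simpa [e1] using h4

/-- Both sides move the `Y`-block and the `Z`-block in front of the remaining letters, but in
opposite relative order. The extra product is the sign for exchanging the two blocks. The numbers
`z` and `z'` belong to slots that do not occur in the words. -/
theorem map_parEquiv_symm (hx : x ≠ x')
    (K : List ({v : {i : X // i ≠ x'} ⊕ Z // v ≠ Sum.inl ⟨x, hx⟩} ⊕ Y))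
    (g : {v : {i : X // i ≠ x'} ⊕ Z // v ≠ Sum.inl ⟨x, hx⟩} ⊕ Y → ZMod 2) (z z' : ZMod 2) :
    rights (K.map (parEquiv Y Z hx).symm) = rights ((lefts K).map Subtype.val) ∧
    rights ((lefts (K.map (parEquiv Y Z hx).symm)).map Subtype.val) = rights K ∧
    (lefts ((lefts (K.map (parEquiv Y Z hx).symm)).map Subtype.val)).map Subtype.val =
      (lefts ((lefts K).map Subtype.val)).map Subtype.val ∧
    shuffleParity (g ∘ parEquiv Y Z hx) (K.map (parEquiv Y Z hx).symm) +
        shuffleParity (plugParity (fun i => g (parEquiv Y Z hx (Sum.inl i))) z)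
          ((lefts (K.map (parEquiv Y Z hx).symm)).map Subtype.val) =
      shuffleParity g K +
        shuffleParity (plugParity (fun i => g (Sum.inl i)) z') ((lefts K).map Subtype.val) +
        weight (g ∘ Sum.inr) (rights K) *
          weight (plugParity (fun i => g (Sum.inl i)) z' ∘ Sum.inr)
            (rights ((lefts K).map Subtype.val)) := by
  induction K with
  | nil => simp
  | cons s K ih =>
    obtain ⟨h1, h2, h3, h4⟩ := ih
    have e5 : (g ∘ parEquiv Y Z hx) ∘ Sum.inr =
        plugParity (fun i => g (Sum.inl i)) z' ∘ Sum.inr := by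
      funext j
      rw [Function.comp_apply (f := plugParity _ _), plugParity_of_ne _ _ Sum.inr_ne_inl]
      rfl
    have e6 : plugParity (fun i => g (parEquiv Y Z hx (Sum.inl i))) z ∘ Sum.inr =
        g ∘ Sum.inr := by
      funext j
      rw [Function.comp_apply (f := plugParity _ _), plugParity_of_ne _ _ Sum.inr_ne_inl]
      rfl
    rcases s with ⟨i | l, hi⟩ | j
    · have e1 : (parEquiv Y Z hx).symm (Sum.inl ⟨Sum.inl i, hi⟩) =
        Sum.inl ⟨Sum.inl ⟨i.1, fun e => hi (congrArg Sum.inl (Subtype.ext e))⟩,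
          fun e => i.2 (congrArg Subtype.val (Sum.inl_injective e))⟩ := rfl
      refine ⟨by simpa [e1] using h1, by simpa [e1] using h2, by simpa [e1] using h3, ?_⟩
      have e2 : plugParity (fun i => g (parEquiv Y Z hx (Sum.inl i))) z
          (Sum.inl ⟨i.1, fun e => hi (congrArg Sum.inl (Subtype.ext e))⟩) =
          g (Sum.inl ⟨Sum.inl i, hi⟩) :=
        plugParity_of_ne _ _ (fun e => i.2 (congrArg Subtype.val (Sum.inl_injective e)))
      have e3 : plugParity (fun i => g (Sum.inl i)) z' (Sum.inl i) =
          g (Sum.inl ⟨Sum.inl i, hi⟩) := plugParity_of_ne _ _ hi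
      have e4 : g (parEquiv Y Z hx (Sum.inl
        ⟨Sum.inl ⟨i.1, fun e => hi (congrArg Sum.inl (Subtype.ext e))⟩,
          fun e => i.2 (congrArg Subtype.val (Sum.inl_injective e))⟩)) =
            g (Sum.inl ⟨Sum.inl i, hi⟩) := rfl
      simp only [List.map_cons, e1, shuffleParity_inl, lefts_inl, rights_inl, h1, h2, e2, e3,
        Function.comp_apply, e4, e5, e6]
      grind
    · have e1 : (parEquiv Y Z hx).symm (Sum.inl ⟨Sum.inr l, hi⟩) = Sum.inr l := rfl
      refine ⟨by simpa [e1] using h1, by simpa [e1] using h2, by simpa [e1] using h3, ?_⟩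
      have e3 : plugParity (fun i => g (Sum.inl i)) z' (Sum.inr l) =
          g (Sum.inl ⟨Sum.inr l, hi⟩) := plugParity_of_ne _ _ hi
      simp only [List.map_cons, e1, shuffleParity_inl, shuffleParity_inr, lefts_inr, lefts_inl,
        rights_inl, rights_inr, weight_cons, Function.comp_apply, e3, h4]
      grind
    · have e1 : (parEquiv Y Z hx).symm (Sum.inr j) = Sum.inl ⟨Sum.inr j, Sum.inr_ne_inl⟩ := rfl
      refine ⟨by simpa [e1] using h1, by simpa [e1] using h2, by simpa [e1] using h3, ?_⟩
      have e4 : g (parEquiv Y Z hx (Sum.inl ⟨Sum.inr j, Sum.inr_ne_inl⟩)) = g (Sum.inr j) := rfl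
      simp only [List.map_cons, e1, shuffleParity_inl, shuffleParity_inr, lefts_inr, lefts_inl,
        rights_inr, weight_cons, Function.comp_apply, h1, e4, e5]
      grind

end Words

section Eval

variable {k : Type u} [Field k] {C : Type} {V : C → DGVec.{u, w} k}
  {E : BinSMod k C} (A : BinAction V E)

namespace Term

theorem eval_relabel_refl {X : Type} {c : X → C} {d : C} {n : ℤ} (p : Term E X c d n)
    (l : List X) (g : X → ZMod 2) (a : ∀ x, V (c x)) :
    (Term.relabel (Equiv.refl X) (refl_color c) p).eval A l g a = p.eval A l g a := by
  simp only [Term.eval, Equiv.refl_symm, Equiv.coe_refl, List.map_id]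
  rfl

theorem eval_relabel_trans {X Y Z : Type} (e : X ≃ Y) (f : Y ≃ Z)
    {c : X → C} {c' : Y → C} {c'' : Z → C} (hc : ∀ x, c' (e x) = c x)
    (hc' : ∀ y, c'' (f y) = c' y) {d : C} {n : ℤ} (p : Term E X c d n)
    (l : List Z) (g : Z → ZMod 2) (a : ∀ z, V (c'' z)) :
    (Term.relabel f hc' (Term.relabel e hc p)).eval A l g a =
      (Term.relabel (e.trans f) (trans_color hc hc') p).eval A l g a := by
  -- Once the colourings are literally pulled back, all transports of colours are identities.
  obtain rfl : c' = c'' ∘ f := funext fun y => (hc' y).symm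
  obtain rfl : c = (c'' ∘ f) ∘ e := funext fun x => (hc x).symm
  simp only [Term.eval, List.map_map]
  rfl

theorem eval_comp_relabel {X X' Y Y' : Type} (e : X ≃ X') (f : Y ≃ Y') {c : X → C} {c' : X' → C}
    {b : Y → C} {b' : Y' → C} (hc : ∀ x, c' (e x) = c x) (hb : ∀ y, b' (f y) = b y)
    {a₀ d : C} {m n N : ℤ} (x : X) (hx : c x = a₀) (hN : m + n = N)
    (p : Term E X c d m) (q : Term E Y b a₀ n) (l : List ({i : X' // i ≠ e x} ⊕ Y'))
    (g : {i : X' // i ≠ e x} ⊕ Y' → ZMod 2)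
    (a : ∀ s, V (Sum.elim (fun i : {i : X' // i ≠ e x} => c' i.1) b' s)) :
    (Term.comp (e x) ((hc x).trans hx) hN (Term.relabel e hc p) (Term.relabel f hb q)).eval A l g a =
      (Term.relabel (compEquiv e f x) (comp_color hc hb x) (Term.comp x hx hN p q)).eval A l g a := by
  obtain rfl : c = c' ∘ e := funext fun x => (hc x).symm
  obtain rfl : b = b' ∘ f := funext fun x => (hb x).symm
  subst hx
  have hsymm : ⇑(compEquiv e f x).symm = Sum.map (fun i : {i : X' // i ≠ e x} =>
      (⟨e.symm i.1, fun h => i.2 (e.symm_apply_eq.1 h)⟩ : {i : X // i ≠ x}))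
        f.symm := by
    funext s
    rcases s with i | j <;> rfl
  have hg : (g ∘ compEquiv e f x) ∘ (compEquiv e f x).symm = g := by
    funext; simp
  simp only [Term.eval]
  rw [hsymm, shuffleParity_map_sumMap, ← hsymm, hg, hsymm, lefts_map_sumMap, rights_map_sumMap,
    List.map_cons, Equiv.symm_apply_apply, List.map_map, List.map_map]
  have hs : q.eval A ((rights l).map f.symm) ((g ∘ Sum.inr) ∘ f)
      (fun y => colorCast (hb y) (inrInputs a (f y))) =
      q.eval A ((rights l).map f.symm) ((g ∘ compEquiv e f x) ∘ Sum.inr) (inrInputs fun s =>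
        colorCast (comp_color hc hb x s) (a (compEquiv e f x s))) := rfl
  congr 2
  · funext i
    by_cases h : i = x
    · subst h
      rw [Function.comp_apply, plugParity_self, plugParity_self, weight_map]
      congr 2
      funext y
      simp [compEquiv]
    · rw [Function.comp_apply, plugParity_of_ne _ _ (fun h' => h (e.injective h')),
        plugParity_of_ne _ _ h]
      rfl
  · funext i
    by_cases h : i = x
    · subst h
      rw [plug_self, plug_self, ← hs]
      rfl
    · rw [plug_of_ne _ _ _ (fun h' => h (e.injective h')), plug_of_ne _ _ _ h]
      rfl

theorem eval_comp_seq {X Y Z : Type} {c : X → C} {b : Y → C} {f : Z → C}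
    {a₀ a₁ d : C} {l m n lm mn N : ℤ} (x : X) (y : Y) (hx : c x = a₀) (hy : b y = a₁)
    (h₁ : l + m = lm) (h₂ : lm + n = N) (h₃ : m + n = mn) (h₄ : l + mn = N)
    (p : Term E X c d l) (q : Term E Y b a₀ m) (r : Term E Z f a₁ n)
    (K : List ({i : X // i ≠ x} ⊕ ({j : Y // j ≠ y} ⊕ Z)))
    (g : {i : X // i ≠ x} ⊕ ({j : Y // j ≠ y} ⊕ Z) → ZMod 2)
    (a : ∀ s, V (Sum.elim (fun i : {i : X // i ≠ x} => c i.1)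
      (Sum.elim (fun i : {j : Y // j ≠ y} => b i.1) f) s)) :
    (Term.relabel (seqEquiv Z x y) (seq_color c b f x y)
      (Term.comp (Sum.inr y) ((Sum.elim_inr _ _ _).trans hy) h₂
        (Term.comp x hx h₁ p q) r)).eval A K g a =
      (Term.comp x hx h₄ p (Term.comp y hy h₃ q r)).eval A K g a := by
  subst hx hy
  obtain ⟨e1, e2, e3, e4⟩ := map_seqEquiv_symm K g
    (n + weight ((g ∘ seqEquiv Z x y) ∘ Sum.inr) (rights (K.map (seqEquiv Z x y).symm)))
  simp only [Term.eval, lefts_inr, rights_inr, shuffleParity_inr, paritySign_smul_smul]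
  -- The shuffle sign of the inner composite is a scalar inside a plugged slot; linearity in that
  -- slot brings it outside.
  simp only [← Term.evalPlug_apply, map_smul, paritySign_smul_smul]
  simp only [Term.evalPlug_apply]
  have f1 (z : ZMod 2) : (fun i : {i : X // i ≠ x} =>
      plugParity (fun i => (g ∘ seqEquiv Z x y) (Sum.inl i)) z (Sum.inl i)) =
        fun i => g (Sum.inl i) := by
    funext i
    rw [plugParity_of_ne _ _ Sum.inl_ne_inr]
    rfl
  have f2 (z : ZMod 2) : plugParity (fun i => (g ∘ seqEquiv Z x y) (Sum.inl i)) z ∘ Sum.inr =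
      plugParity (fun i : {j : Y // j ≠ y} => (g ∘ Sum.inr) (Sum.inl i)) z := by
    funext j
    by_cases hj : j = y
    · subst hj
      rw [Function.comp_apply, plugParity_self, plugParity_self]
    · rw [Function.comp_apply, plugParity_of_ne _ _ hj,
        plugParity_of_ne _ _ fun h => hj (Sum.inr_injective h)]
      rfl
  have t1 (h : Sum.elim (fun i : {i : X // i ≠ x} => c i) b (Sum.inr y) = b y) (v : V (b y)) :
      inlInputs (plug h (inlInputs fun s => colorCast (seq_color c b f x y s)
        (a (seqEquiv Z x y s))) v) = inlInputs a := by
    funext i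
    rw [inlInputs, plug_of_ne _ _ _ Sum.inl_ne_inr]
    rfl
  have t2 (h : Sum.elim (fun i : {i : X // i ≠ x} => c i) b (Sum.inr y) = b y) (v : V (b y)) :
      inrInputs (plug h (inlInputs fun s => colorCast (seq_color c b f x y s)
        (a (seqEquiv Z x y s))) v) = plug rfl (inlInputs (inrInputs a)) v := by
    funext j
    by_cases hj : j = y
    · subst hj
      rw [inrInputs, plug_self, plug_self]
      rfl
    · rw [inrInputs, plug_of_ne _ _ _ hj, plug_of_ne _ _ _ fun h => hj (Sum.inr_injective h)]
      rfl
  have e5 := weight_sum_eq (g ∘ Sum.inr) (rights K)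
  have e6 : (g ∘ seqEquiv Z x y) ∘ Sum.inr = (g ∘ Sum.inr) ∘ Sum.inr := rfl
  have t3 : (inrInputs fun s => colorCast (seq_color c b f x y s) (a (seqEquiv Z x y s))) =
    inrInputs (inrInputs a) := rfl
  rw [f1, f2, t1, t2, e3, weight_cons, plugParity_self, weight_plugParity]
  simp only [Function.comp_apply (f := g) (g := seqEquiv Z x y)]
  rw [e4, e1, e2, e6, e5, t3, ← h₃]
  congr 3
  push_cast
  simp only [Function.comp_def]
  ring

/-- The two sides list the slots of `p` as `x, x'` and as `x', x`, and exchanging them costs `(m +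
|Y|)(n + |Z|)`, with `|Y|`, `|Z|` the weights of the blocks. The outer shuffles contribute `(n +
|Z|)|Y|` and `(m + |Y|)|Z|`, and exchanging the blocks contributes `|Y||Z|`. Modulo two the total is
`mn`. -/
theorem eval_comp_par {X Y Z : Type} {c : X → C} {b : Y → C} {f : Z → C}
    {a₀ a₁ d : C} {l m n lm ln N : ℤ} {x x' : X} (hxx' : x ≠ x') (hx : c x = a₀)
    (hx' : c x' = a₁) (h₁ : l + m = lm) (h₂ : lm + n = N) (h₃ : l + n = ln) (h₄ : ln + m = N)
    (p : Term E X c d l) (q : Term E Y b a₀ m) (r : Term E Z f a₁ n)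
    (K : List ({v : {i : X // i ≠ x'} ⊕ Z // v ≠ Sum.inl ⟨x, hxx'⟩} ⊕ Y)) (hK : K.Nodup)
    (g : {v : {i : X // i ≠ x'} ⊕ Z // v ≠ Sum.inl ⟨x, hxx'⟩} ⊕ Y → ZMod 2)
    (a : ∀ s, V (Sum.elim (fun i : {v : {i : X // i ≠ x'} ⊕ Z // v ≠ Sum.inl ⟨x, hxx'⟩} =>
      Sum.elim (fun j : {i : X // i ≠ x'} => c j.1) f i.1) b s)) :
    (Term.relabel (parEquiv Y Z hxx') (par_color c b f hxx')
      (Term.comp (Sum.inl ⟨x', hxx'.symm⟩) ((Sum.elim_inl _ _ _).trans hx') h₂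
        (Term.comp x hx h₁ p q) r)).eval A K g a =
      (-1 : k) ^ (m * n) • (Term.comp (Sum.inl ⟨x, hxx'⟩) ((Sum.elim_inl _ _ _).trans hx) h₄
        (Term.comp x' hx' h₃ p r) q).eval A K g a := by
  subst hx hx'
  obtain ⟨e1, e2, e3, e4⟩ := map_parEquiv_symm hxx' K g
    (n + weight ((g ∘ parEquiv Y Z hxx') ∘ Sum.inr) (rights (K.map (parEquiv Y Z hxx').symm)))
    (m + weight (g ∘ Sum.inr) (rights K))
  have hnd := nodup_cons_lefts (nodup_cons_lefts hK)
  simp only [Term.eval, lefts_inl, rights_inl, shuffleParity_inl, List.map_cons] at hnd ⊢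
  have hsw := p.eval_swap A [] _ x x' ((List.Perm.swap _ _ _).nodup_iff.1 hnd)
  simp only [List.nil_append] at hsw
  rw [hsw, e1, e2, e3]
  rw [e1] at e4
  rw [neg_one_zpow_eq_paritySign]
  simp only [paritySign_smul_smul]
  set a' : ∀ s, V (Sum.elim (fun i : {v : {i : X // i ≠ x} ⊕ Y // v ≠ Sum.inl ⟨x', hxx'.symm⟩} =>
      Sum.elim (fun j : {i : X // i ≠ x} => c j.1) b i.1) f s) :=
    fun s => colorCast (par_color c b f hxx' s) (a (parEquiv Y Z hxx' s)) with ha'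
  have f5 (z : ZMod 2) : plugParity (fun i => g (Sum.inl i)) z ∘ Sum.inr =
      (g ∘ parEquiv Y Z hxx') ∘ Sum.inr := by
    funext j
    rw [Function.comp_apply, plugParity_of_ne _ _ Sum.inr_ne_inl]
    rfl
  have f6 (z : ZMod 2) : plugParity (fun i => (g ∘ parEquiv Y Z hxx') (Sum.inl i)) z ∘ Sum.inr =
      g ∘ Sum.inr := by
    funext j
    rw [Function.comp_apply, plugParity_of_ne _ _ Sum.inr_ne_inl]
    rfl
  have t5 (h : Sum.elim (fun i : {i : X // i ≠ x'} => c i) f (Sum.inl ⟨x, hxx'⟩) = c x)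
      (v : V (c x)) : inrInputs (plug h (inlInputs a) v) = inrInputs a' := by
    funext j
    rw [inrInputs, plug_of_ne _ _ _ Sum.inr_ne_inl]
    rfl
  have t6 (h : Sum.elim (fun i : {i : X // i ≠ x} => c i) b (Sum.inl ⟨x', hxx'.symm⟩) = c x')
      (v : V (c x')) : inrInputs (plug h (inlInputs a') v) = inrInputs a := by
    funext j
    rw [inrInputs, plug_of_ne _ _ _ Sum.inr_ne_inl]
    rfl
  rw [f5] at e4
  simp only [f5, f6, t5, t6]
  have f7 (z z' : ZMod 2) :
      plugParity (fun i : {i : X // i ≠ x} => plugParity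
        (fun i => (g ∘ parEquiv Y Z hxx') (Sum.inl i)) z (Sum.inl i)) z' =
      plugParity (fun i : {i : X // i ≠ x'} => plugParity
        (fun i => g (Sum.inl i)) z' (Sum.inl i)) z := by
    funext i
    by_cases h : i = x
    · subst h
      rw [plugParity_self, plugParity_of_ne _ _ hxx', plugParity_self]
    · by_cases h' : i = x'
      · subst h'
        rw [plugParity_self, plugParity_of_ne _ _ h, plugParity_self]
      · rw [plugParity_of_ne _ _ h, plugParity_of_ne _ _ h',
          plugParity_of_ne _ _ (fun e => h' (congrArg Subtype.val (Sum.inl_injective e))),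
          plugParity_of_ne _ _ (fun e => h (congrArg Subtype.val (Sum.inl_injective e)))]
        rfl
  have t7 (h : Sum.elim (fun i : {i : X // i ≠ x'} => c i) f (Sum.inl ⟨x, hxx'⟩) = c x)
      (h' : Sum.elim (fun i : {i : X // i ≠ x} => c i) b (Sum.inl ⟨x', hxx'.symm⟩) = c x')
      (v : V (c x)) (v' : V (c x')) :
      plug rfl (inlInputs (plug h' (inlInputs a') v')) v =
        plug rfl (inlInputs (plug h (inlInputs a) v)) v' := by
    funext i
    by_cases hi : i = x
    · subst hi
      rw [plug_self, plug_of_ne _ _ _ hxx', inlInputs, plug_self]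
      rfl
    · by_cases hi' : i = x'
      · subst hi'
        rw [plug_self, plug_of_ne _ _ _ hi, inlInputs, plug_self]
        rfl
      · rw [plug_of_ne _ _ _ hi, plug_of_ne _ _ _ hi', inlInputs, inlInputs,
          plug_of_ne _ _ _ (fun e => hi' (congrArg Subtype.val (Sum.inl_injective e))),
          plug_of_ne _ _ _ (fun e => hi (congrArg Subtype.val (Sum.inl_injective e)))]
        rfl
  rw [f7, t7 rfl]
  congr 2
  rw [plugParity_self, plugParity_of_ne _ _ hxx', plugParity_self, plugParity_self]
  simp only [Function.comp_apply (f := g) (g := parEquiv Y Z hxx')]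
  push_cast
  grind

theorem eval_unit_comp {X : Type} {c : X → C} {d : C} {n : ℤ} (p : Term E X c d n)
    (l : List X) (g : X → ZMod 2) (a : ∀ x, V (c x)) :
    (Term.relabel (unitLeftEquiv X) (unitLeft_color d c)
      (Term.comp () rfl (zero_add n) (Term.unit d) p)).eval A l g a = p.eval A l g a := by
  have h : ⇑(unitLeftEquiv X).symm = Sum.inr := rfl
  simp only [Term.eval, h, shuffleParity_map_inr, rights_map_inr, paritySign_zero, one_smul,
    plug_self]
  rfl

/-- Plugging the identity into `x` moves the letter `x` to the front, with the same sign as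
`Term.eval_move`. The word must therefore contain `x`, and contain it once. -/
theorem eval_comp_unit {X : Type} {c : X → C} {d : C} {n : ℤ} (x : X) (p : Term E X c d n)
    (l : List X) (hl : IsEnum l) (g : X → ZMod 2) (a : ∀ x, V (c x)) :
    (Term.relabel (unitRightEquiv x) (unitRight_color c x)
      (Term.comp x rfl (add_zero n) p (Term.unit (c x)))).eval A l g a = p.eval A l g a := by
  classical
  obtain ⟨l₁, l₂, rfl⟩ := List.append_of_mem (hl.2 x)
  have hx : (unitRightEquiv x).symm x = Sum.inr () := by simp [unitRightEquiv]
  -- A word that avoids `x` lifts to the labels different from `x`; this applies to the parts of the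
  -- word before and after `x`.
  have hne : ∀ m : List X, x ∉ m → ∃ m' : List {i : X // i ≠ x},
      m.map (unitRightEquiv x).symm = m'.map Sum.inl ∧ m = m'.map Subtype.val := by
    intro m hm
    refine ⟨m.attach.map fun i => ⟨i.1, by rintro h; exact hm (h ▸ i.2)⟩, ?_, ?_⟩
    · rw [List.map_map]
      conv_lhs => rw [← List.attach_map_subtype_val m]
      rw [List.map_map]
      refine List.map_congr_left fun i _ => ?_
      have : i.1 ≠ x := by rintro h; exact hm (h ▸ i.2)
      simp [unitRightEquiv, this]
    · rw [List.map_map]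
      conv_lhs => rw [← List.attach_map_subtype_val m]
      rfl
  have hnd := hl.1
  rw [List.nodup_append, List.nodup_cons] at hnd
  obtain ⟨m₁, h₁, h₁'⟩ := hne l₁ fun h => hnd.2.2 _ h _ List.mem_cons_self rfl
  obtain ⟨m₂, h₂, h₂'⟩ := hne l₂ hnd.2.1.1
  have hmove := p.eval_move A [] l₁ l₂ x hl.1 g a
  simp only [List.nil_append] at hmove
  rw [hmove]
  simp only [Term.eval, List.map_append, List.map_cons, hx, h₁, h₂, shuffleParity_append,
    shuffleParity_inr, lefts_append, rights_append, lefts_inr, rights_inr, lefts_map_inl,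
    rights_map_inl, shuffleParity_map_inl, List.nil_append, weight_cons, weight_nil, add_zero,
    zero_add, ← h₁', ← h₂', Int.cast_zero, List.cons_append]
  have hw : weight ((g ∘ unitRightEquiv x) ∘ Sum.inl) m₁ = weight g l₁ := by
    rw [h₁', weight_map]
    rfl
  rw [hw, mul_comm]
  congr 2
  · funext i
    by_cases hi : i = x
    · subst hi; rw [plugParity_self]; rfl
    · rw [plugParity_of_ne _ _ hi]; rfl
  · funext i
    by_cases hi : i = x
    · subst hi; rw [plug_self]; rfl
    · rw [plug_of_ne _ _ _ hi]; rfl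

theorem eval_gen_swap {a₀ b₀ d : C} {n : ℤ} (e : E.M n a₀ b₀ d) (l : List (Fin 2))
    (hl : IsEnum l) (a : ∀ i, V (![b₀, a₀] i)) {G : Fin 2 → ℤ}
    (ha : ∀ x, a x ∈ (V (![b₀, a₀] x)).gr (G x)) (g : Fin 2 → ZMod 2) (hg : g = fun x => (G x : ZMod 2)) :
    (Term.relabel (Equiv.swap 0 1) (swap_color a₀ b₀) (Term.gen e)).eval A l g a =
      (Term.gen (E.swap e)).eval A l g a := by
  have h := A.op_swap e (x := sndInput a) (y := fstInput a) (ha 1) (ha 0)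
  have h0 : fstInput (fun i => colorCast (swap_color a₀ b₀ i) (a (Equiv.swap 0 1 i))) =
    sndInput a := rfl
  have h1 : sndInput (fun i => colorCast (swap_color a₀ b₀ i) (a (Equiv.swap 0 1 i))) =
    fstInput a := rfl
  rw [neg_one_zpow_eq_paritySign, Int.cast_mul] at h
  have hg0 : g 0 = (G 0 : ZMod 2) := by rw [hg]
  have hg1 : g 1 = (G 1 : ZMod 2) := by rw [hg]
  simp only [Term.eval, h0, h1, h, paritySign_smul_smul, ← hg0, ← hg1]
  rcases isEnum_fin_two hl with rfl | rfl
  · simp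
  · simp [mul_comm (g 0), CharTwo.add_self_eq_zero]

end Term

end Eval

end Operads
-- Vanishing combinations of monomials have value zero.
namespace Operads

section Vanish

variable {k : Type u} [Field k] {C : Type} {V : C → DGVec.{u, w} k}

section
variable {E : BinSMod k C} (A : BinAction V E)

/-- The value of a linear combination of monomials. -/
noncomputable def linEval {X : Type} {c : X → C} (d : C) (n : ℤ) (l : List X) (g : X → ZMod 2)
    (a : ∀ x, V (c x)) : (Term E X c d n →₀ k) →ₗ[k] V d :=
  Finsupp.linearCombination k fun t => t.eval A l g a

@[simp] theorem linEval_single {X : Type} {c : X → C} {d : C} {n : ℤ} (l : List X)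
    (g : X → ZMod 2) (a : ∀ x, V (c x)) (t : Term E X c d n) (r : k) :
    linEval A d n l g a (Finsupp.single t r) = r • t.eval A l g a :=
  Finsupp.linearCombination_single _ _ _

theorem linEval_rawRelabel {X Y : Type} (e : X ≃ Y) {c : X → C} {c' : Y → C}
    (hc : ∀ x, c' (e x) = c x) {d : C} {n : ℤ} (l : List Y) (g : Y → ZMod 2)
    (a : ∀ x, V (c' x)) (p : Term E X c d n →₀ k) :
    linEval A d n l g a (rawRelabel e hc p) =
      linEval A d n (l.map e.symm) (g ∘ e) (fun x => colorCast (hc x) (a (e x))) p := by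
  induction p using Finsupp.induction_linear with
  | zero => simp
  | add p q hp hq => simp only [map_add, hp, hq]
  | single t r => simp [rawRelabel, Term.eval]

theorem linEval_rawComp_single_right {X Y : Type} (x : X) {c : X → C} {b : Y → C} {e d : C}
    {m n N : ℤ} (hx : c x = e) (hN : m + n = N) (l : List ({i : X // i ≠ x} ⊕ Y))
    (g : {i : X // i ≠ x} ⊕ Y → ZMod 2)
    (a : ∀ s, V (Sum.elim (fun i : {i : X // i ≠ x} => c i) b s))
    (p : Term E X c d m →₀ k) (s : Term E Y b e n) (r : k) :
    linEval A d N l g a (rawComp x hx hN p (Finsupp.single s r)) =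
      (r * paritySign k (shuffleParity g l)) • linEval A d m (x :: (lefts l).map Subtype.val)
        (plugParity (fun i => g (Sum.inl i)) (n + weight (g ∘ Sum.inr) (rights l)))
        (plug hx (inlInputs a) (s.eval A (rights l) (g ∘ Sum.inr) (inrInputs a))) p := by
  induction p using Finsupp.induction_linear with
  | zero => simp
  | add p q hp hq => simp only [map_add, LinearMap.add_apply, hp, hq, smul_add]
  | single t r' =>
    simp only [rawComp, Finsupp.linearCombination_single, LinearMap.smul_apply,
      Finsupp.lmapDomain_apply, Finsupp.mapDomain_single, map_smul, linEval_single, Term.eval,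
      smul_smul]
    congr 1
    ring

theorem linEval_rawComp_single_left {X Y : Type} (x : X) {c : X → C} {b : Y → C} {e d : C}
    {m n N : ℤ} (hx : c x = e) (hN : m + n = N) (l : List ({i : X // i ≠ x} ⊕ Y))
    (g : {i : X // i ≠ x} ⊕ Y → ZMod 2)
    (a : ∀ s, V (Sum.elim (fun i : {i : X // i ≠ x} => c i) b s))
    (t : Term E X c d m) (r : k) (q : Term E Y b e n →₀ k) :
    linEval A d N l g a (rawComp x hx hN (Finsupp.single t r) q) =
      (r * paritySign k (shuffleParity g l)) • t.evalPlug A (x :: (lefts l).map Subtype.val)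
        (plugParity (fun i => g (Sum.inl i)) (n + weight (g ∘ Sum.inr) (rights l)))
        hx (inlInputs a) (linEval A e n (rights l) (g ∘ Sum.inr) (inrInputs a) q) := by
  induction q using Finsupp.induction_linear with
  | zero => simp
  | add p q hp hq => simp only [map_add, hp, hq, smul_add]
  | single s r' =>
    simp only [rawComp, Finsupp.linearCombination_single, LinearMap.smul_apply,
      Finsupp.lmapDomain_apply, Finsupp.mapDomain_single, map_smul, linEval_single, Term.eval,
      smul_smul, Term.evalPlug_apply]
    congr 1
    ring

end

/-- The binary operations satisfy the relations `R`. -/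
def BinAction.Satisfies {Q : BinaryQuadraticData k C} (A : BinAction V Q.E) : Prop :=
  ∀ ⦃c : Fin 3 → C⦄ ⦃d : C⦄ ⦃n : ℤ⦄ (r : Comb Q.E c d n →₀ k),
    Submodule.Quotient.mk r ∈ Q.R c d n → ∀ ⦃l : List (Fin 3)⦄, IsEnum l →
    ∀ ⦃a : ∀ x, V (c x)⦄ ⦃G : Fin 3 → ℤ⦄, (∀ x, a x ∈ (V (c x)).gr (G x)) →
    linEval A d n l (fun x => (G x : ZMod 2)) a (Finsupp.mapDomain Comb.toTerm r) = 0

/-- Evaluation descends to `F(E)/(R)`. In the induction on `Vanish` the operad axioms are the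
preceding lemmas, the relations of the `𝕊`-module `E` are linearity and symmetry of the operations,
and `R` is the hypothesis. Under composition the inner value is itself homogeneous, so the
hypothesis on degrees is inherited. -/
theorem linEval_eq_zero_of_vanish {Q : BinaryQuadraticData k C} {A : BinAction V Q.E}
    (hA : A.Satisfies) {X : Type} {c : X → C} {d : C} {n : ℤ} {p : Term Q.E X c d n →₀ k}
    (hp : Vanish Q p) {l : List X} (hl : IsEnum l) {a : ∀ x, V (c x)} {G : X → ℤ}
    (ha : ∀ x, a x ∈ (V (c x)).gr (G x)) {g : X → ZMod 2} (hg : g = fun x => (G x : ZMod 2)) :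
    linEval A d n l g a p = 0 := by
  induction hp with
  | zero => simp
  | add _ _ h₁ h₂ => rw [map_add, h₁ hl ha hg, h₂ hl ha hg, add_zero]
  | smul r _ h => rw [map_smul, h hl ha hg, smul_zero]
  | relabel e hc _ h =>
    rw [linEval_rawRelabel]
    exact h (hl.map e.symm) (G := G ∘ e) (fun x => colorCast_mem _ (ha _)) (by rw [hg]; rfl)
  | @comp_left X Y x c b e d m n N hx hN p q _ h =>
    induction q using Finsupp.induction_linear with
    | zero => simp
    | add q q' hq hq' => rw [map_add, map_add, hq, hq', add_zero]
    | single s r =>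
      classical
      rw [linEval_rawComp_single_right, h hl.cons_lefts (plug_mem hx (a := inlInputs a)
        (G := fun i => G (Sum.inl i)) (fun i => ha (Sum.inl i))
          (s.eval_mem A hl.rights (g ∘ Sum.inr) (a := inrInputs a)
            (G := fun y => G (Sum.inr y)) (fun y => ha (Sum.inr y)))), smul_zero]
      rw [plugParity_intCast (fun i : {i : X // i ≠ x} => G (Sum.inl i)), hg]
      congr 1
      rw [Function.comp_def, weight_intCast]
      push_cast
      rfl
  | @comp_right X Y x c b e d m n N hx hN p q _ h =>
    induction p using Finsupp.induction_linear with
    | zero => simp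
    | add q q' hq hq' => rw [map_add, LinearMap.add_apply, map_add, hq, hq', add_zero]
    | single s r =>
      rw [linEval_rawComp_single_left, h hl.rights (a := inrInputs a)
        (G := fun y => G (Sum.inr y)) (g := g ∘ Sum.inr)
        (fun y => ha (Sum.inr y)) (by rw [hg]; rfl), map_zero, smul_zero]
  | relabel_refl p => simp [Term.eval_relabel_refl]
  | relabel_trans e f hc hc' p => simp [Term.eval_relabel_trans]
  | comp_relabel e f hc hb x hx hN p q =>
    rw [map_sub, linEval_single, linEval_single, Term.eval_comp_relabel A e f hc hb x hx, sub_self]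
  | comp_seq x y hx hy h₁ h₂ h₃ h₄ p q r =>
    rw [map_sub, linEval_single, linEval_single, Term.eval_comp_seq A x y hx hy h₁ h₂ h₃ h₄,
      sub_self]
  | comp_par hxx' hx hx' h₁ h₂ h₃ h₄ p q r =>
    rw [map_sub, linEval_single, linEval_single,
      Term.eval_comp_par A hxx' hx hx' h₁ h₂ h₃ h₄ p q r _ hl.1, one_smul, sub_self]
  | unit_comp p => simp [Term.eval_unit_comp]
  | comp_unit x p => simp [Term.eval_comp_unit A x p _ hl]
  | gen_add e e' => simp [Term.eval, sub_sub]
  | gen_smul r e => simp [Term.eval, smul_comm r]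
  | gen_swap e => simp [Term.eval_gen_swap A e l hl a ha g hg]
  | rel r hr => rw [hg]; exact hA r hr hl ha

end Vanish

end Operads
-- Extension to inputs that are not homogeneous.
namespace Operads

section Homogeneous

variable {k : Type u} [Field k] {C : Type} {V : C → DGVec.{u, w} k}

theorem DGVec.mem_closure_homogeneous (H : DGVec.{u, w} k) (v : H) :
    v ∈ AddSubmonoid.closure {x : H | ∃ n, x ∈ H.gr n} := by
  have hv : v ∈ ⨆ n, H.gr n := by rw [H.isInternal.submodule_iSup_eq_top]; trivial
  exact Submodule.iSup_induction H.gr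
    (motive := fun v => v ∈ AddSubmonoid.closure {x : H | ∃ n, x ∈ H.gr n}) hv
    (fun n x hx => AddSubmonoid.subset_closure ⟨n, hx⟩) (zero_mem _) fun x y hx hy => add_mem hx hy

/-- The projection to the part of parity `ε`. -/
noncomputable def DGVec.parityProj (H : DGVec.{u, w} k) (ε : ZMod 2) : H →ₗ[k] H :=
  (DirectSum.toModule k ℤ H fun n => if (n : ZMod 2) = ε then (H.gr n).subtype else 0) ∘ₗ
    (LinearEquiv.ofBijective (DirectSum.coeLinearMap H.gr) H.isInternal).symm.toLinearMap

theorem DGVec.parityProj_apply {H : DGVec.{u, w} k} (ε : ZMod 2) {n : ℤ} {x : H}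
    (hx : x ∈ H.gr n) : H.parityProj ε x = if (n : ZMod 2) = ε then x else 0 := by
  have h : (LinearEquiv.ofBijective (DirectSum.coeLinearMap H.gr) H.isInternal).symm x =
      DirectSum.lof k ℤ (fun n => H.gr n) n ⟨x, hx⟩ := by
    rw [LinearEquiv.symm_apply_eq]
    exact (DirectSum.coeLinearMap_lof H.gr n ⟨x, hx⟩).symm
  rw [parityProj, LinearMap.comp_apply, LinearEquiv.coe_coe, h, DirectSum.toModule_lof]
  split_ifs <;> rfl

-- The coordinates are expanded one at a time as sums of elements of `T x`. Only additivity in each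
-- slot is used, so the lemma also serves for differences of expressions in which several maps are
-- composed.
open Classical in
theorem eq_zero_of_additive {X : Type} [Finite X] {M : X → Type*} [∀ x, AddCommGroup (M x)]
    {W : Type*} [AddCommGroup W] (f : (∀ x, M x) → W)
    (hadd : ∀ a x u v, f (Function.update a x (u + v)) =
      f (Function.update a x u) + f (Function.update a x v))
    (T : ∀ x, Set (M x)) (a : ∀ x, M x) (ha : ∀ x, a x ∈ AddSubmonoid.closure (T x))
    (h : ∀ b, (∀ x, b x ∈ T x) → f b = 0) : f a = 0 := by
  have := Fintype.ofFinite X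
  -- Here `S` holds the coordinates that may still be arbitrary sums; the induction removes them one
  -- by one.
  suffices key : ∀ (S : Finset X) (a : ∀ x, M x), (∀ x, a x ∈ AddSubmonoid.closure (T x)) →
      (∀ x ∉ S, a x ∈ T x) → f a = 0 from
    key Finset.univ a ha fun x hx => (hx (Finset.mem_univ x)).elim
  intro S
  induction S using Finset.induction_on with
  | empty => exact fun a _ ha => h a fun x => ha x (Finset.notMem_empty x)
  | insert x S _ ih =>
    intro a ha ha'
    suffices hv : ∀ v ∈ AddSubmonoid.closure (T x), f (Function.update a x v) = 0 by
      simpa using hv (a x) (ha x)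
    intro v hv
    induction hv using AddSubmonoid.closure_induction with
    | mem v hv =>
      refine ih _ (fun y => ?_) fun y hy => ?_
      · rcases eq_or_ne y x with rfl | hyx
        · simpa using AddSubmonoid.subset_closure hv
        · simpa [hyx] using ha y
      · rcases eq_or_ne y x with rfl | hyx
        · simpa using hv
        · simpa [hyx] using ha' y (by simp [hyx, hy])
    | zero => simpa using hadd a x 0 0
    | add u v _ _ hu hv => rw [hadd, hu, hv, add_zero]

open Classical in
/-- A multiadditive function vanishes if it vanishes on homogeneous tuples; the coordinates
in `S` are homogeneous and stay fixed. -/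
theorem eq_zero_of_homogeneous {X : Type} [Finite X] {c : X → C} {W : Type*} [AddCommGroup W]
    (f : (∀ x, V (c x)) → W)
    (hadd : ∀ a x u v, f (Function.update a x (u + v)) =
      f (Function.update a x u) + f (Function.update a x v))
    (S : Set X) (g : X → ℤ) (a : ∀ x, V (c x)) (ha : ∀ x ∈ S, a x ∈ (V (c x)).gr (g x))
    (h : ∀ (b : ∀ x, V (c x)) (G : X → ℤ), (∀ x, b x ∈ (V (c x)).gr (G x)) →
      (∀ x ∈ S, G x = g x) → f b = 0) : f a = 0 := by
  refine eq_zero_of_additive f hadd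
    (fun x => {v | ∃ n, v ∈ (V (c x)).gr n ∧ (x ∈ S → n = g x)}) a (fun x => ?_) fun b hb => ?_
  · by_cases hx : x ∈ S
    · exact AddSubmonoid.subset_closure ⟨g x, ha x hx, fun _ => rfl⟩
    · simpa [hx] using (V (c x)).mem_closure_homogeneous (a x)
  · choose G hG using hb
    exact h b G (fun x => (hG x).1) fun x => (hG x).2

end Homogeneous

section Act

variable {k : Type u} [Field k] {C : Type} {V : C → DGVec.{u, w} k}

section
variable {E : BinSMod k C} (A : BinAction V E)

open Classical in
/-- The value of a monomial on tuples that are not necessarily homogeneous. -/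
noncomputable def Term.act {X : Type} [Finite X] {c : X → C} {d : C} {n : ℤ} (l : List X)
    (t : Term E X c d n) : MultilinearMap k (fun x => (V (c x)).carrier) (V d).carrier :=
  haveI := Fintype.ofFinite X
  -- The sum runs over all assignments of parities. On a homogeneous tuple the projections kill
  -- every term except the one with the actual parities.
  ∑ g : X → ZMod 2,
    (t.evalMultilinear A l g).compLinearMap fun x => (V (c x)).parityProj (g x)

theorem Term.act_apply {X : Type} [Finite X] {c : X → C} {d : C} {n : ℤ} (l : List X)
    (t : Term E X c d n) {a : ∀ x, V (c x)} {G : X → ℤ} (ha : ∀ x, a x ∈ (V (c x)).gr (G x)) :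
    t.act A l a = t.eval A l (fun x => (G x : ZMod 2)) a := by
  classical
  have := Fintype.ofFinite X
  rw [Term.act, _root_.sum_apply, Finset.sum_eq_single fun x => (G x : ZMod 2)]
  · rw [MultilinearMap.compLinearMap_apply, Term.evalMultilinear_apply]
    congr 1
    funext x
    rw [DGVec.parityProj_apply _ (ha x), if_pos rfl]
  · intro g _ hg
    obtain ⟨x, hx⟩ := Function.ne_iff.1 hg
    rw [MultilinearMap.compLinearMap_apply]
    refine MultilinearMap.map_coord_zero _ x ?_
    rw [DGVec.parityProj_apply _ (ha x), if_neg hx.symm]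
  · simp

/-- The value of a linear combination of monomials. -/
noncomputable def linAct {X : Type} [Finite X] {c : X → C} (d : C) (n : ℤ) (l : List X) :
    (Term E X c d n →₀ k) →ₗ[k]
      MultilinearMap k (fun x => (V (c x)).carrier) (V d).carrier :=
  Finsupp.linearCombination k fun t => t.act A l

theorem linAct_apply {X : Type} [Finite X] {c : X → C} {d : C} {n : ℤ} (l : List X)
    (p : Term E X c d n →₀ k) {a : ∀ x, V (c x)} {G : X → ℤ}
    (ha : ∀ x, a x ∈ (V (c x)).gr (G x)) :
    linAct A d n l p a = linEval A d n l (fun x => (G x : ZMod 2)) a p := by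
  induction p using Finsupp.induction_linear with
  | zero => simp
  | add p q hp hq => rw [map_add, map_add, _root_.add_apply, hp, hq]
  | single t r =>
    rw [linAct, Finsupp.linearCombination_single, _root_.smul_apply, linEval_single,
      Term.act_apply A l t ha]

end

variable {Q : BinaryQuadraticData k C} {A : BinAction V Q.E}

/-- The action of `F(E)/(R)` given by binary operations satisfying the relations. -/
noncomputable def BinAction.presAct (hA : A.Satisfies) {X : Type} [Finite X] {c : X → C} {d : C}
    {n : ℤ} (L : Enum X) :
    Q.PresOp X c d n →ₗ[k] MultilinearMap k (fun x => (V (c x)).carrier) (V d).carrier :=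
  Submodule.liftQ _ (linAct A d n L.1) fun p hp => by
    classical
    rw [LinearMap.mem_ker]
    ext a
    refine eq_zero_of_homogeneous (fun a => linAct A d n L.1 p a) (fun a x u v => ?_) ∅ 0 a
      (fun x hx => hx.elim) fun b G hb _ => ?_
    · exact MultilinearMap.map_update_add _ a x u v
    · exact (linAct_apply A L.1 p hb).trans (linEval_eq_zero_of_vanish hA hp L.2 hb rfl)

theorem BinAction.presAct_cls (hA : A.Satisfies) {X : Type} [Finite X] {c : X → C} {d : C}
    {n : ℤ} (L : Enum X) (t : Term Q.E X c d n) {a : ∀ x, V (c x)} {G : X → ℤ}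
    (ha : ∀ x, a x ∈ (V (c x)).gr (G x)) :
    A.presAct hA L (Q.cls t) a = t.eval A L.1 (fun x => (G x : ZMod 2)) a := by
  rw [presAct, BinaryQuadraticData.cls, Submodule.liftQ_apply, linAct_apply A L.1 _ ha,
    linEval_single, one_smul]

end Act

end Operads
-- The algebra defined by binary operations that satisfy the relations.
namespace Operads

section

variable {k : Type u} [Field k] {C : Type} {V : C → DGVec.{u, w} k}

section
variable {E : BinSMod k C} (A : BinAction V E)

/-- Moving the block `M` in front of `l₁` costs `|M||l₁|`, and moving the slot back behind `l₁`
costs `(n + |M|)|l₁|`. The difference `n|l₁|` is the sign for moving `s` past `l₁`, as in the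
composition axiom of an algebra. -/
theorem Term.eval_comp_block {X Y : Type} (x : X) {c : X → C} {b : Y → C} {e d : C} {m n N : ℤ}
    (hx : c x = e) (hN : m + n = N) (t : Term E X c d m) (s : Term E Y b e n)
    (l₁ l₂ : List {i : X // i ≠ x}) (M : List Y)
    (hL : (l₁.map Subtype.val ++ x :: l₂.map Subtype.val).Nodup)
    (g : {i : X // i ≠ x} ⊕ Y → ZMod 2)
    (a : ∀ s, V (Sum.elim (fun i : {i : X // i ≠ x} => c i) b s)) :
    (Term.comp x hx hN t s).eval A (l₁.map Sum.inl ++ M.map Sum.inr ++ l₂.map Sum.inl) g a =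
      paritySign k (n * weight (g ∘ Sum.inl) l₁) •
        t.eval A (l₁.map Subtype.val ++ x :: l₂.map Subtype.val)
          (plugParity (fun i => g (Sum.inl i)) (n + weight (g ∘ Sum.inr) M))
          (plug hx (inlInputs a) (s.eval A M (g ∘ Sum.inr) (inrInputs a))) := by
  have h := t.eval_move A [] (l₁.map Subtype.val) (l₂.map Subtype.val) x (by simpa using hL)
    (plugParity (fun i => g (Sum.inl i)) (n + weight (g ∘ Sum.inr) M))
    (plug hx (inlInputs a) (s.eval A M (g ∘ Sum.inr) (inrInputs a)))
  simp only [List.nil_append] at h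
  rw [h, paritySign_smul_smul, weight_plugParity, plugParity_self]
  simp only [Term.eval, shuffleParity_append, lefts_append, rights_append, lefts_map_inl,
    lefts_map_inr, rights_map_inl, rights_map_inr, shuffleParity_map_inl, shuffleParity_map_inr,
    List.append_nil, List.nil_append, List.map_append, weight_nil]
  congr 2
  change _ = _ + _ * weight (g ∘ Sum.inl) l₁
  grind

end

section multilinear

variable {X : Type} {c : X → C} {d e : C} {x : X} (hx : c x = e)
  (φ : MultilinearMap k (fun x => (V (c x)).carrier) (V d).carrier)
  (a : ∀ i : {i : X // i ≠ x}, V (c i))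

theorem map_plug_zero : φ (plug hx a 0) = 0 := by
  subst hx
  exact φ.map_coord_zero x (plug_self rfl a 0)

theorem map_plug_add (u v : V e) : φ (plug hx a (u + v)) = φ (plug hx a u) + φ (plug hx a v) := by
  classical
  rw [plug_eq_update hx a (u + v) 0, plug_eq_update hx a u 0, plug_eq_update hx a v 0,
    colorCast_add, φ.map_update_add]

theorem map_plug_smul (r : k) (v : V e) : φ (plug hx a (r • v)) = r • φ (plug hx a v) := by
  classical
  rw [plug_eq_update hx a (r • v) 0, plug_eq_update hx a v 0, colorCast_smul, φ.map_update_smul]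

end multilinear

theorem beforeParity_get {X : Type} (g : X → ZMod 2) {l : List X} (hl : l.Nodup)
    (i : Fin l.length) : beforeParity g l (l.get i) = weight g (l.take i) := by
  induction l with
  | nil => exact i.elim0
  | cons z l ih =>
    obtain ⟨i, hi⟩ := i
    cases i with
    | zero => simp [beforeParity]
    | succ i =>
      have hi' : i < l.length := by simpa using hi
      have h : z ≠ l[i] := by
        rintro rfl
        exact (List.nodup_cons.1 hl).1 (List.getElem_mem _)
      have := ih (List.nodup_cons.1 hl).2 ⟨i, hi'⟩
      simp only [List.get_eq_getElem] at this ⊢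
      simp [beforeParity, h, this]

variable {Q : BinaryQuadraticData k C} {A : BinAction V Q.E} (hA : A.Satisfies)

namespace BinAction

theorem presAct_mem {X : Type} [Finite X] {c : X → C} {d : C} {n : ℤ} (L : Enum X)
    (p : Q.PresOp X c d n) {a : ∀ x, V (c x)} {G : X → ℤ} (ha : ∀ x, a x ∈ (V (c x)).gr (G x)) :
    A.presAct hA L p a ∈ (V d).gr (n + (L.1.map G).sum) := by
  induction p using Q.presOp_induction with
  | zero => simp
  | add p q hp hq => rw [map_add, _root_.add_apply]; exact add_mem hp hq
  | smul r p hp => rw [map_smul, _root_.smul_apply]; exact Submodule.smul_mem _ _ hp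
  | cls t => rw [presAct_cls hA L t ha]; exact t.eval_mem A L.2 _ ha

theorem presAct_swap {X : Type} [Finite X] {c : X → C} {d : C} {n : ℤ} (L L' : Enum X)
    (l₁ l₂ : List X) (x y : X) (hL : L.1 = l₁ ++ x :: y :: l₂) (hL' : L'.1 = l₁ ++ y :: x :: l₂)
    (p : Q.PresOp X c d n) (a : ∀ x, V (c x)) (i j : ℤ)
    (hi : a x ∈ (V (c x)).gr i) (hj : a y ∈ (V (c y)).gr j) :
    A.presAct hA L' p a = (-1 : k) ^ (i * j) • A.presAct hA L p a := by
  classical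
  have hxy : x ≠ y := by
    have h := L.2.1
    rw [hL] at h
    rintro rfl
    simp [List.nodup_append] at h
  rw [← sub_eq_zero]
  -- The degrees of the coordinates `x` and `y` occur in the sign, so these two are kept fixed while
  -- the others are decomposed.
  refine eq_zero_of_homogeneous
    (fun a => A.presAct hA L' p a - (-1 : k) ^ (i * j) • A.presAct hA L p a)
    (fun a x u v => ?_) {x, y} (fun z => if z = x then i else j) a ?_ fun b G hb hG => ?_
  · simp only [MultilinearMap.map_update_add, smul_add]
    abel
  · rintro z (rfl | rfl)
    · simpa using hi
    · simpa [hxy.symm] using hj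
  · have hGx : G x = i := by simpa using hG x (by simp)
    have hGy : G y = j := by simpa [hxy.symm] using hG y (by simp)
    rw [sub_eq_zero]
    induction p using Q.presOp_induction with
    | zero => simp
    | add p q hp hq => simp only [map_add, _root_.add_apply, smul_add, hp, hq]
    | smul r p hp => simp only [map_smul, _root_.smul_apply, hp]; rw [smul_comm]
    | cls t =>
      rw [presAct_cls hA L t hb, presAct_cls hA L' t hb, hL', hL,
        t.eval_swap A l₁ l₂ x y (hL ▸ L.2.1), neg_one_zpow_eq_paritySign, hGx, hGy]
      push_cast
      rfl

theorem presAct_relabel {X Y : Type} [Finite X] [Finite Y] (e : X ≃ Y) {c : X → C} {c' : Y → C}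
    (hc : ∀ x, c' (e x) = c x) {d : C} {n : ℤ} (p : Q.PresOp X c d n) (L : Enum X) (L' : Enum Y)
    (hL : L'.1 = L.1.map e) (a : ∀ y, V (c' y)) :
    A.presAct hA L' (Q.presRelabel e hc p) a =
      A.presAct hA L p (fun x => colorCast (hc x) (a (e x))) := by
  classical
  rw [← sub_eq_zero]
  refine eq_zero_of_homogeneous
    (fun a => A.presAct hA L' (Q.presRelabel e hc p) a -
      A.presAct hA L p (fun x => colorCast (hc x) (a (e x))))
    (fun a y u v => ?_) ∅ 0 a (fun x hx => hx.elim) fun b G hb _ => ?_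
  · obtain ⟨x, rfl⟩ := e.surjective y
    rw [colorCast_update, colorCast_update, colorCast_update, colorCast_add]
    simp only [MultilinearMap.map_update_add]
    abel
  · rw [sub_eq_zero]
    induction p using Q.presOp_induction with
    | zero => simp
    | add p q hp hq => simp only [map_add, _root_.add_apply, hp, hq]
    | smul r p hp => simp only [map_smul, _root_.smul_apply, hp]
    | cls t =>
      rw [Q.presRelabel_cls, presAct_cls hA L' _ hb, presAct_cls hA L t (G := fun x => G (e x))
        fun x => colorCast_mem (hc x) (hb (e x)), Term.eval, hL, List.map_map]
      simp [Function.comp_def]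

theorem presAct_comp {X Y : Type} [Finite X] [Finite Y] (x : X) {c : X → C} {b : Y → C} {e d : C}
    {m n N : ℤ} (hx : c x = e) (hN : m + n = N) (p : Q.PresOp X c d m) (q : Q.PresOp Y b e n)
    (L : Enum X) (M : Enum Y) (K : Enum ({i : X // i ≠ x} ⊕ Y))
    (l₁ l₂ : List {i : X // i ≠ x})
    (hL : L.1 = l₁.map Subtype.val ++ x :: l₂.map Subtype.val)
    (hK : K.1 = l₁.map Sum.inl ++ M.1.map Sum.inr ++ l₂.map Sum.inl)
    (a : ∀ s, V (Sum.elim (fun i : {i : X // i ≠ x} => c i) b s)) (g : {i : X // i ≠ x} → ℤ)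
    (hg : ∀ i ∈ l₁, a (Sum.inl i) ∈ (V (c i.1)).gr (g i)) :
    A.presAct hA K (Q.presComp x hx hN p q) a = (-1 : k) ^ (n * (l₁.map g).sum) •
      A.presAct hA L p (plug hx (inlInputs a) (A.presAct hA M q (inrInputs a))) := by
  classical
  rw [← sub_eq_zero]
  -- Only the coordinates in `l₁` have degrees that occur in the sign; they are kept fixed.
  refine eq_zero_of_homogeneous
    (fun a => A.presAct hA K (Q.presComp x hx hN p q) a - (-1 : k) ^ (n * (l₁.map g).sum) •
      A.presAct hA L p (plug hx (inlInputs a) (A.presAct hA M q (inrInputs a))))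
    (fun a s u v => ?_) {s | ∃ i ∈ l₁, s = Sum.inl i} (Sum.elim g 0) a ?_ fun a G ha hG => ?_
  · rw [MultilinearMap.map_update_add]
    rcases s with i | y
    · simp only [inlInputs_update_inl, inrInputs_update_inl, plug_update]
      rw [colorCast_add, MultilinearMap.map_update_add, smul_add]
      abel
    · simp only [inlInputs_update_inr, inrInputs_update_inr]
      rw [colorCast_add, MultilinearMap.map_update_add, map_plug_add, smul_add]
      abel
  · rintro _ ⟨i, hi, rfl⟩
    exact hg i hi
  · rw [sub_eq_zero]
    induction p using Q.presOp_induction with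
    | zero => simp
    | add p q hp hq => simp only [map_add, LinearMap.add_apply, _root_.add_apply, smul_add, hp, hq]
    | smul r p hp =>
      simp only [map_smul, LinearMap.smul_apply, _root_.smul_apply, hp]
      rw [smul_comm]
    | cls t =>
      induction q using Q.presOp_induction with
      | zero => simp [map_plug_zero]
      | add p q hp hq => simp only [map_add, _root_.add_apply, smul_add, hp, hq, map_plug_add]
      | smul r p hp =>
        simp only [map_smul, _root_.smul_apply, hp, map_plug_smul]
        rw [smul_comm]
      | cls s =>
        have hM := presAct_cls hA M s (a := inrInputs a) (G := fun y => G (Sum.inr y))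
          fun y => ha (Sum.inr y)
        have hM' : A.presAct hA M (Q.cls s) (inrInputs a) ∈ _ := presAct_mem hA M (Q.cls s)
          (a := inrInputs a) (G := fun y => G (Sum.inr y)) fun y => ha (Sum.inr y)
        rw [Q.presComp_cls, presAct_cls hA K _ ha, presAct_cls hA L t
          (plug_mem hx (a := inlInputs a) (G := fun i => G (Sum.inl i))
            (fun i => ha (Sum.inl i)) hM'), hK,
          Term.eval_comp_block A x hx hN t s l₁ l₂ M.1 (hL ▸ L.2.1), hM, hL,
          neg_one_zpow_eq_paritySign]
        have h₁ : weight ((fun s => (G s : ZMod 2)) ∘ Sum.inl) l₁ = ((l₁.map g).sum : ℤ) := by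
          rw [weight, List.map_congr_left (g := fun i => ((g i : ℤ) : ZMod 2))]
          · exact weight_intCast g l₁
          · exact fun i hi => congrArg _ (hG (Sum.inl i) ⟨i, hi, rfl⟩)
        rw [h₁]
        push_cast
        congr 2
        rw [plugParity_intCast (fun i : {i : X // i ≠ x} => G (Sum.inl i))]
        congr 1
        rw [Function.comp_def, weight_intCast]
        push_cast
        rfl

open Classical in
theorem presAct_cls_update_d {X : Type} [Finite X] {c : X → C} {d : C} {n : ℤ} (L : Enum X)
    (t : Term Q.E X c d n) {a : ∀ x, V (c x)} {G : X → ℤ}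
    (ha : ∀ x, a x ∈ (V (c x)).gr (G x)) (x : X) :
    A.presAct hA L (Q.cls t) (Function.update a x ((V (c x)).d (a x))) =
      t.eval A L.1 (Function.update (fun x => (G x : ZMod 2)) x (G x + 1))
        (Function.update a x ((V (c x)).d (a x))) := by
  have hG : ∀ y, Function.update a x ((V (c x)).d (a x)) y ∈
      (V (c y)).gr (Function.update G x (G x - 1) y) := by
    intro y
    rcases eq_or_ne y x with rfl | h
    · simpa using (V (c y)).d_mem (ha y)
    · simpa [h] using ha y
  rw [presAct_cls hA L t hG]
  congr 1
  funext y
  rcases eq_or_ne y x with rfl | h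
  -- The differential lowers the degree by one, whereas the parity is recorded as `G x + 1`; in
  -- `ZMod 2` the two agree.
  · simp [sub_eq_add_neg]
  · simp [h]

theorem presAct_unit {d : C} (L : Enum Unit) (a : Unit → V d) :
    A.presAct hA L (Q.cls (Term.unit d)) a = a () := by
  classical
  rw [← sub_eq_zero]
  refine eq_zero_of_homogeneous (c := fun _ : Unit => d)
    (fun a => A.presAct hA L (Q.cls (Term.unit d)) a - a ())
    (fun a x u v => ?_) ∅ 0 a (fun x hx => hx.elim) fun b G hb _ => ?_
  · simp only [MultilinearMap.map_update_add, Function.update_self]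
    abel
  · rw [sub_eq_zero, presAct_cls hA L _ hb]
    rfl

open Classical in
theorem presAct_d {X : Type} [Finite X] {c : X → C} {d : C} {n : ℤ} (L : Enum X)
    (p : Q.PresOp X c d n) (a : ∀ x, V (c x)) (G : X → ℤ)
    (ha : ∀ x, a x ∈ (V (c x)).gr (G x)) :
    (V d).d (A.presAct hA L p a) =
      (-1 : k) ^ n • ∑ i : Fin L.1.length, (-1 : k) ^ ((L.1.take i).map G).sum •
        A.presAct hA L p
          (Function.update a (L.1.get i) ((V (c (L.1.get i))).d (a (L.1.get i)))) := by
  induction p using Q.presOp_induction with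
  | zero => simp
  | add p q hp hq =>
    simp only [map_add, _root_.add_apply, smul_add, Finset.sum_add_distrib, hp, hq]
  | smul r p hp =>
    simp only [map_smul, _root_.smul_apply, hp]
    rw [smul_comm r, Finset.smul_sum]
    simp only [smul_comm r]
  | cls t =>
    rw [presAct_cls hA L t ha, t.eval_d A L.2 ha rfl, neg_one_zpow_eq_paritySign,
      ← List.sum_ofFn]
    congr 2
    refine List.ext_get (by simp) fun i hi hi' => ?_
    have hi₀ : i < L.1.length := by simpa using hi
    simp only [List.get_eq_getElem, List.getElem_map, List.getElem_ofFn]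
    have hb := beforeParity_get (fun x => (G x : ZMod 2)) L.2.1 ⟨i, hi₀⟩
    simp only [List.get_eq_getElem] at hb
    rw [hb, neg_one_zpow_eq_paritySign, weight_intCast]
    congr 1
    exact (presAct_cls_update_d hA L t ha _).symm

/-- The algebra over `F(E)/(R)` given by binary operations that satisfy the relations. -/
noncomputable def toAlgebra : OperadAlgebra Q.operad V where
  act L := A.presAct hA L
  act_mem L p _ _ ha := A.presAct_mem hA L p ha
  act_swap := A.presAct_swap hA
  act_unit L a := A.presAct_unit hA L fun _ => a
  act_relabel := A.presAct_relabel hA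
  act_comp {X Y} _ _ x c b _ _ _ _ _ hx hN p q L M K l₁ l₂ hL hK a a' g hg := by
    classical
    refine (A.presAct_comp hA x hx hN p q L M K l₁ l₂ hL hK (fun s => match s with
          | Sum.inl i => a i.1
          | Sum.inr y => a' y) g hg).trans ?_
    congr 2
    funext i
    rcases eq_or_ne i x with rfl | h
    · rw [plug_self, Function.update_self]
      rfl
    · rw [plug_of_ne hx _ _ h, Function.update_of_ne h]
      rfl
  act_d := A.presAct_d hA

end BinAction

end

end Operads
-- The binary operations of an algebra, and why they determine it.
namespace Operads

section

variable {k : Type u} [Field k] {C : Type} {V : C → DGVec.{u, w} k}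

theorem IsEnum.perm {X : Type} {l l' : List X} (hl : IsEnum l) (h : l.Perm l') : IsEnum l' :=
  ⟨h.nodup_iff.1 hl.1, fun x => h.mem_iff.1 (hl.2 x)⟩

/-- A property of total orders that is invariant under transpositions of neighbours does not
depend on the order. -/
theorem IsEnum.of_adjacent {X : Type} {P : List X → Prop}
    (hP : ∀ l₁ l₂ x y, IsEnum (l₁ ++ x :: y :: l₂) → P (l₁ ++ x :: y :: l₂) →
      P (l₁ ++ y :: x :: l₂)) {l l' : List X} (hl : IsEnum l) (hl' : IsEnum l') (h : P l) :
    P l' := by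
  suffices key : ∀ {m m' : List X}, m.Perm m' → ∀ l₁, IsEnum (l₁ ++ m) → P (l₁ ++ m) →
      P (l₁ ++ m') from
    key ((List.perm_ext_iff_of_nodup hl.1 hl'.1).2 fun x => by simp [hl.2 x, hl'.2 x]) [] hl h
  intro m m' hm
  induction hm with
  | nil => exact fun _ _ h => h
  | cons x _ ih =>
    intro l₁ h₁ h₂
    simpa using ih (l₁ ++ [x]) (by simpa using h₁) (by simpa using h₂)
  | swap x y l => exact fun l₁ => hP l₁ l y x
  | trans hm _ ih ih' =>
    exact fun l₁ h₁ h₂ => ih' l₁ (h₁.perm (hm.append_left l₁)) (ih l₁ h₁ h₂)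

/-- Two inputs, as a family indexed by `Fin 2`. -/
def pairInputs {a b : C} (x : V a) (y : V b) : ∀ i : Fin 2, V (![a, b] i)
  | 0 => x
  | 1 => y

theorem pairInputs_fst_snd {a b : C} (z : ∀ i, V (![a, b] i)) :
    pairInputs (fstInput z) (sndInput z) = z := by
  funext i
  fin_cases i <;> rfl

theorem pairInputs_eq_update_zero {a b : C} (x x' : V a) (y : V b) :
    pairInputs x y = Function.update (pairInputs x' y) 0 x := by
  funext i
  fin_cases i <;> rfl

theorem pairInputs_eq_update_one {a b : C} (x : V a) (y y' : V b) :
    pairInputs x y = Function.update (pairInputs x y') 1 y := by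
  funext i
  fin_cases i <;> rfl

/-- A multilinear map with two inputs as a bilinear map. -/
def bilinOf {a b d : C} :
    MultilinearMap k (fun i : Fin 2 => (V (![a, b] i)).carrier) (V d).carrier →ₗ[k]
      V a →ₗ[k] V b →ₗ[k] V d where
  toFun φ := LinearMap.mk₂ k (fun x y => φ (pairInputs x y))
    (fun x x' y => by
      rw [pairInputs_eq_update_zero (x + x') 0 y, pairInputs_eq_update_zero x 0 y,
        pairInputs_eq_update_zero x' 0 y]
      exact φ.map_update_add _ _ _ _)
    (fun r x y => by
      rw [pairInputs_eq_update_zero (r • x) 0 y, pairInputs_eq_update_zero x 0 y]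
      exact φ.map_update_smul _ _ _ _)
    (fun x y y' => by
      rw [pairInputs_eq_update_one x (y + y') 0, pairInputs_eq_update_one x y 0,
        pairInputs_eq_update_one x y' 0]
      exact φ.map_update_add _ _ _ _)
    (fun r x y => by
      rw [pairInputs_eq_update_one x (r • y) 0, pairInputs_eq_update_one x y 0]
      exact φ.map_update_smul _ _ _ _)
  map_add' _ _ := rfl
  map_smul' _ _ := rfl

namespace BinaryQuadraticData

variable (Q : BinaryQuadraticData k C)

/-- The operation of `F(E)/(R)` given by a linear combination of monomials. -/
noncomputable def opMk {X : Type} [Finite X] {c : X → C} {d : C} {n : ℤ} :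
    (Term Q.E X c d n →₀ k) →ₗ[k] Q.operad.Op X c d n :=
  Submodule.mkQ (Q.vanishing X c d n)

/-- The operation given by a monomial. -/
noncomputable def opCls {X : Type} [Finite X] {c : X → C} {d : C} {n : ℤ} (t : Term Q.E X c d n) :
    Q.operad.Op X c d n :=
  Q.cls t

theorem opMk_surjective {X : Type} [Finite X] {c : X → C} {d : C} {n : ℤ}
    (p : Q.operad.Op X c d n) : ∃ q, Q.opMk q = p :=
  Submodule.Quotient.mk_surjective _ p

theorem opMk_single {X : Type} [Finite X] {c : X → C} {d : C} {n : ℤ} (t : Term Q.E X c d n)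
    (r : k) : Q.opMk (Finsupp.single t r) = r • Q.opCls t := by
  have h : Finsupp.single t r = r • Finsupp.single t 1 := by simp
  rw [h, map_smul]
  rfl

theorem opMk_eq_zero {X : Type} [Finite X] {c : X → C} {d : C} {n : ℤ}
    {p : Term Q.E X c d n →₀ k} (h : Vanish Q p) : Q.opMk p = 0 :=
  (Submodule.Quotient.mk_eq_zero (Q.vanishing _ _ _ _)).2 h

/-- The generators as a linear map. -/
noncomputable def genLinear {a b d : C} {n : ℤ} :
    Q.E.M n a b d →ₗ[k] Q.operad.Op (Fin 2) ![a, b] d n where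
  toFun e := Q.gen e
  map_add' e e' := by
    have h := Q.opMk_eq_zero (Vanish.gen_add e e')
    rw [sub_sub, map_sub, map_add, sub_eq_zero] at h
    exact h
  map_smul' r e := by
    have h := Q.opMk_eq_zero (Vanish.gen_smul r e)
    rw [map_sub, sub_eq_zero, Q.opMk_single _ r] at h
    exact h

end BinaryQuadraticData

namespace OperadAlgebra

open SwissCheese (stdOrder)

/-- The opposite of the standard order on `Fin 2`. -/
def oppOrder : Enum (Fin 2) := ⟨[1, 0], by decide, by decide⟩

variable {Q : BinaryQuadraticData k C} (B : OperadAlgebra Q.operad V)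

theorem act_opp {a b d : C} {n : ℤ} (p : Q.operad.Op (Fin 2) ![a, b] d n) {i j : ℤ}
    (z : ∀ i, V (![a, b] i)) (hx : z 0 ∈ (V a).gr i) (hy : z 1 ∈ (V b).gr j) :
    B.act oppOrder p z = (-1 : k) ^ (i * j) • B.act stdOrder p z :=
  B.act_swap stdOrder oppOrder [] [] 0 1 rfl rfl p z i j hx hy

/-- The binary operations underlying an algebra. -/
noncomputable def toBinAction : BinAction V Q.E where
  op {n a b d} := bilinOf ∘ₗ B.act stdOrder ∘ₗ Q.genLinear
  op_mem {n a b d} e i j x y hx hy := by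
    have h := B.act_mem stdOrder (Q.gen e) (pairInputs x y) ![i, j]
      (fun l => by fin_cases l <;> assumption)
    change B.act stdOrder (Q.gen e) (pairInputs x y) ∈ _
    rwa [show (stdOrder.1.map ![i, j]).sum = i + j from by simp [stdOrder]] at h
  op_swap {n a b d} e i j x y hx hy := by
    have h₁ : Q.gen (Q.E.swap e) =
        Q.operad.relabel (Equiv.swap 0 1) (swap_color a b) (Q.gen e) := by
      refine Eq.trans ?_ (Q.presRelabel_cls _ _ _).symm
      exact (Q.cls_eq_cls (Vanish.gen_swap e)).symm
    change B.act stdOrder (Q.gen (Q.E.swap e)) (pairInputs y x) = _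
    rw [h₁, B.act_relabel _ _ _ oppOrder stdOrder (by simp [oppOrder, stdOrder])]
    have h₂ : (fun l => swap_color a b l ▸ pairInputs y x (Equiv.swap 0 1 l)) =
        pairInputs x y := by
      funext l
      fin_cases l <;> rfl
    rw [h₂, B.act_opp _ (i := i) (j := j) _ hx hy]
    rfl
  op_d {n a b d} e i x y hx := by
    -- `act_d` requires all inputs to be homogeneous, while `y` is arbitrary here; both sides are
    -- additive in `y`.
    have hy := (V b).mem_closure_homogeneous y
    induction hy using AddSubmonoid.closure_induction with
    | mem y hy =>
      obtain ⟨j, hy⟩ := hy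
      have h := B.act_d stdOrder (Q.gen e) (pairInputs x y) ![i, j]
        (fun l => by fin_cases l <;> assumption)
      -- The length of the standard order reduces to `2`. The prefixes before the two positions are
      -- empty and `[0]`, which produces the signs `1` and `(-1)^i`.
      have h₂ : ∀ F : Fin stdOrder.1.length → V d, ∑ l, F l = F (0 : Fin 2) + F (1 : Fin 2) :=
        fun F => Fin.sum_univ_two F
      rw [h₂] at h
      refine h.trans ?_
      congr 2
      · refine (congrArg (· • _) (zpow_zero (-1 : k))).trans ((one_smul k _).trans ?_)
        refine congrArg (B.act stdOrder (Q.gen e)) ?_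
        rw [pairInputs_eq_update_zero ((V a).d x) x y]
        congr 1
        exact Subsingleton.elim _ _
      · refine congrArg₂ (fun z v => (-1 : k) ^ z • v) (List.sum_singleton (x := i)) ?_
        refine congrArg (B.act stdOrder (Q.gen e)) ?_
        rw [pairInputs_eq_update_one x ((V b).d y) y]
        congr 1
        exact Subsingleton.elim _ _
    | zero => simp
    | add y y' _ _ hy hy' =>
      simp only [map_add, hy, hy', smul_add]
      abel

/-- Every algebra acts on a monomial by `Term.eval`. For a composite this is checked in the order in
which the inner inputs form a block at the front, where the composition axiom has no sign. It then
spreads to all orders, because both sides obey the same rule under transpositions of neighbours.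
Finiteness is an explicit argument since the label type varies in the induction. -/
theorem act_cls_aux {X : Type} {c : X → C} {d : C} {n : ℤ} (t : Term Q.E X c d n) :
    ∀ (_ : Finite X) (L : Enum X) {a : ∀ x, V (c x)} {G : X → ℤ},
      (∀ x, a x ∈ (V (c x)).gr (G x)) →
      B.act L (Q.opCls t) a = t.eval B.toBinAction L.1 (fun x => (G x : ZMod 2)) a := by
  induction t with
  | unit d => exact fun _ L a _ _ => B.act_unit L (a ())
  | @gen a' b' d n e =>
    intro _ L a G ha
    have h₀ : B.act stdOrder (Q.gen e) a = B.toBinAction.op e (fstInput a) (sndInput a) :=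
      congrArg _ (pairInputs_fst_snd a).symm
    rcases isEnum_fin_two L.2 with h | h
    · obtain rfl : L = stdOrder := Subtype.ext h
      exact h₀.trans (one_smul k _).symm
    · obtain rfl : L = oppOrder := Subtype.ext h
      refine (B.act_opp (Q.gen e) a (ha 0) (ha 1)).trans ?_
      rw [h₀, neg_one_zpow_eq_paritySign]
      push_cast
      rfl
  | relabel e hc t ih =>
    intro _ L a G ha
    have := t.finite
    refine (congrArg (fun p => B.act L p a) (Q.presRelabel_cls e hc t).symm).trans ?_
    refine (B.act_relabel e hc (Q.opCls t) ⟨L.1.map e.symm, IsEnum.map L.2 e.symm⟩ L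
      (by simp) a).trans ?_
    exact ih this ⟨L.1.map e.symm, IsEnum.map L.2 e.symm⟩ (G := fun x => G (e x))
      fun x => colorCast_mem (hc x) (ha (e x))
  | @comp X Y x c b e d m n N hx hN t s iht ihs =>
    classical
    intro _ L a G ha
    have := t.finite
    have := s.finite
    have hM := IsEnum.rights L.2
    have hl : IsEnum (x :: (lefts L.1).map Subtype.val) := IsEnum.cons_lefts L.2
    have hK : IsEnum ((rights L.1).map Sum.inr ++ (lefts L.1).map Sum.inl)  := by
      refine ⟨((nodup_rights L.2.1).map Sum.inr_injective).append
        ((nodup_lefts L.2.1).map Sum.inl_injective) (by simp [List.Disjoint]), ?_⟩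
      rintro (i | y)
      · simpa using L.2.2 (Sum.inl i)
      · simpa using L.2.2 (Sum.inr y)
    refine IsEnum.of_adjacent (P := fun l => ∀ h : IsEnum l, B.act ⟨l, h⟩
      (Q.opCls (Term.comp x hx hN t s)) a = (Term.comp x hx hN t s).eval B.toBinAction l
        (fun x => (G x : ZMod 2)) a) (fun l₁ l₂ y z h ih h' => ?_) hK L.2 (fun h => ?_) L.2
    · refine (B.act_swap ⟨_, h⟩ ⟨_, h'⟩ l₁ l₂ y z rfl rfl _ a (G y) (G z) (ha y) (ha z)).trans ?_
      refine (congrArg _ (ih h)).trans ?_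
      rw [Term.eval_swap B.toBinAction _ l₁ l₂ y z h.1, neg_one_zpow_eq_paritySign]
      push_cast
      rfl
    · have hs := ihs ‹_› ⟨_, hM⟩ (a := inrInputs a) (G := fun y => G (Sum.inr y))
        (fun y => ha (Sum.inr y))
      have hmem : B.act ⟨_, hM⟩ (Q.opCls s) (inrInputs a) ∈ _ := B.act_mem ⟨_, hM⟩ (Q.opCls s)
          (inrInputs a) (fun y => G (Sum.inr y)) (fun y => ha (Sum.inr y))
      -- The axiom asks for a full family of inputs of `t`; the `0` plugged at `x` is a dummy that
      -- the axiom overwrites by the value of `s`.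
      have h₁ := B.act_comp x hx hN (Q.opCls t) (Q.opCls s) ⟨_, hl⟩ ⟨_, hM⟩ ⟨_, h⟩ [] (lefts L.1)
        rfl (by simp) (plug hx (inlInputs a) 0) (inrInputs a) 0 (by simp)
      have e₁ : (fun s : {i : X // i ≠ x} ⊕ Y => match s with
          | Sum.inl i => plug hx (inlInputs a) 0 i.1
          | Sum.inr y => inrInputs a y :
          ∀ s, V (Sum.elim (fun i : {i : X // i ≠ x} => c i) b s)) = a := by
        funext s
        rcases s with i | y
        · exact plug_of_ne hx (inlInputs a) 0 i.2
        · rfl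
      have e₂ : Function.update (plug hx (inlInputs a) 0) x
          (hx.symm ▸ B.act ⟨_, hM⟩ (Q.opCls s) (inrInputs a)) =
          plug hx (inlInputs a) (B.act ⟨_, hM⟩ (Q.opCls s) (inrInputs a)) :=
        (plug_eq_update hx (inlInputs a) _ 0).symm
      have h₂ := Term.eval_comp_block B.toBinAction x hx hN t s [] (lefts L.1) (rights L.1) hl.1
        (fun s => (G s : ZMod 2)) a
      have h₃ : Q.operad.comp x hx hN (Q.opCls t) (Q.opCls s) =
        Q.opCls (Term.comp x hx hN t s) := Q.presComp_cls x hx hN t s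
      have ht := iht ‹_› ⟨_, hl⟩ (plug_mem hx (a := inlInputs a) (G := fun i => G (Sum.inl i))
            (fun i => ha (Sum.inl i)) hmem)
      refine (congrArg₂ (fun p a => B.act ⟨_, h⟩ p a) h₃.symm e₁.symm).trans (h₁.trans ?_)
      refine (congrArg _ (congrArg _ e₂)).trans ?_
      refine Eq.trans ?_ h₂.symm
      rw [ht, hs, plugParity_intCast (fun i : {i : X // i ≠ x} => G (Sum.inl i)), Function.comp_def,
        weight_intCast]
      simp
      rfl

theorem act_cls {X : Type} [hX : Finite X] {c : X → C} {d : C} {n : ℤ} (t : Term Q.E X c d n)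
    (L : Enum X) {a : ∀ x, V (c x)} {G : X → ℤ} (ha : ∀ x, a x ∈ (V (c x)).gr (G x)) :
    B.act L (Q.opCls t) a = t.eval B.toBinAction L.1 (fun x => (G x : ZMod 2)) a :=
  B.act_cls_aux t hX L ha

theorem act_opMk {X : Type} [Finite X] {c : X → C} {d : C} {n : ℤ} (p : Term Q.E X c d n →₀ k)
    (L : Enum X) {a : ∀ x, V (c x)} {G : X → ℤ} (ha : ∀ x, a x ∈ (V (c x)).gr (G x)) :
    B.act L (Q.opMk p) a = linEval B.toBinAction d n L.1 (fun x => (G x : ZMod 2)) a p := by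
  induction p using Finsupp.induction_linear with
  | zero => simp
  | add p q hp hq => rw [map_add, map_add, map_add, ← hp, ← hq, _root_.add_apply]
  | single t r =>
    rw [linEval_single, ← B.act_cls t L ha, Q.opMk_single, map_smul, _root_.smul_apply]

theorem toBinAction_satisfies : B.toBinAction.Satisfies := by
  intro c d n r hr l hl a G ha
  rw [← B.act_opMk _ ⟨l, hl⟩ ha, Q.opMk_eq_zero (Vanish.rel r hr), map_zero, _root_.zero_apply]

theorem ext_of_act {P : ColoredOperad.{u, v} k C} {B B' : OperadAlgebra P V}
    (h : ∀ {X : Type} [Finite X] {c : X → C} {d : C} {n : ℤ} (L : Enum X) (p : P.Op X c d n),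
      B.act L p = B'.act L p) : B = B' := by
  obtain ⟨act, _, _, _, _, _, _⟩ := B
  obtain ⟨act', _, _, _, _, _, _⟩ := B'
  obtain rfl : @act = @act' := by
    funext X _ c d n L
    exact LinearMap.ext fun p => h L p
  rfl

/-- An algebra over `F(E)/(R)` is determined by the operations of the generators. -/
theorem ext_of_gen {B B' : OperadAlgebra Q.operad V}
    (h : ∀ {a b d : C} {n : ℤ} (e : Q.E.M n a b d) (x : V a) (y : V b),
      B.toBinAction.op e x y = B'.toBinAction.op e x y) : B = B' := by
  -- A `BinAction` is determined by its field `op`, the other fields being propositions.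
  have hB : B.toBinAction = B'.toBinAction := by
    generalize B.toBinAction = A at h ⊢
    generalize B'.toBinAction = A' at h ⊢
    obtain ⟨op, _, _, _⟩ := A
    obtain ⟨op', _, _, _⟩ := A'
    obtain rfl : @op = @op' := by
      funext n a b d
      ext e x y
      exact h e x y
    rfl
  refine ext_of_act fun {X _ c d n} L p => ?_
  obtain ⟨p, rfl⟩ := Q.opMk_surjective p
  ext a
  rw [← sub_eq_zero]
  refine eq_zero_of_homogeneous (fun a => B.act L (Q.opMk p) a - B'.act L (Q.opMk p) a)
    (fun a x u v => ?_) ∅ 0 a (fun x hx => hx.elim) fun b G hb _ => ?_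
  · rw [MultilinearMap.map_update_add, MultilinearMap.map_update_add]
    abel
  · rw [B.act_opMk p L hb, B'.act_opMk p L hb, hB, sub_self]

end OperadAlgebra

end

end Operads
-- Values of elements of weight two on three inputs.
namespace Operads

section

variable {k : Type u} [Field k] {C : Type} {V : C → DGVec.{u, w} k} {E : BinSMod k C}
  (A : BinAction V E)

theorem linEval_swap {X : Type} {c : X → C} {d : C} {n : ℤ} (p : Term E X c d n →₀ k)
    (l₁ l₂ : List X) (x y : X) (h : (l₁ ++ x :: y :: l₂).Nodup) (g : X → ZMod 2)
    (a : ∀ x, V (c x)) :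
    linEval A d n (l₁ ++ y :: x :: l₂) g a p =
      paritySign k (g x * g y) • linEval A d n (l₁ ++ x :: y :: l₂) g a p := by
  induction p using Finsupp.induction_linear with
  | zero => simp
  | add p q hp hq => simp only [map_add, hp, hq, smul_add]
  | single t r =>
    rw [linEval_single, linEval_single, t.eval_swap A l₁ l₂ x y h, smul_comm]

/-- Changing the order of the inputs multiplies the value by a sign, so vanishing may be tested in
whichever order is convenient for the tree at hand. -/
theorem linEval_eq_zero_of_isEnum {X : Type} {c : X → C} {d : C} {n : ℤ}
    {p : Term E X c d n →₀ k} {l l' : List X} (hl : IsEnum l) (hl' : IsEnum l') {g : X → ZMod 2}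
    {a : ∀ x, V (c x)} (h : linEval A d n l g a p = 0) : linEval A d n l' g a p = 0 :=
  IsEnum.of_adjacent (P := fun l => linEval A d n l g a p = 0)
    (fun l₁ l₂ x y h h' => by rw [linEval_swap A p l₁ l₂ x y h.1, h', smul_zero]) hl hl' h

theorem isEnum_perm (τ : Equiv.Perm (Fin 3)) : IsEnum [τ 0, τ 1, τ 2] := by
  have h : IsEnum ([0, 1, 2] : List (Fin 3)) := by
    constructor
    · decide
    · decide
  simpa using h.map τ

theorem Term.eval_gen_std {a b d : C} {n : ℤ} (e : E.M n a b d) (g : Fin 2 → ZMod 2)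
    (z : ∀ i, V (![a, b] i)) :
    (Term.gen e).eval A [0, 1] g z = A.op e (fstInput z) (sndInput z) := by
  rw [Term.eval, if_neg (by decide), paritySign_zero, one_smul]

theorem fstInput_plug {a b : C} (z : ∀ i : {i : Fin 2 // i ≠ 0}, V (![a, b] i))
    (v : V (![a, b] 0)) : fstInput (plug rfl z v) = v :=
  plug_self rfl z v

theorem sndInput_plug {a b : C} (z : ∀ i : {i : Fin 2 // i ≠ 0}, V (![a, b] i))
    (v : V (![a, b] 0)) : sndInput (plug rfl z v) = z ⟨1, by decide⟩ :=
  plug_of_ne rfl z v (by decide)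

/-- In the planar order of the leaves nothing is permuted and the upper vertex stands first, so no
sign appears. -/
theorem Comb.eval_toTerm {c : Fin 3 → C} {d : C} {n : ℤ} (t : Comb E c d n) (g : Fin 3 → ZMod 2)
    (a : ∀ x, V (c x)) :
    t.toTerm.eval A [t.τ 0, t.τ 1, t.τ 2] g a =
      A.op t.μ (A.op t.ν (colorCast t.hx (a (t.τ 0))) (colorCast t.hy (a (t.τ 1))))
        (colorCast t.hz (a (t.τ 2))) := by
  have h₀ : (combEquiv.trans t.τ).symm (t.τ 0) = Sum.inr 0 := by
    rw [Equiv.symm_apply_eq]; rfl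
  have h₁ : (combEquiv.trans t.τ).symm (t.τ 1) = Sum.inr 1 := by
    rw [Equiv.symm_apply_eq]; rfl
  have h₂ : (combEquiv.trans t.τ).symm (t.τ 2) = Sum.inl ⟨1, by decide⟩ := by
    rw [Equiv.symm_apply_eq]; rfl
  rw [Comb.toTerm, Term.eval]
  simp only [List.map_cons, List.map_nil, h₀, h₁, h₂]
  rw [Term.eval]
  simp only [lefts_inr, lefts_inl, rights_inr, rights_inl, lefts_nil, rights_nil,
    List.map_cons, List.map_nil, shuffleParity_inr, shuffleParity_inl, shuffleParity_nil,
    weight_nil, mul_zero, add_zero, paritySign_zero, one_smul]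
  rw [Term.eval_gen_std]
  exact congrArg₂ (fun u v => A.op t.μ u v)
    ((fstInput_plug _ _).trans (Term.eval_gen_std A t.ν _ _)) (sndInput_plug _ _)

/-- Four of the relations are linearity of the operations. In the exchange of the two upper leaves,
the sign from reordering the inputs cancels the sign in the symmetry of the operation. -/
theorem Comb.linEval_rel {c : Fin 3 → C} {d : C} {n : ℤ} {r : Comb E c d n →₀ k}
    (hr : Comb.Rel E c d n r) {l : List (Fin 3)} (hl : IsEnum l) {a : ∀ x, V (c x)}
    {G : Fin 3 → ℤ} (ha : ∀ x, a x ∈ (V (c x)).gr (G x)) :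
    linEval A d n l (fun x => (G x : ZMod 2)) a (Finsupp.lmapDomain k k Comb.toTerm r) = 0 := by
  obtain ⟨τ, hx, hy, hz, hn, μ, μ', ν⟩ | ⟨τ, hx, hy, hz, hn, r, μ, ν⟩ |
    ⟨τ, hx, hy, hz, hn, μ, ν, ν'⟩ | ⟨τ, hx, hy, hz, hn, r, μ, ν⟩ | ⟨τ, hx, hy, hz, hn, μ, ν⟩ := hr
  all_goals
    refine linEval_eq_zero_of_isEnum A (isEnum_perm τ) hl ?_
    simp only [map_sub, Finsupp.lmapDomain_apply, Finsupp.mapDomain_single, linEval_single]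
  · have h := fun μ => Comb.eval_toTerm A (⟨τ, hx, hy, hz, hn, μ, ν⟩ : Comb E c d n)
      (fun x => (G x : ZMod 2)) a
    dsimp only at h
    simp [h]
  · have h := fun μ => Comb.eval_toTerm A (⟨τ, hx, hy, hz, hn, μ, ν⟩ : Comb E c d n)
      (fun x => (G x : ZMod 2)) a
    dsimp only at h
    simp [h]
  · have h := fun ν => Comb.eval_toTerm A (⟨τ, hx, hy, hz, hn, μ, ν⟩ : Comb E c d n)
      (fun x => (G x : ZMod 2)) a
    dsimp only at h
    simp [h]
  · have h := fun ν => Comb.eval_toTerm A (⟨τ, hx, hy, hz, hn, μ, ν⟩ : Comb E c d n)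
      (fun x => (G x : ZMod 2)) a
    dsimp only at h
    simp [h]
  · have h := Comb.eval_toTerm A (⟨τ, hx, hy, hz, hn, μ, ν⟩ : Comb E c d n)
      (fun x => (G x : ZMod 2)) a
    generalize ht : (⟨τ * Equiv.swap 0 1, by simpa using hy, by simpa using hx,
      by rw [Equiv.Perm.mul_apply, Equiv.swap_apply_of_ne_of_ne] <;> simp [hz],
      hn, μ, E.swap ν⟩ : Comb E c d n) = t
    have h' := t.eval_toTerm A (fun x => (G x : ZMod 2)) a
    have hs := t.toTerm.eval_swap A [] [τ 2] (τ 1) (τ 0)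
      ((isEnum_perm τ).perm (List.Perm.swap _ _ _)).1
      (fun x => (G x : ZMod 2)) a
    have h'' : t.toTerm.eval A [τ 1, τ 0, τ 2] (fun x => (G x : ZMod 2)) a =
        A.op μ (A.op (E.swap ν) (colorCast hy (a (τ 1))) (colorCast hx (a (τ 0))))
          (colorCast hz (a (τ 2))) := by
      subst ht
      exact h'
    simp only [List.nil_append] at hs
    rw [h, hs, h'', A.op_swap ν (colorCast_mem hx (ha _)) (colorCast_mem hy (ha _)),
      neg_one_zpow_eq_paritySign, map_smul, LinearMap.smul_apply, paritySign_smul_smul]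
    push_cast
    rw [mul_comm, CharTwo.add_self_eq_zero, paritySign_zero, one_smul, one_smul,
      sub_self]

/-- The value of an element of `F⁽²⁾(E)` on homogeneous inputs. -/
noncomputable def quadEval {c : Fin 3 → C} {d : C} {n : ℤ} {l : List (Fin 3)} (hl : IsEnum l)
    {a : ∀ x, V (c x)} {G : Fin 3 → ℤ} (ha : ∀ x, a x ∈ (V (c x)).gr (G x)) :
    Quad E c d n →ₗ[k] V d :=
  Submodule.liftQ _
    (linEval A d n l (fun x => (G x : ZMod 2)) a ∘ₗ Finsupp.lmapDomain k k Comb.toTerm) <| by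
    rw [Submodule.span_le]
    exact fun r hr => Comb.linEval_rel A hr hl ha

theorem quadEval_mk {c : Fin 3 → C} {d : C} {n : ℤ} {l : List (Fin 3)} (hl : IsEnum l)
    {a : ∀ x, V (c x)} {G : Fin 3 → ℤ} (ha : ∀ x, a x ∈ (V (c x)).gr (G x))
    (r : Comb E c d n →₀ k) :
    quadEval A hl ha (Submodule.Quotient.mk r : Quad E c d n) =
      linEval A d n l (fun x => (G x : ZMod 2)) a (Finsupp.mapDomain Comb.toTerm r) := rfl

theorem colorCast_congr {X Y : Type} {c : Y → C} {c' : X → C} (σ : X → Y) (h : ∀ i, c' i = c (σ i))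
    {a : ∀ x, V (c' x)} {a' : ∀ x, V (c x)} (haa' : ∀ x, a' (σ x) = colorCast (h x) (a x))
    {x : X} {y : Y} (hxy : σ x = y) {e : C} (h₁ : c' x = e) (h₂ : c y = e) :
    colorCast h₁ (a x) = colorCast h₂ (a' y) := by
  subst hxy h₂
  rw [haa']
  rfl

theorem quadEval_act {c c' : Fin 3 → C} {d : C} {n : ℤ} (σ : Equiv.Perm (Fin 3))
    (h : ∀ i, c' i = c (σ i)) {l l' : List (Fin 3)} (hl : IsEnum l) (hl' : IsEnum l')
    (hll' : l' = l.map σ) {a : ∀ x, V (c' x)} {G : Fin 3 → ℤ}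
    (ha : ∀ x, a x ∈ (V (c' x)).gr (G x)) {a' : ∀ x, V (c x)} {G' : Fin 3 → ℤ}
    (ha' : ∀ x, a' x ∈ (V (c x)).gr (G' x)) (haa' : ∀ x, a' (σ x) = colorCast (h x) (a x))
    (hGG' : ∀ x, G' (σ x) = G x) (q : Quad E c d n) :
    quadEval A hl ha (Quad.act σ h q) = quadEval A hl' ha' q := by
  obtain ⟨r, rfl⟩ := Submodule.Quotient.mk_surjective _ q
  rw [Quad.act, Submodule.mapQ_apply, quadEval_mk, quadEval_mk, Finsupp.lmapDomain_apply,
    ← Finsupp.mapDomain_comp]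
  induction r using Finsupp.induction_linear with
  | zero => simp
  | add p q hp hq => rw [Finsupp.mapDomain_add, Finsupp.mapDomain_add, map_add, map_add, hp, hq]
  | single t r =>
    rw [Finsupp.mapDomain_single, Finsupp.mapDomain_single, linEval_single, linEval_single]
    congr 1
    subst hll'
    rw [Function.comp_apply, Comb.toTerm, Term.eval, Comb.toTerm, Term.eval]
    have hσ : ∀ x, σ ((combEquiv.trans (Comb.act σ h t).τ) x) = (combEquiv.trans t.τ) x :=
      fun x => by simp [Comb.act]
    have e₁ : l.map (combEquiv.trans (Comb.act σ h t).τ).symm =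
        (l.map σ).map (combEquiv.trans t.τ).symm := by
      rw [List.map_map]
      refine List.map_congr_left fun x _ => ?_
      rw [Equiv.symm_apply_eq, ← σ.injective.eq_iff, hσ, Function.comp_apply,
        Equiv.apply_symm_apply]
    have e₂ : (fun x => (G x : ZMod 2)) ∘ (combEquiv.trans (Comb.act σ h t).τ) =
        (fun x => (G' x : ZMod 2)) ∘ (combEquiv.trans t.τ) := by
      funext x
      simp only [Function.comp_apply, ← hGG', hσ]
    rw [e₁, e₂]
    congr 1
    funext x
    exact colorCast_congr σ h haa' (hσ x) _ _

theorem quadEval_swap {c : Fin 3 → C} {d : C} {n : ℤ} {l l' : List (Fin 3)}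
    (hl : IsEnum l) (hl' : IsEnum l') {l₁ l₂ : List (Fin 3)} {x y : Fin 3}
    (h : l = l₁ ++ x :: y :: l₂) (h' : l' = l₁ ++ y :: x :: l₂)
    {a : ∀ x, V (c x)} {G : Fin 3 → ℤ} (ha : ∀ x, a x ∈ (V (c x)).gr (G x)) (q : Quad E c d n) :
    quadEval A hl' ha q = (-1 : k) ^ (G x * G y) • quadEval A hl ha q := by
  obtain ⟨r, rfl⟩ := Submodule.Quotient.mk_surjective _ q
  subst h h'
  rw [quadEval_mk, quadEval_mk, linEval_swap A _ l₁ l₂ x y hl.1, neg_one_zpow_eq_paritySign]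
  push_cast
  rfl

end

section

variable {k : Type u} [Field k] {C : Type} {V : C → DGVec.{u, w} k} {E : BinSMod k C}

/-- Three inputs, as a family indexed by `Fin 3`. -/
def tripleInputs {a b c : C} (x : V a) (y : V b) (z : V c) : ∀ i : Fin 3, V (![a, b, c] i)
  | 0 => x
  | 1 => y
  | 2 => z

theorem tripleInputs_mem {a b c : C} {x : V a} {y : V b} {z : V c} {i j l : ℤ}
    (hx : x ∈ (V a).gr i) (hy : y ∈ (V b).gr j) (hz : z ∈ (V c).gr l) (t : Fin 3) :
    tripleInputs x y z t ∈ (V (![a, b, c] t)).gr (![i, j, l] t) := by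
  fin_cases t <;> assumption

theorem isEnum_fin_three : IsEnum ([0, 1, 2] : List (Fin 3)) :=
  isEnum_perm 1

section
variable (A : BinAction V E) {a b c d : C} {n : ℤ} {x : V a} {y : V b} {z : V c} {i j l : ℤ}
    (hx : x ∈ (V a).gr i) (hy : y ∈ (V b).gr j) (hz : z ∈ (V c).gr l)

/-- The value of an element of `F⁽²⁾(E)` on three homogeneous inputs in the standard order. -/
noncomputable def tripleEval : Quad E ![a, b, c] d n →ₗ[k] V d :=
  quadEval A isEnum_fin_three (tripleInputs_mem hx hy hz)

theorem tripleEval_left {e : C} {m m' : ℤ} (μ : E.M m e c d) (ν : E.M m' a b e)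
    (hn : m + m' = n) :
    tripleEval A hx hy hz (Quad.left μ ν hn) = A.op μ (A.op ν x y) z := by
  rw [tripleEval, Quad.left, Quad.mk, quadEval_mk, Finsupp.mapDomain_single, linEval_single,
    one_smul]
  exact Comb.eval_toTerm A (⟨1, rfl, rfl, rfl, hn, μ, ν⟩ : Comb E ![a, b, c] d n) _ _

/-- Here, as for the two rotations below, the sign is the Koszul sign for bringing `x, y, z` into
the order in which `q` reads them. -/
theorem tripleEval_act_swap (h : ∀ i, ![a, b, c] i = ![b, a, c] (Equiv.swap 0 1 i))
    (q : Quad E ![b, a, c] d n) :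
    tripleEval A hx hy hz (Quad.act (Equiv.swap 0 1) h q) =
      (-1 : k) ^ (i * j) • tripleEval A hy hx hz q := by
  have h₁ : IsEnum ([1, 0, 2] : List (Fin 3)) := isEnum_perm (Equiv.swap 0 1)
  rw [tripleEval, quadEval_act A (Equiv.swap 0 1) h isEnum_fin_three
    h₁ rfl _ (tripleInputs_mem hy hx hz)
    (by intro t; fin_cases t <;> rfl) (by intro t; fin_cases t <;> rfl),
    quadEval_swap A isEnum_fin_three _ (l₁ := []) (l₂ := [2]) (x := 0) (y := 1) rfl rfl]
  simp [tripleEval, mul_comm]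

theorem tripleEval_act_rotate (h : ∀ i, ![a, b, c] i = ![c, a, b] (finRotate 3 i))
    (q : Quad E ![c, a, b] d n) :
    tripleEval A hx hy hz (Quad.act (finRotate 3) h q) =
      (-1 : k) ^ (l * (i + j)) • tripleEval A hz hx hy q := by
  have h₁ : IsEnum ([1, 0, 2] : List (Fin 3)) := isEnum_perm (Equiv.swap 0 1)
  have h₂ : IsEnum ([1, 2, 0] : List (Fin 3)) := isEnum_perm (finRotate 3)
  rw [tripleEval, quadEval_act A (finRotate 3) h isEnum_fin_three
    h₂ rfl _ (tripleInputs_mem hz hx hy)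
    (by intro t; fin_cases t <;> rfl) (by intro t; fin_cases t <;> rfl),
    quadEval_swap A h₁ _ (l₁ := [1]) (l₂ := []) (x := 0) (y := 2) rfl rfl,
    quadEval_swap A isEnum_fin_three _ (l₁ := []) (l₂ := [2]) (x := 0) (y := 1) rfl rfl, smul_smul]
  congr 1
  simp [neg_one_zpow_eq_paritySign, ← paritySign_add]
  ring_nf

theorem tripleEval_act_rotate_inv (h : ∀ i, ![a, b, c] i = ![b, c, a] ((finRotate 3)⁻¹ i))
    (q : Quad E ![b, c, a] d n) :
    tripleEval A hx hy hz (Quad.act (finRotate 3)⁻¹ h q) =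
      (-1 : k) ^ (i * (j + l)) • tripleEval A hy hz hx q := by
  have h₁ : IsEnum ([0, 2, 1] : List (Fin 3)) := isEnum_perm (Equiv.swap 1 2)
  have h₂ : IsEnum ([2, 0, 1] : List (Fin 3)) := isEnum_perm (finRotate 3)⁻¹
  rw [tripleEval, quadEval_act A (finRotate 3)⁻¹ h isEnum_fin_three
    h₂ rfl _ (tripleInputs_mem hy hz hx)
    (by intro t; fin_cases t <;> rfl) (by intro t; fin_cases t <;> rfl),
    quadEval_swap A h₁ _ (l₁ := []) (l₂ := [1]) (x := 0) (y := 2) rfl rfl,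
    quadEval_swap A isEnum_fin_three _ (l₁ := [0]) (l₂ := []) (x := 1) (y := 2) rfl rfl, smul_smul]
  congr 1
  simp [neg_one_zpow_eq_paritySign, ← paritySign_add]
  ring_nf

/-- A right composite is a rotated left composite with flipped root. Rotating costs `i(j + l)`. The
flip costs `i(m' + j + l)`, since the value of `ν` has degree `m' + j + l`. What remains is `m'i`,
the sign for moving `ν` past `x`. -/
theorem tripleEval_right {e : C} {m m' : ℤ} (μ : E.M m a e d) (ν : E.M m' b c e)
    (hn : m + m' = n) :
    tripleEval A hx hy hz (Quad.right μ ν hn) = (-1 : k) ^ (m' * i) • A.op μ x (A.op ν y z) := by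
  have h : ∀ i, ![a, b, c] i = ![b, c, a] ((finRotate 3)⁻¹ i) := by
    intro t; fin_cases t <;> rfl
  have h' : Quad.right μ ν hn = Quad.act (finRotate 3)⁻¹ h (Quad.left (E.swap μ) ν hn) := by
    rw [Quad.left, Quad.right, Quad.mk, Quad.mk, Quad.act, Submodule.mapQ_apply,
      Finsupp.lmapDomain_apply, Finsupp.mapDomain_single]
    congr 2
  rw [h', tripleEval_act_rotate_inv, tripleEval_left, A.op_swap μ hx (A.op_mem ν hy hz), smul_smul]
  congr 1
  simp only [neg_one_zpow_eq_paritySign, ← paritySign_add]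
  push_cast
  congr 1
  grind

end

/-- It is enough to check the relators. -/
theorem BinAction.satisfies_generated {S : ∀ (c : Fin 3 → C) (d : C) (n : ℤ), Quad E c d n → Prop}
    (A : BinAction V E)
    (hS : ∀ {c : Fin 3 → C} {d : C} {n : ℤ} {q : Quad E c d n}, S c d n q →
      ∀ {a : ∀ x, V (c x)} {G : Fin 3 → ℤ} (ha : ∀ x, a x ∈ (V (c x)).gr (G x)),
      quadEval A isEnum_fin_three ha q = 0) :
    BinAction.Satisfies (Q := BinaryQuadraticData.generated E S) A := by
  suffices key : ∀ {c : Fin 3 → C} {d : C} {n : ℤ} (q : Quad E c d n),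
      q ∈ (BinaryQuadraticData.generated E S).R c d n → ∀ {l : List (Fin 3)} (hl : IsEnum l)
      {a : ∀ x, V (c x)} {G : Fin 3 → ℤ} (ha : ∀ x, a x ∈ (V (c x)).gr (G x)),
      quadEval A hl ha q = 0 from
    fun c d n r hr l hl a G ha => key _ hr hl ha
  intro c d n q hq l hl a G ha
  induction hq using Submodule.span_induction with
  | mem y hy =>
    obtain ⟨c₀, σ, h, x, hx, rfl⟩ := hy
    -- The relator itself is evaluated on the inputs relabelled by `σ`.
    have hG : ∀ x, colorCast (V := V) (show c (σ⁻¹ x) = c₀ x by simp [h]) (a (σ⁻¹ x)) ∈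
      (V (c₀ x)).gr (G (σ⁻¹ x)) := fun x => colorCast_mem _ (ha _)
    have key := hS hx hG
    rw [quadEval_act A σ h hl (hl.map σ) rfl ha hG _ (by simp)]
    · obtain ⟨x, rfl⟩ := Submodule.Quotient.mk_surjective _ x
      rw [quadEval_mk] at key ⊢
      exact linEval_eq_zero_of_isEnum A isEnum_fin_three (hl.map σ) key
    · intro x
      exact colorCast_congr (c' := c) (c := c) (a := a) (a' := a) id (fun _ => rfl)
        (fun _ => rfl) (by simp) _ _
  | zero => simp
  | add x y _ _ hx hy => rw [map_add, hx, hy, add_zero]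
  | smul r x _ hx => rw [map_smul, hx, smul_zero]

theorem OperadAlgebra.quadEval_eq_zero {Q : BinaryQuadraticData k C}
    (B : OperadAlgebra Q.operad V) {c : Fin 3 → C} {d : C} {n : ℤ} {q : Quad Q.E c d n}
    (hq : q ∈ Q.R c d n) {l : List (Fin 3)} (hl : IsEnum l)
    {a : ∀ x, V (c x)} {G : Fin 3 → ℤ} (ha : ∀ x, a x ∈ (V (c x)).gr (G x)) :
    quadEval B.toBinAction hl ha q = 0 := by
  obtain ⟨r, rfl⟩ := Submodule.Quotient.mk_surjective _ q
  rw [quadEval_mk]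
  exact B.toBinAction_satisfies r hq hl ha

end

end Operads
-- Isomorphic quadratic data present isomorphic operads.
namespace Operads

section

variable {k : Type u} [Field k] {C : Type}

/-- A morphism of `𝕊`-modules concentrated in arity two. -/
structure BinSMod.Hom (E F : BinSMod k C) where
  map {n : ℤ} {a b d : C} : E.M n a b d →ₗ[k] F.M n a b d
  map_swap {n : ℤ} {a b d : C} (e : E.M n a b d) : map (E.swap e) = F.swap (map e)

variable {E F : BinSMod k C} (f : BinSMod.Hom E F)

/-- The monomial in the images of the generators. -/
def Term.map : ∀ {X : Type} {c : X → C} {d : C} {n : ℤ}, Term E X c d n → Term F X c d n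
  | _, _, _, _, .unit d => .unit d
  | _, _, _, _, .gen e => .gen (f.map e)
  | _, _, _, _, .relabel e hc t => .relabel e hc (t.map)
  | _, _, _, _, .comp x hx hN t s => .comp x hx hN t.map s.map

theorem Term.map_map_of_inverse {f : BinSMod.Hom E F} {f' : BinSMod.Hom F E}
    (h : ∀ {n : ℤ} {a b d : C} (e : E.M n a b d), f'.map (f.map e) = e)
    {X : Type} {c : X → C} {d : C} {n : ℤ} (t : Term E X c d n) : (t.map f).map f' = t := by
  induction t with
  | unit d => rfl
  | gen e => rw [Term.map, Term.map, h]
  | relabel e hc t ih => rw [Term.map, Term.map, ih]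
  | comp x hx hN t s iht ihs => rw [Term.map, Term.map, iht, ihs]

/-- The two-vertex tree with the images of the labels. -/
def Comb.map {c : Fin 3 → C} {d : C} {n : ℤ} (t : Comb E c d n) : Comb F c d n where
  τ := t.τ
  hx := t.hx
  hy := t.hy
  hz := t.hz
  hn := t.hn
  μ := f.map t.μ
  ν := f.map t.ν

/-- The map on weight two parts of free operads. -/
noncomputable def Quad.map {c : Fin 3 → C} {d : C} {n : ℤ} : Quad E c d n →ₗ[k] Quad F c d n :=
  Submodule.mapQ _ _ (Finsupp.lmapDomain k k (Comb.map f)) <| by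
    rw [Submodule.span_le]
    rintro _ (⟨τ, hx, hy, hz, hn, μ, μ', ν⟩ | ⟨τ, hx, hy, hz, hn, r, μ, ν⟩ |
      ⟨τ, hx, hy, hz, hn, μ, ν, ν'⟩ | ⟨τ, hx, hy, hz, hn, r, μ, ν⟩ | ⟨τ, hx, hy, hz, hn, μ, ν⟩)
    all_goals
      refine Submodule.subset_span ?_
      simp only [map_sub, Finsupp.lmapDomain_apply, Finsupp.mapDomain_single, Comb.map, map_add,
        map_smul, f.map_swap]
    · exact Comb.Rel.root_add τ hx hy hz hn _ _ _
    · exact Comb.Rel.root_smul τ hx hy hz hn r _ _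
    · exact Comb.Rel.top_add τ hx hy hz hn _ _ _
    · exact Comb.Rel.top_smul τ hx hy hz hn r _ _
    · exact Comb.Rel.top_swap τ hx hy hz hn _ _

theorem Quad.map_mk {c : Fin 3 → C} {d : C} {n : ℤ} (r : Comb E c d n →₀ k) :
    Quad.map f (Submodule.Quotient.mk r : Quad E c d n) =
      Submodule.Quotient.mk (Finsupp.mapDomain (Comb.map f) r) := rfl

theorem Quad.map_act {c c' : Fin 3 → C} {d : C} {n : ℤ} (σ : Equiv.Perm (Fin 3))
    (h : ∀ i, c' i = c (σ i)) (q : Quad E c d n) :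
    Quad.map f (Quad.act σ h q) = Quad.act σ h (Quad.map f q) := by
  obtain ⟨r, rfl⟩ := Submodule.Quotient.mk_surjective _ q
  simp only [Quad.act, Quad.map, Submodule.mapQ_apply, Finsupp.lmapDomain_apply,
    ← Finsupp.mapDomain_comp]
  rfl

theorem Quad.map_map_of_inverse {f : BinSMod.Hom E F} {f' : BinSMod.Hom F E}
    (h : ∀ {n : ℤ} {a b d : C} (e : E.M n a b d), f'.map (f.map e) = e)
    {c : Fin 3 → C} {d : C} {n : ℤ} (q : Quad E c d n) : Quad.map f' (Quad.map f q) = q := by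
  obtain ⟨r, rfl⟩ := Submodule.Quotient.mk_surjective _ q
  have hc : Comb.map (c := c) (d := d) (n := n) f' ∘ Comb.map f = id := by
    funext t
    exact congrArg₂ (fun μ ν => (⟨t.τ, t.hx, t.hy, t.hz, t.hn, μ, ν⟩ : Comb E c d n)) (h t.μ) (h t.ν)
  rw [Quad.map_mk, Quad.map_mk, ← Finsupp.mapDomain_comp, hc, Finsupp.mapDomain_id]

section
variable {X : Type} {c : X → C} {d : C} {n : ℤ}

theorem mapDomain_rawRelabel {Y : Type} (e : X ≃ Y) {c' : Y → C} (hc : ∀ x, c' (e x) = c x)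
    (p : Term E X c d n →₀ k) :
    Finsupp.mapDomain (Term.map f) (rawRelabel e hc p) =
      rawRelabel e hc (Finsupp.mapDomain (Term.map f) p) := by
  simp only [rawRelabel, Finsupp.lmapDomain_apply, ← Finsupp.mapDomain_comp]
  rfl

theorem mapDomain_rawComp {Y : Type} (x : X) {b : Y → C} {a : C} {m N : ℤ}
    (hx : c x = a) (hN : n + m = N) (p : Term E X c d n →₀ k) (q : Term E Y b a m →₀ k) :
    Finsupp.mapDomain (Term.map f) (rawComp x hx hN p q) =
      rawComp x hx hN (Finsupp.mapDomain (Term.map f) p) (Finsupp.mapDomain (Term.map f) q) := by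
  induction p using Finsupp.induction_linear with
  | zero => simp
  | add p p' hp hp' =>
    simp only [map_add, LinearMap.add_apply, Finsupp.mapDomain_add, hp, hp']
  | single t r =>
    simp only [rawComp, Finsupp.linearCombination_single, LinearMap.smul_apply,
      Finsupp.lmapDomain_apply, Finsupp.mapDomain_single, Finsupp.mapDomain_smul,
      ← Finsupp.mapDomain_comp]
    rfl

end

theorem mapDomain_single_sub {α β : Type*} (φ : α → β) (a b : α) (r : k) :
    Finsupp.mapDomain φ (Finsupp.single a (1 : k) - Finsupp.single b r) =
      Finsupp.single (φ a) 1 - Finsupp.single (φ b) r := by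
  rw [← Finsupp.lmapDomain_apply k k, map_sub, Finsupp.lmapDomain_apply, Finsupp.lmapDomain_apply,
    Finsupp.mapDomain_single, Finsupp.mapDomain_single]

variable {Q Q' : BinaryQuadraticData k C}

/-- `Term.map` commutes with all constructors of monomials, so every generator of the ideal goes to
the generator of the same kind; `hf` is used only for the relations in `R`. -/
theorem Vanish.map (f : BinSMod.Hom Q.E Q'.E)
    (hf : ∀ {c : Fin 3 → C} {d : C} {n : ℤ} (q : Quad Q.E c d n), q ∈ Q.R c d n →
      Quad.map f q ∈ Q'.R c d n)
    {X : Type} {c : X → C} {d : C} {n : ℤ} {p : Term Q.E X c d n →₀ k} (hp : Vanish Q p) :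
    Vanish Q' (Finsupp.mapDomain (Term.map f) p) := by
  induction hp with
  | zero => rw [Finsupp.mapDomain_zero]; exact .zero
  | add _ _ h h' => rw [Finsupp.mapDomain_add]; exact h.add h'
  | smul r _ h => rw [Finsupp.mapDomain_smul]; exact h.smul r
  | relabel e hc _ h => rw [mapDomain_rawRelabel]; exact h.relabel e hc
  | comp_left x hx hN q _ h => rw [mapDomain_rawComp]; exact h.comp_left x hx hN _
  | comp_right x hx hN q _ h => rw [mapDomain_rawComp]; exact h.comp_right x hx hN _
  | relabel_refl p => rw [mapDomain_single_sub]; exact .relabel_refl _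
  | relabel_trans e e' hc hc' p => rw [mapDomain_single_sub]; exact .relabel_trans e e' hc hc' _
  | comp_relabel e e' hc hb x hx hN p q =>
    rw [mapDomain_single_sub]; exact .comp_relabel e e' hc hb x hx hN _ _
  | comp_seq x y hx hy h₁ h₂ h₃ h₄ p q r =>
    rw [mapDomain_single_sub]; exact .comp_seq x y hx hy h₁ h₂ h₃ h₄ _ _ _
  | comp_par hxx' hx hx' h₁ h₂ h₃ h₄ p q r =>
    rw [mapDomain_single_sub]; exact .comp_par hxx' hx hx' h₁ h₂ h₃ h₄ _ _ _
  | unit_comp p => rw [mapDomain_single_sub]; exact .unit_comp _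
  | comp_unit x p => rw [mapDomain_single_sub]; exact .comp_unit x _
  | gen_add e e' =>
    have h := Vanish.gen_add (Q := Q') (f.map e) (f.map e')
    rw [← map_add] at h
    rw [← Finsupp.lmapDomain_apply k k, map_sub, Finsupp.lmapDomain_apply, mapDomain_single_sub,
      Finsupp.lmapDomain_apply, Finsupp.mapDomain_single]
    exact h
  | gen_smul r e =>
    have h := Vanish.gen_smul (Q := Q') r (f.map e)
    rw [← map_smul] at h
    rw [mapDomain_single_sub]
    exact h
  | gen_swap e =>
    have h := Vanish.gen_swap (Q := Q') (f.map e)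
    rw [← f.map_swap] at h
    rw [mapDomain_single_sub]
    exact h
  | rel r hr =>
    rw [← Finsupp.mapDomain_comp]
    have h := Vanish.rel (Q := Q') (Finsupp.mapDomain (Comb.map f) r) (hf _ hr)
    rwa [← Finsupp.mapDomain_comp] at h

/-- The linear map between presented operads given by a morphism of generators that respects the
relations. -/
noncomputable def BinaryQuadraticData.presMap (f : BinSMod.Hom Q.E Q'.E)
    (hf : ∀ {c : Fin 3 → C} {d : C} {n : ℤ} (q : Quad Q.E c d n), q ∈ Q.R c d n →
      Quad.map f q ∈ Q'.R c d n) {X : Type} {c : X → C} {d : C} {n : ℤ} :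
    Q.PresOp X c d n →ₗ[k] Q'.PresOp X c d n :=
  Submodule.mapQ _ _ (Finsupp.lmapDomain k k (Term.map f)) fun _ hp => Vanish.map f hf hp

theorem BinaryQuadraticData.presMap_cls (f : BinSMod.Hom Q.E Q'.E)
    (hf : ∀ {c : Fin 3 → C} {d : C} {n : ℤ} (q : Quad Q.E c d n), q ∈ Q.R c d n →
      Quad.map f q ∈ Q'.R c d n) {X : Type} {c : X → C} {d : C} {n : ℤ} (t : Term Q.E X c d n) :
    presMap f hf (Q.cls t) = Q'.cls (t.map f) :=
  congrArg (Submodule.mkQ (Q'.vanishing X c d n)) Finsupp.mapDomain_single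

theorem BinaryQuadraticData.presMap_presMap {f : BinSMod.Hom Q.E Q'.E} {f' : BinSMod.Hom Q'.E Q.E}
    (hff' : ∀ {n : ℤ} {a b d : C} (e : Q.E.M n a b d), f'.map (f.map e) = e)
    (hf : ∀ {c : Fin 3 → C} {d : C} {n : ℤ} (q : Quad Q.E c d n), q ∈ Q.R c d n →
      Quad.map f q ∈ Q'.R c d n)
    (hf' : ∀ {c : Fin 3 → C} {d : C} {n : ℤ} (q : Quad Q'.E c d n), q ∈ Q'.R c d n →
      Quad.map f' q ∈ Q.R c d n) {X : Type} {c : X → C} {d : C} {n : ℤ}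
    (p : Q.PresOp X c d n) : presMap f' hf' (presMap f hf p) = p := by
  induction p using Q.presOp_induction with
  | zero => simp
  | add p q hp hq => rw [map_add, map_add, hp, hq]
  | smul r p hp => rw [map_smul, map_smul, hp]
  | cls t => rw [presMap_cls, presMap_cls, Term.map_map_of_inverse hff']

section
variable (f : BinSMod.Hom Q.E Q'.E)
  (hf : ∀ {c : Fin 3 → C} {d : C} {n : ℤ} (q : Quad Q.E c d n), q ∈ Q.R c d n →
    Quad.map f q ∈ Q'.R c d n)

theorem BinaryQuadraticData.presMap_presRelabel {X Y : Type} (e : X ≃ Y) {c : X → C} {c' : Y → C}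
    (hc : ∀ x, c' (e x) = c x) {d : C} {n : ℤ} (p : Q.PresOp X c d n) :
    presMap f hf (Q.presRelabel e hc p) = Q'.presRelabel e hc (presMap f hf p) := by
  induction p using Q.presOp_induction with
  | zero => simp
  | add p q hp hq => simp only [map_add, hp, hq]
  | smul r p hp => simp only [map_smul, hp]
  | cls t => rw [presRelabel_cls, presMap_cls, presMap_cls, presRelabel_cls]; rfl

theorem BinaryQuadraticData.presMap_presComp {X Y : Type} (x : X) {c : X → C} {b : Y → C} {a d : C}
    {m n N : ℤ} (hx : c x = a) (hN : m + n = N) (p : Q.PresOp X c d m) (q : Q.PresOp Y b a n) :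
    presMap f hf (Q.presComp x hx hN p q) =
      Q'.presComp x hx hN (presMap f hf p) (presMap f hf q) := by
  induction p using Q.presOp_induction with
  | zero => simp
  | add p p' hp hp' => simp only [map_add, LinearMap.add_apply, hp, hp']
  | smul r p hp => simp only [map_smul, LinearMap.smul_apply, hp]
  | cls t =>
    induction q using Q.presOp_induction with
    | zero => simp
    | add q q' hq hq' => simp only [map_add, hq, hq']
    | smul r q hq => simp only [map_smul, hq]
    | cls s => rw [presComp_cls, presMap_cls, presMap_cls, presMap_cls, presComp_cls]; rfl

end

/-- Isomorphic quadratic data present isomorphic components. -/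
noncomputable def BinaryQuadraticData.presEquiv (f : BinSMod.Hom Q.E Q'.E)
    (f' : BinSMod.Hom Q'.E Q.E)
    (hff' : ∀ {n : ℤ} {a b d : C} (e : Q.E.M n a b d), f'.map (f.map e) = e)
    (hf'f : ∀ {n : ℤ} {a b d : C} (e : Q'.E.M n a b d), f.map (f'.map e) = e)
    (hf : ∀ {c : Fin 3 → C} {d : C} {n : ℤ} (q : Quad Q.E c d n), q ∈ Q.R c d n →
      Quad.map f q ∈ Q'.R c d n)
    (hf' : ∀ {c : Fin 3 → C} {d : C} {n : ℤ} (q : Quad Q'.E c d n), q ∈ Q'.R c d n →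
      Quad.map f' q ∈ Q.R c d n) {X : Type} {c : X → C} {d : C} {n : ℤ} :
    Q.PresOp X c d n ≃ₗ[k] Q'.PresOp X c d n :=
  { presMap f hf with
    invFun := presMap f' hf'
    left_inv := presMap_presMap hff' hf hf'
    right_inv := presMap_presMap hf'f hf' hf }

/-- Isomorphic quadratic data present isomorphic operads. -/
noncomputable def BinaryQuadraticData.iso (f : BinSMod.Hom Q.E Q'.E) (f' : BinSMod.Hom Q'.E Q.E)
    (hff' : ∀ {n : ℤ} {a b d : C} (e : Q.E.M n a b d), f'.map (f.map e) = e)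
    (hf'f : ∀ {n : ℤ} {a b d : C} (e : Q'.E.M n a b d), f.map (f'.map e) = e)
    (hf : ∀ {c : Fin 3 → C} {d : C} {n : ℤ} (q : Quad Q.E c d n), q ∈ Q.R c d n →
      Quad.map f q ∈ Q'.R c d n)
    (hf' : ∀ {c : Fin 3 → C} {d : C} {n : ℤ} (q : Quad Q'.E c d n), q ∈ Q'.R c d n →
      Quad.map f' q ∈ Q.R c d n) : ColoredOperad.Iso Q.operad Q'.operad where
  equiv := presEquiv f f' hff' hf'f hf hf'
  map_unit _ := presMap_cls f hf _
  map_relabel e _ _ hc _ _ p := presMap_presRelabel f hf e hc p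
  map_comp x _ _ _ _ _ _ _ hx hN p q := presMap_presComp f hf x hx hN p q

theorem BinaryQuadraticData.iso_gen (f : BinSMod.Hom Q.E Q'.E) (f' : BinSMod.Hom Q'.E Q.E)
    (hff' : ∀ {n : ℤ} {a b d : C} (e : Q.E.M n a b d), f'.map (f.map e) = e)
    (hf'f : ∀ {n : ℤ} {a b d : C} (e : Q'.E.M n a b d), f.map (f'.map e) = e)
    (hf : ∀ {c : Fin 3 → C} {d : C} {n : ℤ} (q : Quad Q.E c d n), q ∈ Q.R c d n →
      Quad.map f q ∈ Q'.R c d n)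
    (hf' : ∀ {c : Fin 3 → C} {d : C} {n : ℤ} (q : Quad Q'.E c d n), q ∈ Q'.R c d n →
      Quad.map f' q ∈ Q.R c d n) {a b d : C} {n : ℤ} (e : Q.E.M n a b d) :
    (iso f f' hff' hf'f hf hf').equiv (Q.gen e) = Q'.gen (f.map e) :=
  presMap_cls f hf _

end

/-- Algebras can be transported along isomorphisms of operads. -/
def OperadAlgebra.comap {k : Type u} [Field k] {C : Type} {P : ColoredOperad.{u, v} k C}
    {P' : ColoredOperad.{u, v} k C} {V : C → DGVec.{u, w} k} (Φ : ColoredOperad.Iso P P')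
    (B : OperadAlgebra P' V) : OperadAlgebra P V where
  act L := B.act L ∘ₗ Φ.equiv.toLinearMap
  act_mem L p := B.act_mem L (Φ.equiv p)
  act_swap L L' l₁ l₂ x y hL hL' p := B.act_swap L L' l₁ l₂ x y hL hL' (Φ.equiv p)
  act_unit L a := by
    simp only [LinearMap.comp_apply, LinearEquiv.coe_coe, Φ.map_unit, B.act_unit]
  act_relabel e _ _ hc _ _ p L L' hL a := by
    simp only [LinearMap.comp_apply, LinearEquiv.coe_coe, Φ.map_relabel]
    exact B.act_relabel e hc _ L L' hL a
  act_comp x _ _ _ _ _ _ _ hx hN p q L M K l₁ l₂ hL hK a a' g hg := by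
    simp only [LinearMap.comp_apply, LinearEquiv.coe_coe, Φ.map_comp]
    exact B.act_comp x hx hN _ _ L M K l₁ l₂ hL hK a a' g hg
  act_d L p := B.act_d L (Φ.equiv p)

end Operads
-- Comparison of `E_{v^!}` with the dual of `E_v`.
namespace SwissCheese

open Operads Color

/-- The position of a basis element in the list `f₂, g₂, e₀₂, e₀₂', e₁₁, e₁₁'`. -/
def GenV.code {n : ℤ} {a b d : Color} : GenV n a b d → Fin 6
  | f₂ => 0
  | g₂ => 1
  | e₀₂ => 2
  | e₀₂' => 3
  | e₁₁' => 5
  | e₁₁ => 4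

/-- The position of a basis element in the list `𝔩₂, 𝔠₂, 𝔫₀₂, 𝔫₀₂', 𝔫₁₁, 𝔫₁₁'`. -/
def GenD.code {n : ℤ} {a b d : Color} : GenD n a b d → Fin 6
  | l₂ => 0
  | c₂ => 1
  | n₀₂ => 2
  | n₀₂' => 3
  | n₁₁' => 5
  | n₁₁ => 4

/-- The sign relating `E_{v^!}` to the dual basis of `E_v`. -/
def dualSign : Fin 6 → ℤ := ![1, 1, 1, -1, 1, -1]

/-- The basis element of `E_v` to which `g` is dual, up to sign. -/
def GenD.toV {n : ℤ} {a b d : Color} : GenD n a b d → GenV (-n) a b d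
  | l₂ => GenV.f₂
  | c₂ => GenV.g₂
  | n₀₂ => GenV.e₀₂
  | n₀₂' => GenV.e₀₂'
  | n₁₁ => GenV.e₁₁
  | n₁₁' => GenV.e₁₁'

theorem GenD.code_injective {n : ℤ} {a b d : Color} :
    Function.Injective (GenD.code (n := n) (a := a) (b := b) (d := d)) := by
  intro g h e
  cases g <;> cases h <;> first | rfl | cases e

instance {n : ℤ} {a b d : Color} : Finite (GenD n a b d) := Finite.of_injective _ GenD.code_injective

theorem GenD.code_toV {n : ℤ} {a b d : Color} (g : GenD n a b d) : g.toV.code = g.code := by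
  cases g <;> rfl

theorem GenD.toV_injective {n : ℤ} {a b d : Color} :
    Function.Injective (GenD.toV (n := n) (a := a) (b := b) (d := d)) := fun g h e =>
  GenD.code_injective (by rw [← g.code_toV, ← h.code_toV, e])

theorem GenD.toV_surjective {n : ℤ} {a b d : Color} (v : GenV (-n) a b d) :
    ∃ g : GenD n a b d, g.toV = v := by
  -- The index `-n` cannot be unified with the degrees of the constructors, so it is replaced by a
  -- variable and an equation.
  suffices h : ∀ {m : ℤ} (v : GenV m a b d) (hm : m = -n),
      ∃ g : GenD n a b d, g.toV = hm ▸ v from h v rfl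
  intro m v hm
  cases v
  · obtain rfl : n = 0 := by omega
    exact ⟨l₂, rfl⟩
  · obtain rfl : n = -1 := by omega
    exact ⟨c₂, rfl⟩
  · obtain rfl : n = 0 := by omega
    exact ⟨n₀₂, rfl⟩
  · obtain rfl : n = 0 := by omega
    exact ⟨n₀₂', rfl⟩
  · obtain rfl : n = 0 := by omega
    exact ⟨n₁₁, rfl⟩
  · obtain rfl : n = 0 := by omega
    exact ⟨n₁₁', rfl⟩

theorem GenD.toV_swap {n : ℤ} {a b d : Color} (g : GenD n a b d) : g.swap.toV = g.toV.swap := by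
  cases g <;> rfl

/-- This is equivariance of the comparison on basis elements. The action on `E_v^∨` is twisted by
the signature, so the transposition takes the dual of `e₀₂` to minus the dual of `e₀₂ · (21)`, and
similarly for `e₁₁`. This forces the entries `-1` of `dualSign` at the primed elements. -/
theorem GenD.dualSign_swap {n : ℤ} {a b d : Color} (g : GenD n a b d) :
    (g.sign : ℤ) * dualSign g.swap.code = -dualSign g.code := by
  cases g <;> rfl

theorem dualSign_mul_self (i : Fin 6) : dualSign i * dualSign i = 1 := by
  revert i; decide

section
variable (k : Type u) [Field k]

/-- The comparison of `E_{v^!}` with `E_v^∨`, on components. -/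
noncomputable def toDualMap {n : ℤ} {a b d : Color} :
    (GenD n a b d →₀ k) →ₗ[k] Module.Dual k (GenV (-n) a b d →₀ k) :=
  Finsupp.linearCombination k fun g : GenD n a b d =>
    ((dualSign g.code : ℤ) : k) • (Finsupp.lapply g.toV : (GenV (-n) a b d →₀ k) →ₗ[k] k)

theorem toDualMap_apply {n : ℤ} {a b d : Color} (e : GenD n a b d →₀ k) (g : GenD n a b d) :
    toDualMap k e (Finsupp.single g.toV 1) = ((dualSign g.code : ℤ) : k) * e g := by
  classical
  induction e using Finsupp.induction_linear with
  | zero => simp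
  | add e e' h h' => rw [map_add, LinearMap.add_apply, h, h', Finsupp.add_apply, mul_add]
  | single g' r =>
    rw [toDualMap, Finsupp.linearCombination_single]
    by_cases h : g' = g
    · subst h
      simp [mul_comm]
    · simp [h, GenD.toV_injective.eq_iff, Ne.symm h]

theorem toDualMap_single {n : ℤ} {a b d : Color} (g : GenD n a b d) :
    toDualMap k (Finsupp.single g 1) = ((dualSign g.code : ℤ) : k) • Finsupp.lapply g.toV := by
  rw [toDualMap, Finsupp.linearCombination_single, one_smul]

theorem GenD.swap_swap {n : ℤ} {a b d : Color} (g : GenD n a b d) : g.swap.swap = g := by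
  cases g <;> rfl

theorem toDualMap_swap {n : ℤ} {a b d : Color} (e : GenD n a b d →₀ k) :
    toDualMap k (Finsupp.linearCombination k
      (fun g : GenD n a b d => Finsupp.single g.swap (((g.sign : ℤˣ) : ℤ) : k)) e) =
      -(toDualMap k e ∘ₗ Finsupp.linearCombination k
        fun g : GenV (-n) b a d => Finsupp.single g.swap (((1 : ℤˣ) : ℤ) : k)) := by
  classical
  induction e using Finsupp.induction_linear with
  | zero => simp
  | add e e' h h' => rw [map_add, map_add, map_add, h, h', LinearMap.add_comp, neg_add]
  | single g r =>
    refine Finsupp.lhom_ext fun v s => ?_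
    obtain ⟨g', rfl⟩ := GenD.toV_surjective v
    have hs : (Finsupp.single g'.toV s : GenV (-n) b a d →₀ k) =
        s • Finsupp.single g'.toV 1 := by simp
    rw [hs, map_smul, map_smul, toDualMap_apply, Finsupp.linearCombination_single,
      LinearMap.neg_apply, LinearMap.comp_apply, Finsupp.linearCombination_single, one_smul,
      Units.val_one, Int.cast_one, ← GenD.toV_swap, toDualMap_apply, Finsupp.smul_single,
      smul_eq_mul]
    congr 1
    by_cases h : g.swap = g'
    · subst h
      rw [GenD.swap_swap, Finsupp.single_eq_same, Finsupp.single_eq_same]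
      have h := g.dualSign_swap
      have h' : ((g.sign : ℤ) : k) * ((dualSign g.swap.code : ℤ) : k) =
          -((dualSign g.code : ℤ) : k) := by exact_mod_cast congrArg (Int.cast : ℤ → k) h
      linear_combination r * h'
    · have hne : g ≠ g'.swap := fun e => h (by rw [e, GenD.swap_swap])
      simp [h, hne]

/-- The comparison of `E_{v^!}` with `E_v^∨`. -/
noncomputable def toDual : BinSMod.Hom (Ed k) (Ev k).dual where
  map := toDualMap k
  map_swap := toDualMap_swap k

/-- The inverse of `toDualMap`. -/
noncomputable def ofDualMap {n : ℤ} {a b d : Color} :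
    Module.Dual k (GenV (-n) a b d →₀ k) →ₗ[k] (GenD n a b d →₀ k) :=
  (Finsupp.linearEquivFunOnFinite k k (GenD n a b d)).symm.toLinearMap ∘ₗ
    LinearMap.pi fun g => ((dualSign g.code : ℤ) : k) • LinearMap.applyₗ (Finsupp.single g.toV 1)

theorem ofDualMap_apply {n : ℤ} {a b d : Color} (φ : Module.Dual k (GenV (-n) a b d →₀ k))
    (g : GenD n a b d) :
    ofDualMap k φ g = ((dualSign g.code : ℤ) : k) * φ (Finsupp.single g.toV 1) := rfl

theorem ofDualMap_toDualMap {n : ℤ} {a b d : Color} (e : GenD n a b d →₀ k) :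
    ofDualMap k (toDualMap k e) = e := by
  ext g
  rw [ofDualMap_apply, toDualMap_apply, ← mul_assoc, ← Int.cast_mul, dualSign_mul_self,
    Int.cast_one, one_mul]

theorem toDualMap_ofDualMap {n : ℤ} {a b d : Color} (φ : Module.Dual k (GenV (-n) a b d →₀ k)) :
    toDualMap k (ofDualMap k φ) = φ := by
  refine Finsupp.lhom_ext fun v s => ?_
  obtain ⟨g, rfl⟩ := GenD.toV_surjective v
  have hs : (Finsupp.single g.toV s : GenV (-n) a b d →₀ k) =
      s • Finsupp.single g.toV 1 := by simp
  rw [hs, map_smul, map_smul, toDualMap_apply, ofDualMap_apply, ← mul_assoc, ← Int.cast_mul,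
    dualSign_mul_self, Int.cast_one, one_mul]

/-- The inverse of `toDual`. -/
noncomputable def ofDual : BinSMod.Hom (Ev k).dual (Ed k) where
  map := ofDualMap k
  map_swap φ := by
    have h := (toDual k).map_swap (ofDualMap k φ)
    have h₁ : (toDual k).map (ofDualMap k φ) = φ := toDualMap_ofDualMap k φ
    rw [h₁] at h
    rw [← h]
    exact ofDualMap_toDualMap k _

theorem ofDual_toDual {n : ℤ} {a b d : Color} (e : (Ed k).M n a b d) :
    (ofDual k).map ((toDual k).map e) = e :=
  ofDualMap_toDualMap k e

theorem toDual_ofDual {n : ℤ} {a b d : Color} (e : (Ev k).dual.M n a b d) :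
    (toDual k).map ((ofDual k).map e) = e :=
  toDualMap_ofDualMap k e

theorem toDual_l₂ : (toDual k).map (GenD.l₂.el k) = 𝔩₂ k :=
  (toDualMap_single k GenD.l₂).trans (by simp [dualSign, GenD.code]; rfl)

theorem toDual_c₂ : (toDual k).map (GenD.c₂.el k) = 𝔠₂ k :=
  (toDualMap_single k GenD.c₂).trans (by simp [dualSign, GenD.code]; rfl)

theorem toDual_n₀₂ : (toDual k).map (GenD.n₀₂.el k) = 𝔫₀₂ k :=
  (toDualMap_single k GenD.n₀₂).trans (by simp [dualSign, GenD.code]; rfl)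

theorem toDual_n₁₁ : (toDual k).map (GenD.n₁₁.el k) = 𝔫₁₁ k :=
  (toDualMap_single k GenD.n₁₁).trans (by simp [dualSign, GenD.code]; rfl)

/-- A position determines the degree and the colours, so components that are not dual to each other
need no separate treatment: the evaluation depends on the positions alone. -/
theorem eval_toDual {n m : ℤ} {a b d a' b' d' : Color} (g : GenD n a b d) (v : GenV m a' b' d') :
    Quad.eval ((toDual k).map (g.el k)) (v.el k) =
      if v.code = g.code then ((dualSign g.code : ℤ) : k) else 0 := by
  classical
  by_cases hv : m = -n ∧ a' = a ∧ b' = b ∧ d' = d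
  · obtain ⟨rfl, rfl, rfl, rfl⟩ := hv
    obtain ⟨g', rfl⟩ := GenD.toV_surjective v
    rw [GenD.code_toV, Quad.eval, dif_pos ⟨rfl, rfl, rfl, rfl⟩]
    refine (toDualMap_apply k (Finsupp.single g 1) g').trans ?_
    by_cases h : g' = g
    · subst h
      rw [Finsupp.single_eq_same, mul_one, if_pos rfl]
    · rw [Finsupp.single_eq_of_ne h, mul_zero, if_neg fun e => h (GenD.code_injective e)]
  · rw [Quad.eval, dif_neg hv, if_neg]
    intro e
    apply hv
    cases v <;> cases g <;> first | exact ⟨rfl, rfl, rfl, rfl⟩ | exact absurd e (by decide)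

end

end SwissCheese
-- Trees with basis labels and their pairing.
namespace SwissCheese

open Operads Color

/-- The effect of `GenD.swap` on positions. -/
def swapCode : Fin 6 → Fin 6 := ![0, 1, 3, 2, 5, 4]

/-- The sign `GenD.sign` in terms of positions. -/
def swapSign : Fin 6 → ℤ := ![-1, -1, 1, 1, 1, 1]

theorem GenD.code_swap {n : ℤ} {a b d : Color} (g : GenD n a b d) :
    g.swap.code = swapCode g.code := by
  cases g <;> rfl

theorem GenD.sign_eq {n : ℤ} {a b d : Color} (g : GenD n a b d) :
    (g.sign : ℤ) = swapSign g.code := by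
  cases g <;> rfl

/-- The pairing of a tree in `E_v` with a tree in `E_{v^!}`, in terms of positions. -/
def flatPair (τ : Equiv.Perm (Fin 3)) (g h : Fin 6) (τ' : Equiv.Perm (Fin 3)) (g' h' : Fin 6) : ℤ :=
  Equiv.Perm.sign τ * (if g = 1 ∧ h' = 1 then -1 else 1) * (if g = g' then dualSign g' else 0) *
    ((if τ' = τ then if h = h' then dualSign h' else 0 else 0) +
      (if τ' = τ * Equiv.swap 0 1 then
        swapSign h' * (if h = swapCode h' then dualSign (swapCode h') else 0) else 0))

section
variable (k : Type u) [Field k]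

/-- A tree with vertices labelled by basis elements of `E_v`. -/
noncomputable def treeV {c : Fin 3 → Color} {n : ℤ} (τ : Equiv.Perm (Fin 3)) {i j : ℤ}
    {x y z e d : Color} (μ : GenV i e z d) (ν : GenV j x y e) (hx : c (τ 0) = x)
    (hy : c (τ 1) = y) (hz : c (τ 2) = z) (hn : i + j = n) : Quad (Ev k) c d n :=
  Quad.mk ⟨τ, hx, hy, hz, hn, μ.el k, ν.el k⟩

/-- A tree with vertices labelled by basis elements of `E_{v^!}`. -/
noncomputable def treeD {c : Fin 3 → Color} {n : ℤ} (τ : Equiv.Perm (Fin 3)) {i j : ℤ}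
    {x y z e d : Color} (μ : GenD i e z d) (ν : GenD j x y e) (hx : c (τ 0) = x)
    (hy : c (τ 1) = y) (hz : c (τ 2) = z) (hn : i + j = n) : Quad (Ed k) c d n :=
  Quad.mk ⟨τ, hx, hy, hz, hn, μ.el k, ν.el k⟩

theorem pairing_mk_mk {C : Type} {E : BinSMod k C} {c : Fin 3 → C} {d : C} {n m : ℤ}
    (t : Comb E c d n) (s : Comb E.dual c d m) :
    Quad.pairing (Quad.mk t) (Quad.mk s) = Quad.pairComb t s := by
  simp [Quad.pairing, Quad.mk]

theorem Ed_swap_el {n : ℤ} {a b d : Color} (g : GenD n a b d) :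
    (Ed k).swap (g.el k) = ((g.sign : ℤ) : k) • g.swap.el k := by
  have h : Finsupp.linearCombination k
      (fun g : GenD n a b d => Finsupp.single g.swap (((g.sign : ℤˣ) : ℤ) : k))
      (Finsupp.single g 1) = ((g.sign : ℤ) : k) • Finsupp.single g.swap (1 : k) := by
    simp
  exact h

theorem Ev_swap_el {n : ℤ} {a b d : Color} (g : GenV n a b d) :
    (Ev k).swap (g.el k) = g.swap.el k := by
  have h : Finsupp.linearCombination k
      (fun g : GenV n a b d => Finsupp.single g.swap (((1 : ℤˣ) : ℤ) : k))
      (Finsupp.single g 1) = Finsupp.single g.swap (1 : k) := by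
    simp
  exact h

/-- A bilinear map takes its values in the span of its values on bases. -/
theorem bilin_mem {α β M : Type*} [AddCommGroup M] [Module k M]
    (φ : (α →₀ k) →ₗ[k] (β →₀ k) →ₗ[k] M) (W : Submodule k M)
    (h : ∀ a b, φ (Finsupp.single a 1) (Finsupp.single b 1) ∈ W) (μ : α →₀ k) (ν : β →₀ k) :
    φ μ ν ∈ W := by
  induction μ using Finsupp.induction_linear with
  | zero => simp
  | add p q hp hq => rw [map_add, LinearMap.add_apply]; exact add_mem hp hq
  | single a r =>
    induction ν using Finsupp.induction_linear with
    | zero => simp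
    | add p q hp hq => rw [map_add]; exact add_mem hp hq
    | single b s =>
      have h₁ : (Finsupp.single a r : α →₀ k) = r • Finsupp.single a 1 := by simp
      have h₂ : (Finsupp.single b s : β →₀ k) = s • Finsupp.single b 1 := by simp
      rw [h₁, h₂, map_smul, map_smul, LinearMap.smul_apply]
      exact W.smul_mem _ (W.smul_mem _ (h a b))

/-- Removes the colours, the degrees and the field from the pairing: what is left is an integer
computed from finite data, within reach of `decide`. -/
theorem pairing_tree {c : Fin 3 → Color} {n m : ℤ} {τ τ' : Equiv.Perm (Fin 3)} {i j i' j' : ℤ}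
    {x y z e x' y' z' e' d : Color} (μ : GenV i e z d) (ν : GenV j x y e) (hx : c (τ 0) = x)
    (hy : c (τ 1) = y) (hz : c (τ 2) = z) (hn : i + j = n)
    (μ' : GenD i' e' z' d) (ν' : GenD j' x' y' e') (hx' : c (τ' 0) = x')
    (hy' : c (τ' 1) = y') (hz' : c (τ' 2) = z') (hn' : i' + j' = m) :
    Quad.pairing (treeV k τ μ ν hx hy hz hn)
        (Quad.map (toDual k) (treeD k τ' μ' ν' hx' hy' hz' hn')) =
      ((flatPair τ μ.code ν.code τ' μ'.code ν'.code : ℤ) : k) := by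
  have h : Quad.map (toDual k) (treeD k τ' μ' ν' hx' hy' hz' hn') =
      Quad.mk ⟨τ', hx', hy', hz', hn', (toDual k).map (μ'.el k), (toDual k).map (ν'.el k)⟩ := by
    rw [treeD, Quad.mk, Quad.map_mk, Finsupp.mapDomain_single]
    rfl
  -- The only generators of odd degree are `g₂` and `𝔠₂`, so the Koszul sign of the pairing is `-1`
  -- for these two and `1` otherwise.
  have hd : (-1 : k) ^ (i * j') =
      ((if μ.code = 1 ∧ ν'.code = 1 then -1 else 1 : ℤ) : k) := by
    cases μ <;> cases ν' <;> simp [GenV.code, GenD.code]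
  rw [h, treeV, pairing_mk_mk, Quad.pairComb]
  dsimp only
  rw [← (toDual k).map_swap, Ed_swap_el, map_smul, Quad.eval_smul_left, eval_toDual, eval_toDual,
    eval_toDual, hd, GenD.code_swap, GenD.sign_eq, flatPair]
  push_cast
  rfl

theorem act_treeV {c c' : Fin 3 → Color} {n : ℤ} (σ : Equiv.Perm (Fin 3)) (h : ∀ i, c' i = c (σ i))
    {τ : Equiv.Perm (Fin 3)} {i j : ℤ}
    {x y z e d : Color} (μ : GenV i e z d) (ν : GenV j x y e) (hx : c (τ 0) = x)
    (hy : c (τ 1) = y) (hz : c (τ 2) = z) (hn : i + j = n) :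
    Quad.act σ h (treeV k τ μ ν hx hy hz hn) = treeV k (σ⁻¹ * τ) μ ν (by simp [h, hx])
      (by simp [h, hy]) (by simp [h, hz]) hn := by
  rw [treeV, Quad.mk, Quad.act, Submodule.mapQ_apply, Finsupp.lmapDomain_apply,
    Finsupp.mapDomain_single]
  rfl

theorem act_treeD {c c' : Fin 3 → Color} {n : ℤ} (σ : Equiv.Perm (Fin 3)) (h : ∀ i, c' i = c (σ i))
    {τ : Equiv.Perm (Fin 3)} {i j : ℤ}
    {x y z e d : Color} (μ : GenD i e z d) (ν : GenD j x y e) (hx : c (τ 0) = x)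
    (hy : c (τ 1) = y) (hz : c (τ 2) = z) (hn : i + j = n) :
    Quad.act σ h (treeD k τ μ ν hx hy hz hn) = treeD k (σ⁻¹ * τ) μ ν (by simp [h, hx])
      (by simp [h, hy]) (by simp [h, hz]) hn := by
  rw [treeD, Quad.mk, Quad.act, Submodule.mapQ_apply, Finsupp.lmapDomain_apply,
    Finsupp.mapDomain_single]
  rfl

end

section
variable {k : Type u} [Field k] {C : Type} {E : BinSMod k C} {c : Fin 3 → C} {d : C} {n : ℤ}
  (τ : Equiv.Perm (Fin 3)) {x y z e : C} (hx : c (τ 0) = x) (hy : c (τ 1) = y)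
  (hz : c (τ 2) = z) {i j : ℤ} (hn : i + j = n)

theorem mk_eq_of_rel {r : Comb E c d n →₀ k} (h : Comb.Rel E c d n r) :
    (Submodule.Quotient.mk r : Quad E c d n) = 0 :=
  (Submodule.Quotient.mk_eq_zero _).2 (Submodule.subset_span h)

theorem mk_single (t : Comb E c d n) (r : k) :
    (Submodule.Quotient.mk (Finsupp.single t r) : Quad E c d n) = r • Quad.mk t := by
  rw [Quad.mk, ← Submodule.Quotient.mk_smul, Finsupp.smul_single, smul_eq_mul, mul_one]

/-- A tree as a bilinear function of its labels. -/
noncomputable def treeLin : E.M i e z d →ₗ[k] E.M j x y e →ₗ[k] Quad E c d n :=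
  LinearMap.mk₂ k (fun μ ν => Quad.mk ⟨τ, hx, hy, hz, hn, μ, ν⟩)
    (fun μ μ' ν => by
      have h := mk_eq_of_rel (Comb.Rel.root_add τ hx hy hz hn μ μ' ν)
      rwa [Submodule.Quotient.mk_sub, Submodule.Quotient.mk_sub, sub_sub, sub_eq_zero] at h)
    (fun r μ ν => by
      have h := mk_eq_of_rel (Comb.Rel.root_smul τ hx hy hz hn r μ ν)
      rwa [Submodule.Quotient.mk_sub, sub_eq_zero, mk_single _ r] at h)
    (fun μ ν ν' => by
      have h := mk_eq_of_rel (Comb.Rel.top_add τ hx hy hz hn μ ν ν')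
      rwa [Submodule.Quotient.mk_sub, Submodule.Quotient.mk_sub, sub_sub, sub_eq_zero] at h)
    (fun r μ ν => by
      have h := mk_eq_of_rel (Comb.Rel.top_smul τ hx hy hz hn r μ ν)
      rwa [Submodule.Quotient.mk_sub, sub_eq_zero, mk_single _ r] at h)

theorem treeLin_swap (μ : E.M i e z d) (ν : E.M j x y e) :
    treeLin τ hx hy hz hn μ ν = treeLin (τ * Equiv.swap 0 1) (by simpa using hy)
      (by simpa using hx) (by rw [Equiv.Perm.mul_apply, Equiv.swap_apply_of_ne_of_ne] <;> simp [hz])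
      hn μ (E.swap ν) := by
  have h := mk_eq_of_rel (Comb.Rel.top_swap τ hx hy hz hn μ ν)
  rwa [Submodule.Quotient.mk_sub, sub_eq_zero] at h

end

section
variable {k : Type u} [Field k] {c : Fin 3 → Color} {d : Color} {n : ℤ}
  (τ : Equiv.Perm (Fin 3)) {x y z e : Color} (hx : c (τ 0) = x) (hy : c (τ 1) = y)
  (hz : c (τ 2) = z) {i j : ℤ} (hn : i + j = n)

theorem treeD_swap (μ : GenD i e z d) (ν : GenD j x y e) (τ' : Equiv.Perm (Fin 3))
    (hτ : τ' = τ * Equiv.swap 0 1) (hx' : c (τ' 0) = y) (hy' : c (τ' 1) = x) (hz' : c (τ' 2) = z) :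
    treeD k τ μ ν hx hy hz hn =
      ((ν.sign : ℤ) : k) • treeD k τ' μ ν.swap hx' hy' hz' hn := by
  subst hτ
  refine (treeLin_swap (E := Ed k) τ hx hy hz hn (μ.el k) (ν.el k)).trans ?_
  rw [Ed_swap_el, map_smul]
  rfl

/-- The trees with basis labels span. -/
theorem mem_of_treeD {W : Submodule k (Quad (Ed k) c d n)}
    (h : ∀ (τ : Equiv.Perm (Fin 3)) {i j : ℤ} {x y z e : Color} (μ : GenD i e z d)
      (ν : GenD j x y e) (hx : c (τ 0) = x) (hy : c (τ 1) = y) (hz : c (τ 2) = z)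
      (hn : i + j = n), treeD k τ μ ν hx hy hz hn ∈ W) (q : Quad (Ed k) c d n) : q ∈ W := by
  obtain ⟨r, rfl⟩ := Submodule.Quotient.mk_surjective _ q
  induction r using Finsupp.induction_linear with
  | zero => exact zero_mem W
  | add p q hp hq => exact add_mem hp hq
  | single t r =>
    rw [mk_single]
    refine W.smul_mem r ?_
    obtain ⟨τ, hx, hy, hz, hn, μ, ν⟩ := t
    exact bilin_mem k (treeLin (E := Ed k) τ hx hy hz hn) W
      (fun μ ν => h τ μ ν hx hy hz hn) μ ν

end

end SwissCheese
-- Orthogonality of the two families of relators.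
namespace SwissCheese

open Operads Color

section
variable {C : Type} (x y z : C)

theorem one_color_zero : ![x, y, z] ((1 : Equiv.Perm (Fin 3)) 0) = x := rfl

theorem one_color_one : ![x, y, z] ((1 : Equiv.Perm (Fin 3)) 1) = y := rfl

theorem one_color_two : ![x, y, z] ((1 : Equiv.Perm (Fin 3)) 2) = z := rfl

theorem rotate_color_zero : ![x, y, z] (finRotate 3 0) = y := rfl

theorem rotate_color_one : ![x, y, z] (finRotate 3 1) = z := rfl

theorem rotate_color_two : ![x, y, z] (finRotate 3 2) = x := rfl

end

section
variable (k : Type u) [Field k]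

theorem GenV.l_eq {i j : ℤ} {x y z e d : Color} (n : ℤ) (μ : GenV i e z d) (ν : GenV j x y e)
    (h : i + j = n) :
    GenV.l k n μ ν h =
      treeV k 1 μ ν (one_color_zero x y z) (one_color_one x y z) (one_color_two x y z) h := rfl

theorem GenV.r_eq {i j : ℤ} {x y z e d : Color} (n : ℤ) (μ : GenV i x e d) (ν : GenV j y z e)
    (h : i + j = n) :
    GenV.r k n μ ν h = treeV k (finRotate 3) μ.swap ν (rotate_color_zero x y z)
      (rotate_color_one x y z) (rotate_color_two x y z) h :=
  congrArg (fun m => Quad.mk (⟨finRotate 3, rfl, rfl, rfl, h, m, ν.el k⟩ :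
    Comb (Ev k) ![x, y, z] d n)) (Ev_swap_el k μ)

theorem GenD.l_eq {i j : ℤ} {x y z e d : Color} (n : ℤ) (μ : GenD i e z d) (ν : GenD j x y e)
    (h : i + j = n) :
    GenD.l k n μ ν h =
      treeD k 1 μ ν (one_color_zero x y z) (one_color_one x y z) (one_color_two x y z) h := rfl

theorem GenD.r_eq {i j : ℤ} {x y z e d : Color} (n : ℤ) (μ : GenD i x e d) (ν : GenD j y z e)
    (h : i + j = n) :
    GenD.r k n μ ν h = ((μ.sign : ℤ) : k) • treeD k (finRotate 3) μ.swap ν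
      (rotate_color_zero x y z) (rotate_color_one x y z) (rotate_color_two x y z) h := by
  have h₁ : GenD.r k n μ ν h = treeLin (E := Ed k) (finRotate 3) (rotate_color_zero x y z)
    (rotate_color_one x y z) (rotate_color_two x y z) h ((Ed k).swap (μ.el k)) (ν.el k) := rfl
  rw [h₁, Ed_swap_el, map_smul, LinearMap.smul_apply]
  rfl

/-- The relators of the dual presentation are orthogonal to those of `sc^vor`. -/
theorem pairing_relV_relD {c c₀ : Fin 3 → Color} {d : Color} {n m : ℤ} {x : Quad (Ev k) c₀ d m}
    {y : Quad (Ed k) c d n} (hx : RelV k c₀ d m x) (hy : RelD k c d n y)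
    (σ : Equiv.Perm (Fin 3)) (h : ∀ i, c i = c₀ (σ i)) :
    Quad.pairing (Quad.act σ h x) (Quad.map (toDual k) y) = 0 := by
  -- All pairs of relators with the same output colour; each pairing is expanded into a sum of
  -- integers `flatPair`.
  cases hx <;> cases hy <;>
    simp only [GenV.l_eq, GenV.r_eq, GenD.l_eq, GenD.r_eq, act213, act231, act312, map_add, map_sub,
      map_smul, act_treeV, act_treeD, LinearMap.add_apply, LinearMap.sub_apply, pairing_tree,
      smul_eq_mul] <;>
    norm_cast <;>
    · refine (congrArg (Int.cast : ℤ → k) ?_).trans Int.cast_zero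
      -- The integer vanishes for every `σ`, including those that do not match the colours, so the
      -- compatibility is dropped before deciding.
      clear h
      revert σ
      decide

end

end SwissCheese
-- The orthogonal of `R_v`, a criterion for membership in `R_{v^!}`, and the translated relators.
namespace SwissCheese

open Operads Color

section
variable (k : Type u) [Field k]

/-- The relations `R_v`. -/
noncomputable def relV (c : Fin 3 → Color) (d : Color) (n : ℤ) : Submodule k (Quad (Ev k) c d n) :=
  Submodule.span k {y | ∃ (c₀ : Fin 3 → Color) (σ : Equiv.Perm (Fin 3))
    (h : ∀ i, c i = c₀ (σ i)) (x : Quad (Ev k) c₀ d n), RelV k c₀ d n x ∧ y = Quad.act σ h x}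

/-- The relations `R_{v^!}`. -/
noncomputable def relD (c : Fin 3 → Color) (d : Color) (n : ℤ) : Submodule k (Quad (Ed k) c d n) :=
  Submodule.span k {y | ∃ (c₀ : Fin 3 → Color) (σ : Equiv.Perm (Fin 3))
    (h : ∀ i, c i = c₀ (σ i)) (x : Quad (Ed k) c₀ d n), RelD k c₀ d n x ∧ y = Quad.act σ h x}

theorem act_mem_relV {c c₀ : Fin 3 → Color} {d : Color} {n : ℤ} (σ : Equiv.Perm (Fin 3))
    (h : ∀ i, c i = c₀ (σ i)) {x : Quad (Ev k) c₀ d n} (hx : RelV k c₀ d n x) :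
    Quad.act σ h x ∈ relV k c d n :=
  Submodule.subset_span ⟨c₀, σ, h, x, hx, rfl⟩

theorem act_mem_relD {c c₀ : Fin 3 → Color} {d : Color} {n : ℤ} (σ : Equiv.Perm (Fin 3))
    (h : ∀ i, c i = c₀ (σ i)) {x : Quad (Ed k) c₀ d n} (hx : RelD k c₀ d n x) :
    Quad.act σ h x ∈ relD k c d n :=
  Submodule.subset_span ⟨c₀, σ, h, x, hx, rfl⟩

/-- The elements of `F⁽²⁾(E_{v^!})` orthogonal to `R_v`. -/
def Orthogonal {c : Fin 3 → Color} {d : Color} {n : ℤ} (y : Quad (Ed k) c d n) : Prop :=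
  ∀ m, ∀ x ∈ relV k c d m, Quad.pairing x (Quad.map (toDual k) y) = 0

theorem Orthogonal.act {c c' : Fin 3 → Color} {d : Color} {n : ℤ} {y : Quad (Ed k) c d n}
    (hy : Orthogonal k y) (σ : Equiv.Perm (Fin 3)) (h : ∀ i, c' i = c (σ i)) :
    Orthogonal k (Quad.act σ h y) := by
  intro m x hx
  rw [Quad.map_act]
  exact (scvor k).koszulDual.act_mem σ h hy m x hx

/-- The pairing is invariant up to sign under simultaneous permutation, so permutations need to be
considered on the side of `R_v` only, and the statement reduces to pairs of relators. -/
theorem orthogonal_of_mem {c : Fin 3 → Color} {d : Color} {n : ℤ} {y : Quad (Ed k) c d n}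
    (hy : y ∈ relD k c d n) : Orthogonal k y := by
  induction hy using Submodule.span_induction with
  | zero => intro m x _; rw [map_zero, map_zero]
  | add y y' _ _ h h' => intro m x hx; rw [map_add, map_add, h m x hx, h' m x hx, add_zero]
  | smul r y _ h => intro m x hx; rw [map_smul, map_smul, h m x hx, smul_zero]
  | mem y hy =>
    obtain ⟨c₀, σ, h, y, hy, rfl⟩ := hy
    refine Orthogonal.act k ?_ σ h
    intro m x hx
    induction hx using Submodule.span_induction with
    | zero => rw [map_zero, LinearMap.zero_apply]
    | add x x' _ _ h h' => rw [map_add, LinearMap.add_apply, h, h', add_zero]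
    | smul r x _ h => rw [map_smul, LinearMap.smul_apply, h, smul_zero]
    | mem x hx =>
      obtain ⟨c₁, ρ, hρ, x, hx, rfl⟩ := hx
      exact pairing_relV_relD k hx hy ρ hρ

/-- A criterion for `R_{v^!}` to contain the orthogonal of `R_v` in a given component. -/
theorem mem_relD_of_orthogonal {c : Fin 3 → Color} {d : Color} {n m : ℤ} {ι : Type} [Finite ι]
    (N : ι → Quad (Ed k) c d n) (x : ι → Quad (Ev k) c d m) (hx : ∀ i, x i ∈ relV k c d m)
    (hne : ∀ i, Quad.pairing (x i) (Quad.map (toDual k) (N i)) ≠ 0)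
    (hz : ∀ i j, i ≠ j → Quad.pairing (x i) (Quad.map (toDual k) (N j)) = 0)
    (hN : ∀ q, q ∈ relD k c d n ⊔ Submodule.span k (Set.range N))
    {y : Quad (Ed k) c d n} (hy : Orthogonal k y) : y ∈ relD k c d n := by
  have := Fintype.ofFinite ι
  obtain ⟨r, hr, s, hs, rfl⟩ := Submodule.mem_sup.1 (hN y)
  obtain ⟨a, rfl⟩ := (Submodule.mem_span_range_iff_exists_fun k).1 hs
  refine add_mem hr ?_
  -- Pairing with `x i` kills the component in `R_{v^!}` and all trees but `N i`, leaving `a i`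
  -- times a nonzero scalar.
  have ha : ∀ i, a i = 0 := by
    intro i
    have h := hy m (x i) (hx i)
    have h' := orthogonal_of_mem k hr m (x i) (hx i)
    rw [map_add, map_add, h', zero_add, map_sum, map_sum, Finset.sum_eq_single i, map_smul,
      map_smul, smul_eq_mul] at h
    · exact (mul_eq_zero.1 h).resolve_right (hne i)
    · intro j _ hj
      rw [map_smul, map_smul, hz i j hj.symm, smul_zero]
    · intro h
      exact absurd (Finset.mem_univ i) h
  simp [ha]

end

section
variable {k : Type u} [Field k] {c : Fin 3 → Color}

theorem color_inv {τ : Equiv.Perm (Fin 3)} {x y z : Color} (hx : c (τ 0) = x) (hy : c (τ 1) = y)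
    (hz : c (τ 2) = z) (i : Fin 3) : c i = ![x, y, z] (τ⁻¹ i) := by
  obtain ⟨j, rfl⟩ := τ.surjective i
  rw [Equiv.Perm.inv_def, Equiv.symm_apply_apply]
  subst hx hy hz
  fin_cases j <;> rfl

open GenD

/-- This and the lemmas below translate a relator by `τ⁻¹` and write it in trees whose upper vertex
is not primed. They serve as rewriting rules that eliminate all but the chosen trees in each
component. -/
theorem jacobi_mem (τ : Equiv.Perm (Fin 3)) (hc : ∀ i, c i = cl) :
    treeD k τ l₂ l₂ (hc _) (hc _) (hc _) (add_zero 0) +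
      treeD k (τ * (finRotate 3)⁻¹) l₂ l₂ (hc _) (hc _) (hc _) (add_zero 0) +
      treeD k (τ * finRotate 3) l₂ l₂ (hc _) (hc _) (hc _) (add_zero 0) ∈ relD k c cl 0 := by
  have h := act_mem_relD k τ⁻¹ (color_inv (hc _) (hc _) (hc _)) (RelD.l_jacobi (k := k))
  simpa only [l_eq, act231, act312, map_add, act_treeD, inv_inv, mul_one] using h

theorem leibniz_mem (τ : Equiv.Perm (Fin 3)) (hc : ∀ i, c i = cl) :
    treeD k (τ * finRotate 3) l₂ c₂ (hc _) (hc _) (hc _) (zero_add (-1)) +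
      treeD k τ c₂ l₂ (hc _) (hc _) (hc _) (add_zero (-1)) +
      treeD k (τ * (finRotate 3)⁻¹) c₂ l₂ (hc _) (hc _) (hc _) (add_zero (-1)) ∈
        relD k c cl (-1) := by
  have h := act_mem_relD k τ⁻¹ (color_inv (hc _) (hc _) (hc _)) (RelD.leibniz (k := k))
  -- The last term of the Leibniz relator carries its leaves in the opposite orientation; exchanging
  -- the two leaves of the antisymmetric `𝔩₂` brings them back to a rotation of `τ`, with a sign.
  have hs : τ * (finRotate 3)⁻¹ = τ * (Equiv.swap 0 1 * finRotate 3) * Equiv.swap 0 1 := by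
    rw [mul_assoc]; congr 1; decide
  have hw := treeD_swap (k := k) (τ * (Equiv.swap 0 1 * finRotate 3)) (hc _) (hc _) (hc _)
    (add_zero (-1)) c₂ l₂ (τ * (finRotate 3)⁻¹) hs (hc _) (hc _) (hc _)
  simp only [l_eq, r_eq, act213, map_add, map_sub, map_smul, act_treeD, inv_inv, mul_one,
    Equiv.swap_inv, GenD.swap] at h
  rw [hw] at h
  rw [← neg_mem_iff]
  convert h using 1
  simp only [GenD.sign, GenD.swap]
  simp
  abel

theorem c_assoc_mem (τ : Equiv.Perm (Fin 3)) (hc : ∀ i, c i = cl) :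
    treeD k τ c₂ c₂ (hc _) (hc _) (hc _) (by norm_num) -
      treeD k (τ * finRotate 3) c₂ c₂ (hc _) (hc _) (hc _) (by norm_num) ∈ relD k c cl (-2) := by
  have h := act_mem_relD k τ⁻¹ (color_inv (hc _) (hc _) (hc _)) (RelD.c_assoc (k := k))
  simp only [l_eq, r_eq, map_add, map_smul, act_treeD, inv_inv, mul_one] at h
  convert h using 1
  simp only [GenD.sign, GenD.swap]
  simp
  abel

theorem n_assoc_mem (τ : Equiv.Perm (Fin 3)) (hc : ∀ i, c i = op) :
    treeD k (τ * finRotate 3) n₀₂' n₀₂ (hc _) (hc _) (hc _) (add_zero 0) -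
      treeD k τ n₀₂ n₀₂ (hc _) (hc _) (hc _) (add_zero 0) ∈ relD k c op 0 := by
  have h := act_mem_relD k τ⁻¹ (color_inv (hc _) (hc _) (hc _)) (RelD.n_assoc (k := k))
  simp only [l_eq, r_eq, map_sub, map_smul, act_treeD, inv_inv, mul_one] at h
  convert h using 1
  simp only [GenD.sign, GenD.swap]
  simp

theorem lie_action_mem (τ : Equiv.Perm (Fin 3)) (hx : c (τ 0) = cl) (hy : c (τ 1) = cl)
    (hz : c (τ 2) = op) :
    treeD k τ n₁₁ l₂ hx hy hz (add_zero 0) -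
      treeD k (τ * finRotate 3) n₁₁' n₁₁ hy hz hx (add_zero 0) +
      treeD k (τ * (Equiv.swap 0 1 * finRotate 3)) n₁₁' n₁₁ hx hz hy (add_zero 0) ∈
        relD k c op 0 := by
  have h := act_mem_relD k τ⁻¹ (color_inv hx hy hz) (RelD.lie_action (k := k))
  simp only [l_eq, r_eq, act213, map_sub, map_smul, act_treeD, inv_inv, mul_one,
    Equiv.swap_inv] at h
  convert h using 1
  simp only [GenD.sign, GenD.swap]
  simp
  abel

theorem derivation_mem (τ : Equiv.Perm (Fin 3)) (hx : c (τ 0) = cl) (hy : c (τ 1) = op)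
    (hz : c (τ 2) = op) :
    treeD k (τ * finRotate 3) n₁₁' n₀₂ hy hz hx (add_zero 0) -
      treeD k τ n₀₂ n₁₁ hx hy hz (add_zero 0) -
      treeD k (τ * (Equiv.swap 0 1 * finRotate 3)) n₀₂' n₁₁ hx hz hy (add_zero 0) ∈
        relD k c op 0 := by
  have h := act_mem_relD k τ⁻¹ (color_inv hx hy hz) (RelD.derivation (k := k))
  simp only [l_eq, r_eq, act213, map_add, map_sub, map_smul, act_treeD, inv_inv, mul_one,
    Equiv.swap_inv] at h
  convert h using 1
  simp only [GenD.sign, GenD.swap]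
  simp
  abel

theorem kills_product_mem (τ : Equiv.Perm (Fin 3)) (hx : c (τ 0) = cl) (hy : c (τ 1) = cl)
    (hz : c (τ 2) = op) :
    treeD k τ n₁₁ c₂ hx hy hz (zero_add (-1)) ∈ relD k c op (-1) := by
  have h := act_mem_relD k τ⁻¹ (color_inv hx hy hz) (RelD.kills_product (k := k))
  simpa only [l_eq, act_treeD, inv_inv, mul_one] using h

end

end SwissCheese
-- Components whose inputs all have the same colour.
namespace SwissCheese

open Operads Color

section
variable {k : Type u} [Field k] {c : Fin 3 → Color} {d : Color} {n : ℤ}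

open GenD

theorem perm_even_or_odd : ∀ τ : Equiv.Perm (Fin 3),
    (τ = 1 ∨ τ = finRotate 3 ∨ τ = (finRotate 3)⁻¹) ∨
      (τ * Equiv.swap 0 1 = 1 ∨ τ * Equiv.swap 0 1 = finRotate 3 ∨
        τ * Equiv.swap 0 1 = (finRotate 3)⁻¹) := by
  decide

theorem treeD_mem_of_swap {W : Submodule k (Quad (Ed k) c d n)} (τ : Equiv.Perm (Fin 3))
    {x y z e : Color} {i j : ℤ} (hx : c (τ 0) = x) (hy : c (τ 1) = y) (hz : c (τ 2) = z)
    (hn : i + j = n) (μ : GenD i e z d) (ν : GenD j x y e)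
    (h : ∀ hx' hy' hz', treeD k (τ * Equiv.swap 0 1) μ ν.swap hx' hy' hz' hn ∈ W) :
    treeD k τ μ ν hx hy hz hn ∈ W := by
  have hz' : c ((τ * Equiv.swap 0 1 : Equiv.Perm (Fin 3)) 2) = z := by
    rw [Equiv.Perm.mul_apply, Equiv.swap_apply_of_ne_of_ne] <;> simp [hz]
  rw [treeD_swap τ hx hy hz hn μ ν _ rfl (by simpa using hy) (by simpa using hx) hz']
  exact W.smul_mem _ (h _ _ _)

/-- The trees whose upper vertex is labelled by `𝔩₂`, `𝔠₂`, `𝔫₀₂` or `𝔫₁₁` span, and in the first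
two cases one tree for each cyclic order suffices. -/
theorem mem_of_treeD_reduced {W : Submodule k (Quad (Ed k) c d n)}
    (hl : ∀ (τ : Equiv.Perm (Fin 3)), (τ = 1 ∨ τ = finRotate 3 ∨ τ = (finRotate 3)⁻¹) →
      ∀ {i : ℤ} {z : Color} (μ : GenD i cl z d) (hx : c (τ 0) = cl) (hy : c (τ 1) = cl)
      (hz : c (τ 2) = z) (hn : i + 0 = n), treeD k τ μ l₂ hx hy hz hn ∈ W)
    (hc : ∀ (τ : Equiv.Perm (Fin 3)), (τ = 1 ∨ τ = finRotate 3 ∨ τ = (finRotate 3)⁻¹) →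
      ∀ {i : ℤ} {z : Color} (μ : GenD i cl z d) (hx : c (τ 0) = cl) (hy : c (τ 1) = cl)
      (hz : c (τ 2) = z) (hn : i + -1 = n), treeD k τ μ c₂ hx hy hz hn ∈ W)
    (hm : ∀ (τ : Equiv.Perm (Fin 3))
      {i : ℤ} {z : Color} (μ : GenD i op z d) (hx : c (τ 0) = op) (hy : c (τ 1) = op)
      (hz : c (τ 2) = z) (hn : i + 0 = n), treeD k τ μ n₀₂ hx hy hz hn ∈ W)
    (ha : ∀ (τ : Equiv.Perm (Fin 3))
      {i : ℤ} {z : Color} (μ : GenD i op z d) (hx : c (τ 0) = cl) (hy : c (τ 1) = op)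
      (hz : c (τ 2) = z) (hn : i + 0 = n), treeD k τ μ n₁₁ hx hy hz hn ∈ W)
    (q : Quad (Ed k) c d n) : q ∈ W := by
  refine mem_of_treeD ?_ q
  intro τ i j x y z e μ ν hx hy hz hn
  cases ν with
  | l₂ =>
    rcases perm_even_or_odd τ with hτ | hτ
    · exact hl τ hτ μ hx hy hz hn
    · exact treeD_mem_of_swap τ hx hy hz hn μ _ fun hx' hy' hz' => hl _ hτ μ hx' hy' hz' hn
  | c₂ =>
    rcases perm_even_or_odd τ with hτ | hτ
    · exact hc τ hτ μ hx hy hz hn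
    · exact treeD_mem_of_swap τ hx hy hz hn μ _ fun hx' hy' hz' => hc _ hτ μ hx' hy' hz' hn
  | n₀₂ => exact hm τ μ hx hy hz hn
  | n₀₂' => exact treeD_mem_of_swap τ hx hy hz hn μ _ fun hx' hy' hz' => hm _ μ hx' hy' hz' hn
  | n₁₁ => exact ha τ μ hx hy hz hn
  | n₁₁' => exact treeD_mem_of_swap τ hx hy hz hn μ _ fun hx' hy' hz' => ha _ μ hx' hy' hz' hn

theorem cast_ne_zero_of_unit {z : ℤ} (h : z = 1 ∨ z = -1) : (z : k) ≠ 0 := by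
  rcases h with rfl | rfl <;> simp

theorem cast_eq_zero_of_eq {z : ℤ} (h : z = 0) : (z : k) = 0 := by
  rw [h, Int.cast_zero]

theorem not_cl_op {a : Color} (h : a = cl) (h' : a = op) : False := by
  cases h.symm.trans h'

/-- Of the three cyclic trees in `𝔩₂`, the Jacobi identity eliminates one. The two that remain are
detected by associators of `f₂`, each containing one of the two kept trees and the eliminated one.
-/
theorem mem_relD_closed_zero (hc : ∀ i, c i = cl) {y : Quad (Ed k) c cl 0}
    (hy : Orthogonal k y) : y ∈ relD k c cl 0 := by
  have hv : ∀ σ : Equiv.Perm (Fin 3), ∀ i, c i = ![cl, cl, cl] (σ i) := fun σ =>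
    color_inv (τ := σ⁻¹) (hc _) (hc _) (hc _)
  refine mem_relD_of_orthogonal k (ι := Fin 2)
    (fun j => treeD k (![1, finRotate 3] j) l₂ l₂ (hc _) (hc _) (hc _) (add_zero 0))
    (fun j => Quad.act (![finRotate 3, (finRotate 3)⁻¹] j) (hv _)
      (GenV.f₂.r k 0 GenV.f₂ - GenV.f₂.l k 0 GenV.f₂))
    (fun j => act_mem_relV k _ _ RelV.f_assoc) ?_ ?_ ?_ hy
  · intro i
    simp only [GenV.l_eq, GenV.r_eq, map_sub, act_treeV, LinearMap.sub_apply, pairing_tree,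
      ← Int.cast_sub]
    exact cast_ne_zero_of_unit (by revert i; decide)
  · intro i j hij
    simp only [GenV.l_eq, GenV.r_eq, map_sub, act_treeV, LinearMap.sub_apply, pairing_tree,
      ← Int.cast_sub]
    exact cast_eq_zero_of_eq (by revert i j; decide)
  · have h : ∀ j : Fin 2, treeD k (![1, finRotate 3] j) l₂ l₂ (hc _) (hc _) (hc _) (add_zero 0) ∈
        relD k c cl 0 ⊔ Submodule.span k (Set.range fun j : Fin 2 =>
          treeD k (![1, finRotate 3] j) l₂ l₂ (hc _) (hc _) (hc _) (add_zero 0)) := fun j =>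
      Submodule.mem_sup_right (Submodule.subset_span ⟨j, rfl⟩)
    refine mem_of_treeD_reduced ?_ ?_ ?_ ?_
    · intro τ hτ i z μ hx hy hz hn
      cases μ with
      | l₂ =>
        rcases hτ with rfl | rfl | rfl
        · exact h 0
        · exact h 1
        · have h' := jacobi_mem (k := k) 1 hc
          simp only [one_mul] at h'
          convert sub_mem (sub_mem (Submodule.mem_sup_left h') (h 0)) (h 1) using 1
          simp only [Matrix.cons_val_zero, Matrix.cons_val_one]
          abel
      | c₂ => omega
    · intro τ hτ i z μ hx hy hz hn
      cases μ <;> omega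
    · intro τ i z μ hx
      exact (not_cl_op (hc _) hx).elim
    · intro τ i z μ _ hy
      exact (not_cl_op (hc _) hy).elim

/-- The Leibniz relation eliminates the trees with `𝔩₂` at the root. The three trees `𝔠₂(𝔩₂ ⊗ id)`
are detected by the Leibniz relations of `sc^vor`, each of which has a single term with `g₂` at the
root. -/
theorem mem_relD_closed_neg_one (hc : ∀ i, c i = cl) {y : Quad (Ed k) c cl (-1)}
    (hy : Orthogonal k y) : y ∈ relD k c cl (-1) := by
  have hv : ∀ σ : Equiv.Perm (Fin 3), ∀ i, c i = ![cl, cl, cl] (σ i) := fun σ =>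
    color_inv (τ := σ⁻¹) (hc _) (hc _) (hc _)
  refine mem_relD_of_orthogonal k (ι := Fin 3)
    (fun j => treeD k (![1, finRotate 3, (finRotate 3)⁻¹] j) c₂ l₂ (hc _) (hc _) (hc _)
      (add_zero (-1)))
    (fun j => Quad.act (![finRotate 3, 1, (finRotate 3)⁻¹] j) (hv _) (GenV.g₂.r k 1 GenV.f₂ -
      (GenV.f₂.l k 1 GenV.g₂ + act213 (GenV.f₂.r k 1 GenV.g₂))))
    (fun j => act_mem_relV k _ _ RelV.leibniz) ?_ ?_ ?_ hy
  · intro i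
    simp only [GenV.l_eq, GenV.r_eq, act213, map_sub, map_add, act_treeV, LinearMap.sub_apply,
      LinearMap.add_apply, pairing_tree, ← Int.cast_sub, ← Int.cast_add]
    exact cast_ne_zero_of_unit (by revert i; decide)
  · intro i j hij
    simp only [GenV.l_eq, GenV.r_eq, act213, map_sub, map_add, act_treeV, LinearMap.sub_apply,
      LinearMap.add_apply, pairing_tree, ← Int.cast_sub, ← Int.cast_add]
    exact cast_eq_zero_of_eq (by revert i j; decide)
  · have h : ∀ τ, (τ = 1 ∨ τ = finRotate 3 ∨ τ = (finRotate 3)⁻¹) →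
        treeD k τ c₂ l₂ (hc _) (hc _) (hc _) (add_zero (-1)) ∈
        relD k c cl (-1) ⊔ Submodule.span k (Set.range fun j : Fin 3 =>
          treeD k (![1, finRotate 3, (finRotate 3)⁻¹] j) c₂ l₂ (hc _) (hc _) (hc _)
            (add_zero (-1))) := by
      rintro τ (rfl | rfl | rfl)
      · exact Submodule.mem_sup_right (Submodule.subset_span ⟨0, rfl⟩)
      · exact Submodule.mem_sup_right (Submodule.subset_span ⟨1, rfl⟩)
      · exact Submodule.mem_sup_right (Submodule.subset_span ⟨2, rfl⟩)
    refine mem_of_treeD_reduced ?_ ?_ ?_ ?_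
    · intro τ hτ i z μ hx hy hz hn
      cases μ with
      | l₂ => omega
      | c₂ => exact h τ hτ
    · intro τ hτ i z μ hx hy hz hn
      cases μ with
      | l₂ =>
        -- `leibniz_mem` places the tree to be eliminated at `τ * finRotate 3`, whence the inverse
        -- rotation. The two other trees are still in cyclic order.
        have h' := leibniz_mem (k := k) (τ * (finRotate 3)⁻¹) hc
        simp only [inv_mul_cancel_right] at h'
        convert sub_mem (sub_mem (Submodule.mem_sup_left h')
          (h (τ * (finRotate 3)⁻¹) (by clear hx hy hz h'; revert τ; decide)))
          (h (τ * (finRotate 3)⁻¹ * (finRotate 3)⁻¹)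
            (by clear hx hy hz h'; revert τ; decide)) using 1
        abel
      | c₂ => omega
    · intro τ i z μ hx
      exact (not_cl_op (hc _) hx).elim
    · intro τ i z μ _ hy
      exact (not_cl_op (hc _) hy).elim

/-- Associativity up to sign identifies the three cyclic trees in `𝔠₂`, so one remains; the Jacobi
identity of `g₂` detects it. -/
theorem mem_relD_closed_neg_two (hc : ∀ i, c i = cl) {y : Quad (Ed k) c cl (-2)}
    (hy : Orthogonal k y) : y ∈ relD k c cl (-2) := by
  have hv : ∀ σ : Equiv.Perm (Fin 3), ∀ i, c i = ![cl, cl, cl] (σ i) := fun σ =>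
    color_inv (τ := σ⁻¹) (hc _) (hc _) (hc _)
  refine mem_relD_of_orthogonal k (ι := Unit)
    (fun _ => treeD k 1 c₂ c₂ (hc _) (hc _) (hc _) (by norm_num))
    (fun _ => Quad.act 1 (hv _) (GenV.g₂.l k 2 GenV.g₂ + act231 (GenV.g₂.l k 2 GenV.g₂) +
      act312 (GenV.g₂.l k 2 GenV.g₂)))
    (fun j => act_mem_relV k _ _ RelV.g_jacobi) ?_ (fun i j h => absurd rfl h) ?_ hy
  · intro i
    simp only [GenV.l_eq, act231, act312, map_add, act_treeV, LinearMap.add_apply, pairing_tree,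
      ← Int.cast_add]
    exact cast_ne_zero_of_unit (by decide)
  · have h₀ : treeD k 1 c₂ c₂ (hc _) (hc _) (hc _) (by norm_num) ∈
        relD k c cl (-2) ⊔ Submodule.span k (Set.range fun _ : Unit =>
          treeD k 1 c₂ c₂ (hc _) (hc _) (hc _) (by norm_num)) :=
      Submodule.mem_sup_right (Submodule.subset_span ⟨(), rfl⟩)
    have h₁ := c_assoc_mem (k := k) 1 hc
    have h₂ := c_assoc_mem (k := k) (finRotate 3)⁻¹ hc
    simp only [one_mul, inv_mul_cancel] at h₁ h₂
    refine mem_of_treeD_reduced ?_ ?_ ?_ ?_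
    · intro τ hτ i z μ hx hy hz hn
      cases μ <;> omega
    · intro τ hτ i z μ hx hy hz hn
      cases μ with
      | l₂ => omega
      | c₂ =>
        rcases hτ with rfl | rfl | rfl
        · exact h₀
        · convert sub_mem h₀ (Submodule.mem_sup_left h₁) using 1
          abel
        · convert add_mem (Submodule.mem_sup_left h₂) h₀ using 1
          abel
    · intro τ i z μ hx
      exact (not_cl_op (hc _) hx).elim
    · intro τ i z μ _ hy
      exact (not_cl_op (hc _) hy).elim

/-- The associative operad is its own dual: associativity eliminates the right combs, and each of
the six left combs is detected by the associator of `e₀₂` that contains it. -/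
theorem mem_relD_open (hc : ∀ i, c i = op) {y : Quad (Ed k) c op 0}
    (hy : Orthogonal k y) : y ∈ relD k c op 0 := by
  have hv : ∀ σ : Equiv.Perm (Fin 3), ∀ i, c i = ![op, op, op] (σ i) := fun σ =>
    color_inv (τ := σ⁻¹) (hc _) (hc _) (hc _)
  refine mem_relD_of_orthogonal k (ι := Equiv.Perm (Fin 3))
    (fun τ => treeD k τ n₀₂ n₀₂ (hc _) (hc _) (hc _) (add_zero 0))
    (fun τ => Quad.act τ⁻¹ (hv _) (GenV.e₀₂.r k 0 GenV.e₀₂ - GenV.e₀₂.l k 0 GenV.e₀₂))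
    (fun j => act_mem_relV k _ _ RelV.e_assoc) ?_ ?_ ?_ hy
  · intro i
    simp only [GenV.l_eq, GenV.r_eq, map_sub, act_treeV, LinearMap.sub_apply, pairing_tree,
      ← Int.cast_sub]
    exact cast_ne_zero_of_unit (by revert i; decide)
  · intro i j hij
    simp only [GenV.l_eq, GenV.r_eq, map_sub, act_treeV, LinearMap.sub_apply, pairing_tree,
      ← Int.cast_sub]
    exact cast_eq_zero_of_eq (by revert i j; decide)
  · have h : ∀ τ : Equiv.Perm (Fin 3), treeD k τ n₀₂ n₀₂ (hc _) (hc _) (hc _) (add_zero 0) ∈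
        relD k c op 0 ⊔ Submodule.span k (Set.range fun τ : Equiv.Perm (Fin 3) =>
          treeD k τ n₀₂ n₀₂ (hc _) (hc _) (hc _) (add_zero 0)) := fun τ =>
      Submodule.mem_sup_right (Submodule.subset_span ⟨τ, rfl⟩)
    refine mem_of_treeD_reduced ?_ ?_ ?_ ?_
    · intro τ _ i z μ hx
      exact (not_cl_op hx (hc _)).elim
    · intro τ _ i z μ hx
      exact (not_cl_op hx (hc _)).elim
    · intro τ i z μ hx hy hz hn
      cases μ with
      | n₀₂ => exact h τ
      | n₀₂' =>
        have h' := n_assoc_mem (k := k) (τ * (finRotate 3)⁻¹) hc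
        simp only [inv_mul_cancel_right] at h'
        convert add_mem (Submodule.mem_sup_left h') (h (τ * (finRotate 3)⁻¹)) using 1
        abel
      | n₁₁' => exact (not_cl_op hz (hc _)).elim
    · intro τ i z μ hx
      exact (not_cl_op hx (hc _)).elim

end

end SwissCheese
-- Components with inputs of both colours, empty components, and the equality of `R_{v^!}` with the
-- orthogonal.
namespace SwissCheese

open Operads Color

section
variable {k : Type u} [Field k] {c : Fin 3 → Color} {d : Color} {n : ℤ}

open GenD

/-- The Lie action relation eliminates `𝔫₁₁(𝔩₂ ⊗ id)`. There remain the two iterated actions, one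
for each order of the closed inputs, and each is detected by the action relation of `sc^vor` in that
order. -/
theorem mem_relD_closed_closed_zero (h₀ : c 0 = cl) (h₁ : c 1 = cl) (h₂ : c 2 = op)
    {y : Quad (Ed k) c op 0} (hy : Orthogonal k y) : y ∈ relD k c op 0 := by
  have hop : ∀ j, c j = op → j = 2 := by
    intro j hj
    fin_cases j
    · exact (not_cl_op h₀ hj).elim
    · exact (not_cl_op h₁ hj).elim
    · rfl
  have hv : ∀ j : Fin 2, ∀ i, c i = ![cl, cl, op] (![1, Equiv.swap 0 1] j i) := by
    intro j i
    fin_cases j <;> fin_cases i <;> assumption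
  have t₀ : ∀ j : Fin 2,
      c ((![finRotate 3, Equiv.swap 0 1 * finRotate 3] j : Equiv.Perm (Fin 3)) 0) = cl := by
    intro j
    fin_cases j <;> assumption
  have t₁ : ∀ j : Fin 2,
      c ((![finRotate 3, Equiv.swap 0 1 * finRotate 3] j : Equiv.Perm (Fin 3)) 1) = op := by
    intro j
    fin_cases j <;> assumption
  have t₂ : ∀ j : Fin 2,
      c ((![finRotate 3, Equiv.swap 0 1 * finRotate 3] j : Equiv.Perm (Fin 3)) 2) = cl := by
    intro j
    fin_cases j <;> assumption
  refine mem_relD_of_orthogonal k (ι := Fin 2)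
    (fun j => treeD k (![finRotate 3, Equiv.swap 0 1 * finRotate 3] j) n₁₁' n₁₁ (t₀ j) (t₁ j) (t₂ j)
      (add_zero 0))
    (fun j => Quad.act (![1, Equiv.swap 0 1] j) (hv j)
      (GenV.e₁₁.r k 0 GenV.e₁₁ - GenV.e₁₁.l k 0 GenV.f₂))
    (fun j => act_mem_relV k _ _ RelV.action) ?_ ?_ ?_ hy
  · intro i
    simp only [GenV.l_eq, GenV.r_eq, map_sub, act_treeV, LinearMap.sub_apply, pairing_tree,
      ← Int.cast_sub]
    exact cast_ne_zero_of_unit (by revert i; decide)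
  · intro i j hij
    simp only [GenV.l_eq, GenV.r_eq, map_sub, act_treeV, LinearMap.sub_apply, pairing_tree,
      ← Int.cast_sub]
    exact cast_eq_zero_of_eq (by revert i j; decide)
  · have h : ∀ j : Fin 2, treeD k (![finRotate 3, Equiv.swap 0 1 * finRotate 3] j) n₁₁' n₁₁
        (t₀ j) (t₁ j) (t₂ j) (add_zero 0) ∈
        relD k c op 0 ⊔ Submodule.span k (Set.range fun j : Fin 2 =>
          treeD k (![finRotate 3, Equiv.swap 0 1 * finRotate 3] j) n₁₁' n₁₁ (t₀ j) (t₁ j) (t₂ j)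
            (add_zero 0)) := fun j =>
      Submodule.mem_sup_right (Submodule.subset_span ⟨j, rfl⟩)
    refine mem_of_treeD_reduced ?_ ?_ ?_ ?_
    · intro τ hτ i z μ hx hy hz hn
      cases μ with
      | n₁₁ =>
        rcases hτ with rfl | rfl | rfl
        · have h' := lie_action_mem (k := k) 1 hx hy hz
          simp only [one_mul] at h'
          convert sub_mem (add_mem (Submodule.mem_sup_left h') (h 0)) (h 1) using 1
          simp only [Matrix.cons_val_zero, Matrix.cons_val_one]
          abel
        · exact (not_cl_op h₀ hz).elim
        · exact (not_cl_op h₁ hz).elim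
    · intro τ hτ i z μ hx hy hz hn
      cases μ
      omega
    -- Both leaves of `𝔫₀₂` are open, but there is only one open input.
    · intro τ i z μ hx hy
      have h' := τ.injective ((hop _ hx).trans (hop _ hy).symm)
      exact absurd h' (by decide)
    · intro τ i z μ hx hy hz hn
      cases μ with
      | n₀₂ =>
        have h' := τ.injective ((hop _ hy).trans (hop _ hz).symm)
        exact absurd h' (by decide)
      | n₀₂' =>
        have h' := τ.injective ((hop _ hy).trans (hop _ hz).symm)
        exact absurd h' (by decide)
      | n₁₁' =>
        have h' := hop _ hy
        have h'' : τ = finRotate 3 ∨ τ = Equiv.swap 0 1 * finRotate 3 := by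
          clear hx hy hz
          revert τ
          decide
        rcases h'' with rfl | rfl
        · exact h 0
        · exact h 1

/-- With open output and degree `-1` the only trees are those with `𝔫₁₁` at the root and `𝔠₂` above
it, and all of them are relations; this matches the absence of relators of `sc^vor` of degree `1`
with open output. -/
theorem mem_relD_neg_one (y : Quad (Ed k) c op (-1)) : y ∈ relD k c op (-1) := by
  refine mem_of_treeD_reduced ?_ ?_ ?_ ?_ y
  · intro τ hτ i z μ hx hy hz hn
    cases μ
    omega
  · intro τ hτ i z μ hx hy hz hn
    cases μ with
    | n₁₁ => exact kills_product_mem τ hx hy hz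
  · intro τ i z μ hx hy hz hn
    cases μ <;> omega
  · intro τ i z μ hx hy hz hn
    cases μ <;> omega

/-- The derivation relation eliminates `𝔫₁₁(id ⊗ 𝔫₀₂)`. There remain four trees: the closed input
acts on one of the two open inputs, and the result multiplies the other one from the left or from
the right. -/
theorem mem_relD_closed_open (h₀ : c 0 = cl) (h₁ : c 1 = op) (h₂ : c 2 = op)
    {y : Quad (Ed k) c op 0} (hy : Orthogonal k y) : y ∈ relD k c op 0 := by
  have hcl : ∀ j, c j = cl → j = 0 := by
    intro j hj
    fin_cases j
    · rfl
    · exact (not_cl_op hj h₁).elim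
    · exact (not_cl_op hj h₂).elim
  have hop : ∀ j, c j = op → j ≠ 0 := by
    rintro j hj rfl
    exact not_cl_op h₀ hj
  have hv : ∀ j : Fin 2, ∀ i,
      c i = ![cl, op, op] ((![1, Equiv.swap 0 1 * finRotate 3] j : Equiv.Perm (Fin 3)) i) := by
    intro j i
    fin_cases j <;> fin_cases i <;> assumption
  have t₀ : ∀ j : Fin 2,
      c ((![1, Equiv.swap 0 1 * finRotate 3] j : Equiv.Perm (Fin 3)) 0) = cl := by
    intro j
    fin_cases j <;> assumption
  have t₁ : ∀ j : Fin 2,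
      c ((![1, Equiv.swap 0 1 * finRotate 3] j : Equiv.Perm (Fin 3)) 1) = op := by
    intro j
    fin_cases j <;> assumption
  have t₂ : ∀ j : Fin 2,
      c ((![1, Equiv.swap 0 1 * finRotate 3] j : Equiv.Perm (Fin 3)) 2) = op := by
    intro j
    fin_cases j <;> assumption
  refine mem_relD_of_orthogonal k (ι := Fin 2 ⊕ Fin 2)
    (Sum.elim
      (fun j => treeD k (![1, Equiv.swap 0 1 * finRotate 3] j) n₀₂ n₁₁ (t₀ j) (t₁ j) (t₂ j)
        (add_zero 0))
      (fun j => treeD k (![1, Equiv.swap 0 1 * finRotate 3] j) n₀₂' n₁₁ (t₀ j) (t₁ j) (t₂ j)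
        (add_zero 0)))
    (Sum.elim
      (fun j => Quad.act (![1, Equiv.swap 0 1 * finRotate 3] j) (hv j)
        (GenV.e₁₁.r k 0 GenV.e₀₂ - GenV.e₀₂.l k 0 GenV.e₁₁))
      -- The sum of the two relations is `e₁₁(id ⊗ e₀₂) = e₀₂(id ⊗ e₁₁) · (213)`: the terms `e₀₂(e₁₁
      -- ⊗ id)`, which pair with the trees of the first family, cancel. In the surviving term the
      -- closed input acts on the second factor of the product, which accounts for the index `1 -
      -- j`.
      (fun j => Quad.act (![1, Equiv.swap 0 1 * finRotate 3] (1 - j)) (hv (1 - j))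
        (GenV.e₁₁.r k 0 GenV.e₀₂ - GenV.e₀₂.l k 0 GenV.e₁₁) +
        Quad.act (![1, Equiv.swap 0 1 * finRotate 3] (1 - j)) (hv (1 - j))
        (GenV.e₀₂.l k 0 GenV.e₁₁ - act213 (GenV.e₀₂.r k 0 GenV.e₁₁))))
    ?_ ?_ ?_ ?_ hy
  · rintro (j | j)
    · exact act_mem_relV k _ _ RelV.action_mul_left
    · exact add_mem (act_mem_relV k _ _ RelV.action_mul_left)
        (act_mem_relV k _ _ RelV.action_mul_right)
  · rintro (i | i) <;>
      simp only [Sum.elim_inl, Sum.elim_inr, GenV.l_eq, GenV.r_eq, act213, map_sub, act_treeV,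
        map_add, LinearMap.sub_apply, LinearMap.add_apply, pairing_tree, ← Int.cast_sub,
        ← Int.cast_add] <;>
      exact cast_ne_zero_of_unit (by revert i; decide)
  · rintro (i | i) (j | j) hij <;>
      simp only [Sum.elim_inl, Sum.elim_inr, GenV.l_eq, GenV.r_eq, act213, map_sub, act_treeV,
        map_add, LinearMap.sub_apply, LinearMap.add_apply, pairing_tree, ← Int.cast_sub,
        ← Int.cast_add] <;>
      exact cast_eq_zero_of_eq (by revert i j; decide)
  · set N := Sum.elim
      (fun j => treeD k (![1, Equiv.swap 0 1 * finRotate 3] j) n₀₂ n₁₁ (t₀ j) (t₁ j) (t₂ j)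
        (add_zero 0))
      (fun j => treeD k (![1, Equiv.swap 0 1 * finRotate 3] j) n₀₂' n₁₁ (t₀ j) (t₁ j) (t₂ j)
        (add_zero 0)) with hN
    have h : ∀ j, N j ∈ relD k c op 0 ⊔ Submodule.span k (Set.range N) := fun j =>
      Submodule.mem_sup_right (Submodule.subset_span ⟨j, rfl⟩)
    refine mem_of_treeD_reduced ?_ ?_ ?_ ?_
    · intro τ _ i z μ hx hy
      exact absurd (τ.injective ((hcl _ hx).trans (hcl _ hy).symm)) (by decide)
    · intro τ _ i z μ hx hy
      exact absurd (τ.injective ((hcl _ hx).trans (hcl _ hy).symm)) (by decide)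
    · intro τ i z μ hx hy hz hn
      have hx' := hop _ hx
      have hy' := hop _ hy
      have key : τ = finRotate 3 ∨ τ = Equiv.swap 0 1 * finRotate 3 * finRotate 3 := by
        clear hx hy hz
        revert τ
        decide
      cases μ with
      | n₀₂ => rcases key with rfl | rfl <;> exact (not_cl_op h₀ hz).elim
      | n₀₂' => rcases key with rfl | rfl <;> exact (not_cl_op h₀ hz).elim
      | n₁₁' =>
        rcases key with rfl | rfl
        · have h' := derivation_mem (k := k) 1 h₀ h₁ h₂
          simp only [one_mul] at h'
          convert add_mem (add_mem (Submodule.mem_sup_left h') (h (Sum.inl 0)))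
            (h (Sum.inr 1)) using 1
          simp only [hN, Sum.elim_inl, Sum.elim_inr, Matrix.cons_val_zero, Matrix.cons_val_one]
          abel
        · have h' := derivation_mem (k := k) (Equiv.swap 0 1 * finRotate 3) h₀ h₂ h₁
          have hs : (Equiv.swap 0 1 * finRotate 3 * (Equiv.swap 0 1 * finRotate 3) :
            Equiv.Perm (Fin 3)) = 1 := by decide
          simp only [hs] at h'
          convert add_mem (add_mem (Submodule.mem_sup_left h') (h (Sum.inl 1)))
            (h (Sum.inr 0)) using 1
          simp only [hN, Sum.elim_inl, Sum.elim_inr, Matrix.cons_val_zero, Matrix.cons_val_one]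
          abel
    · intro τ i z μ hx hy hz hn
      have hx' := hcl _ hx
      have key : τ = 1 ∨ τ = Equiv.swap 0 1 * finRotate 3 := by
        clear hx hy hz
        revert τ
        decide
      cases μ with
      | n₀₂ =>
        rcases key with rfl | rfl
        · exact h (Sum.inl 0)
        · exact h (Sum.inl 1)
      | n₀₂' =>
        rcases key with rfl | rfl
        · exact h (Sum.inr 0)
        · exact h (Sum.inr 1)
      | n₁₁' => exact absurd (τ.injective ((hcl _ hx).trans (hcl _ hz).symm)) (by decide)

/-- Every colouring can be sorted. -/
theorem exists_sorted (c : Fin 3 → Color) : ∃ σ : Equiv.Perm (Fin 3),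
    (∀ i, c (σ i) = cl) ∨ (c (σ 0) = cl ∧ c (σ 1) = cl ∧ c (σ 2) = op) ∨
      (c (σ 0) = cl ∧ c (σ 1) = op ∧ c (σ 2) = op) ∨ (∀ i, c (σ i) = op) := by
  rcases h₀ : c 0 with _ | _ <;> rcases h₁ : c 1 with _ | _ <;> rcases h₂ : c 2 with _ | _
  · exact ⟨1, Or.inl fun i => by fin_cases i <;> assumption⟩
  · exact ⟨1, Or.inr (Or.inl ⟨h₀, h₁, h₂⟩)⟩
  · exact ⟨Equiv.swap 1 2, Or.inr (Or.inl ⟨h₀, h₂, h₁⟩)⟩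
  · exact ⟨1, Or.inr (Or.inr (Or.inl ⟨h₀, h₁, h₂⟩))⟩
  · exact ⟨finRotate 3, Or.inr (Or.inl ⟨h₁, h₂, h₀⟩)⟩
  · exact ⟨Equiv.swap 0 1, Or.inr (Or.inr (Or.inl ⟨h₁, h₀, h₂⟩))⟩
  · exact ⟨(finRotate 3)⁻¹, Or.inr (Or.inr (Or.inl ⟨h₂, h₀, h₁⟩))⟩
  · exact ⟨1, Or.inr (Or.inr (Or.inr fun i => by fin_cases i <;> assumption))⟩

/-- A closed output has closed inputs. -/
theorem mem_relD_of_open_input {j : Fin 3} (hj : c j = op) (y : Quad (Ed k) c cl n) :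
    y ∈ relD k c cl n := by
  refine mem_of_treeD_reduced ?_ ?_ ?_ ?_ y
  all_goals
    intro τ
    obtain ⟨j, rfl⟩ := τ.surjective j
  · intro _ i z μ hx hy hz
    cases μ <;> fin_cases j <;> exact (not_cl_op (by assumption) hj).elim
  · intro _ i z μ hx hy hz
    cases μ <;> fin_cases j <;> exact (not_cl_op (by assumption) hj).elim
  · intro i z μ
    cases μ
  · intro i z μ
    cases μ

/-- An open output has an open input. -/
theorem mem_relD_of_closed_inputs (hc : ∀ i, c i = cl) (y : Quad (Ed k) c op n) :
    y ∈ relD k c op n := by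
  refine mem_of_treeD_reduced ?_ ?_ ?_ ?_ y
  · intro τ _ i z μ _ _ hz
    cases μ
    exact (not_cl_op (hc _) hz).elim
  · intro τ _ i z μ _ _ hz
    cases μ
    exact (not_cl_op (hc _) hz).elim
  · intro τ i z μ hx
    exact (not_cl_op (hc _) hx).elim
  · intro τ i z μ _ hy
    exact (not_cl_op (hc _) hy).elim

/-- There are no trees in other degrees. -/
theorem mem_relD_of_degree (h₀ : n ≠ 0) (h₁ : n ≠ -1) (h₂ : n ≠ -2) (y : Quad (Ed k) c d n) :
    y ∈ relD k c d n := by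
  refine mem_of_treeD_reduced ?_ ?_ ?_ ?_ y
  · intro τ _ i z μ hx hy hz hn
    cases μ <;> omega
  · intro τ _ i z μ hx hy hz hn
    cases μ <;> omega
  · intro τ i z μ hx hy hz hn
    cases μ <;> omega
  · intro τ i z μ hx hy hz hn
    cases μ <;> omega

/-- There is no tree of degree `-2` with an open output. -/
theorem mem_relD_neg_two (y : Quad (Ed k) c op (-2)) : y ∈ relD k c op (-2) := by
  refine mem_of_treeD_reduced ?_ ?_ ?_ ?_ y
  · intro τ _ i z μ hx hy hz hn
    cases μ
    omega
  · intro τ _ i z μ hx hy hz hn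
    cases μ
    omega
  · intro τ i z μ hx hy hz hn
    cases μ <;> omega
  · intro τ i z μ hx hy hz hn
    cases μ <;> omega

theorem mem_relD_of_sorted (hc : (∀ i, c i = cl) ∨ (c 0 = cl ∧ c 1 = cl ∧ c 2 = op) ∨
    (c 0 = cl ∧ c 1 = op ∧ c 2 = op) ∨ (∀ i, c i = op)) {y : Quad (Ed k) c d n}
    (hy : Orthogonal k y) : y ∈ relD k c d n := by
  by_cases hn₀ : n = 0
  · subst hn₀
    cases d with
    | cl =>
      rcases hc with h | ⟨h₀, h₁, h₂⟩ | ⟨h₀, h₁, h₂⟩ | h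
      · exact mem_relD_closed_zero h hy
      · exact mem_relD_of_open_input h₂ y
      · exact mem_relD_of_open_input h₂ y
      · exact mem_relD_of_open_input (h 0) y
    | op =>
      rcases hc with h | ⟨h₀, h₁, h₂⟩ | ⟨h₀, h₁, h₂⟩ | h
      · exact mem_relD_of_closed_inputs h y
      · exact mem_relD_closed_closed_zero h₀ h₁ h₂ hy
      · exact mem_relD_closed_open h₀ h₁ h₂ hy
      · exact mem_relD_open h hy
  by_cases hn₁ : n = -1
  · subst hn₁
    cases d with
    | cl =>
      rcases hc with h | ⟨h₀, h₁, h₂⟩ | ⟨h₀, h₁, h₂⟩ | h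
      · exact mem_relD_closed_neg_one h hy
      · exact mem_relD_of_open_input h₂ y
      · exact mem_relD_of_open_input h₂ y
      · exact mem_relD_of_open_input (h 0) y
    | op => exact mem_relD_neg_one y
  by_cases hn₂ : n = -2
  · subst hn₂
    cases d with
    | cl =>
      rcases hc with h | ⟨h₀, h₁, h₂⟩ | ⟨h₀, h₁, h₂⟩ | h
      · exact mem_relD_closed_neg_two h hy
      · exact mem_relD_of_open_input h₂ y
      · exact mem_relD_of_open_input h₂ y
      · exact mem_relD_of_open_input (h 0) y
    | op => exact mem_relD_neg_two y
  exact mem_relD_of_degree hn₀ hn₁ hn₂ y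

theorem act_mem_relD_of_mem {c' : Fin 3 → Color} (σ : Equiv.Perm (Fin 3))
    (h : ∀ i, c' i = c (σ i)) {y : Quad (Ed k) c d n} (hy : y ∈ relD k c d n) :
    Quad.act σ h y ∈ relD k c' d n :=
  (scvorDual k).act_mem σ h hy

/-- The relations `R_{v^!}` are the orthogonal of `R_v`. -/
theorem mem_relD_iff {y : Quad (Ed k) c d n} : y ∈ relD k c d n ↔ Orthogonal k y := by
  refine ⟨orthogonal_of_mem k, fun hy => ?_⟩
  -- Orthogonality and membership are both stable under `S₃`, so the colouring may be sorted and the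
  -- result transported back.
  obtain ⟨σ, hσ⟩ := exists_sorted c
  have h := mem_relD_of_sorted (c := fun i => c (σ i)) hσ (hy.act k σ fun _ => rfl)
  have h' := act_mem_relD_of_mem σ⁻¹ (c' := c) (fun i => by simp) h
  have e : Quad.act σ⁻¹ (c := fun i => c (σ i)) (c' := c) (fun i => by simp)
      (Quad.act σ (fun _ => rfl) y) = y :=
    (Quad.act_act _ _ _ _ _).trans (Quad.act_of_eq_one (mul_inv_cancel σ) _ y)
  rwa [e] at h'

end

end SwissCheese
-- Induction over homogeneous elements, and the isomorphism with the Koszul dual operad.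
namespace Operads

theorem DGVec.homogeneous_induction {k : Type u} [Field k] (H : DGVec.{u, w} k) {p : H → Prop}
    (hom : ∀ n, ∀ x ∈ H.gr n, p x) (zero : p 0) (add : ∀ x y, p x → p y → p (x + y)) (x : H) :
    p x := by
  induction H.mem_closure_homogeneous x using AddSubmonoid.closure_induction with
  | mem x hx => exact hom _ x hx.choose_spec
  | zero => exact zero
  | add x y _ _ hx hy => exact add x y hx hy

theorem neg_one_zpow_congr {k : Type u} [Field k] {i j : ℤ} (h : (i : ZMod 2) = j) :
    (-1 : k) ^ i = (-1 : k) ^ j := by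
  rw [neg_one_zpow_eq_paritySign, neg_one_zpow_eq_paritySign, h]

theorem quadEval_congr {k : Type u} [Field k] {C : Type} {V : C → DGVec.{u, w} k}
    {E : BinSMod k C} (A : BinAction V E) {c : Fin 3 → C} {d : C} {n : ℤ} {l : List (Fin 3)}
    (hl : IsEnum l) {a a' : ∀ x, V (c x)} {G G' : Fin 3 → ℤ} (haa' : a = a') (hGG' : G = G')
    (ha : ∀ x, a x ∈ (V (c x)).gr (G x)) (ha' : ∀ x, a' x ∈ (V (c x)).gr (G' x))
    (q : Quad E c d n) : quadEval A hl ha q = quadEval A hl ha' q := by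
  subst haa' hGG'
  rfl

end Operads

namespace SwissCheese

open Operads Color

section
variable (k : Type u) [Field k]

theorem map_toDual_mem {c : Fin 3 → Color} {d : Color} {n : ℤ} (q : Quad (Ed k) c d n)
    (hq : q ∈ (scvorDual k).R c d n) : Quad.map (toDual k) q ∈ (scvor k).koszulDual.R c d n :=
  orthogonal_of_mem k hq

theorem map_ofDual_mem {c : Fin 3 → Color} {d : Color} {n : ℤ} (q : Quad (Ev k).dual c d n)
    (hq : q ∈ (scvor k).koszulDual.R c d n) : Quad.map (ofDual k) q ∈ (scvorDual k).R c d n := by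
  refine mem_relD_iff.2 fun m x hx => ?_
  rw [Quad.map_map_of_inverse (toDual_ofDual k)]
  exact hq m x hx

/-- The presentation of the Koszul dual operad of `sc^vor`. -/
noncomputable def dualIso :
    ColoredOperad.Iso (scvorDual k).operad (scvor k).koszulDual.operad :=
  BinaryQuadraticData.iso (Q := scvorDual k) (Q' := (scvor k).koszulDual) (toDual k) (ofDual k)
    (ofDual_toDual k) (toDual_ofDual k) (map_toDual_mem k) (map_ofDual_mem k)

/-- The inverse of `dualIso`. -/
noncomputable def dualIsoInv :
    ColoredOperad.Iso (scvor k).koszulDual.operad (scvorDual k).operad :=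
  BinaryQuadraticData.iso (Q := (scvor k).koszulDual) (Q' := scvorDual k) (ofDual k) (toDual k)
    (toDual_ofDual k) (ofDual_toDual k) (map_ofDual_mem k) (map_toDual_mem k)

theorem dualIso_gen {a b d : Color} {n : ℤ} (e : (Ed k).M n a b d) :
    (dualIso k).equiv ((scvorDual k).gen e) = (scvor k).koszulDual.gen ((toDual k).map e) :=
  BinaryQuadraticData.iso_gen (Q := scvorDual k) (Q' := (scvor k).koszulDual) (toDual k) (ofDual k)
    (ofDual_toDual k) (toDual_ofDual k) (map_toDual_mem k) (map_ofDual_mem k) e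

theorem dualIsoInv_gen {a b d : Color} {n : ℤ} (e : (Ed k).M n a b d) :
    (dualIsoInv k).equiv ((scvor k).koszulDual.gen ((toDual k).map e)) = (scvorDual k).gen e :=
  (BinaryQuadraticData.iso_gen (Q := (scvor k).koszulDual) (Q' := scvorDual k) (ofDual k)
    (toDual k) (toDual_ofDual k) (ofDual_toDual k) (map_ofDual_mem k) (map_toDual_mem k)
    ((toDual k).map e)).trans (congrArg (scvorDual k).gen (ofDual_toDual k e))

end

section
variable {k : Type u} [Field k] {V : Color → DGVec.{u, w} k}

/-- The relators vanish on `V`. -/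
def SatisfiesRelD (A : BinAction V (Ed k)) : Prop :=
  ∀ {c : Fin 3 → Color} {d : Color} {n : ℤ} {q : Quad (Ed k) c d n}, RelD k c d n q →
    ∀ {v : ∀ x, V (c x)} {G : Fin 3 → ℤ} (hv : ∀ x, v x ∈ (V (c x)).gr (G x)),
      quadEval A isEnum_fin_three hv q = 0

theorem SatisfiesRelD.tripleEval {A : BinAction V (Ed k)} (hA : SatisfiesRelD A)
    {a b c d : Color} {n : ℤ} {q : Quad (Ed k) ![a, b, c] d n} (hq : RelD k ![a, b, c] d n q)
    {x : V a} {y : V b} {z : V c} {i j l : ℤ} (hx : x ∈ (V a).gr i) (hy : y ∈ (V b).gr j)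
    (hz : z ∈ (V c).gr l) : tripleEval A hx hy hz q = 0 :=
  hA hq (tripleInputs_mem hx hy hz)

theorem quadEval_eq_zero_of_triple (A : BinAction V (Ed k)) {a b c d : Color} {n : ℤ}
    {q : Quad (Ed k) ![a, b, c] d n}
    (h : ∀ {x : V a} {y : V b} {z : V c} {i j l : ℤ} (hx : x ∈ (V a).gr i) (hy : y ∈ (V b).gr j)
      (hz : z ∈ (V c).gr l), tripleEval A hx hy hz q = 0)
    {v : ∀ x, V (![a, b, c] x)} {G : Fin 3 → ℤ} (hv : ∀ x, v x ∈ (V (![a, b, c] x)).gr (G x)) :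
    quadEval A isEnum_fin_three hv q = 0 := by
  have hv' : v = tripleInputs (V := V) (v 0) (v 1) (v 2) := by
    funext i
    fin_cases i <;> rfl
  have hG : G = ![G 0, G 1, G 2] := by
    funext i
    fin_cases i <;> rfl
  have h₀ : v 0 ∈ (V a).gr (G 0) := hv 0
  have h₁ : v 1 ∈ (V b).gr (G 1) := hv 1
  have h₂ : v 2 ∈ (V c).gr (G 2) := hv 2
  exact (quadEval_congr A isEnum_fin_three hv' hG hv (tripleInputs_mem h₀ h₁ h₂) q).trans
    (h h₀ h₁ h₂)

theorem satisfiesRelD_toBinAction (B : OperadAlgebra (scvorDual k).operad V) :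
    SatisfiesRelD (A := B.toBinAction) := by
  intro c d n q hq v G hv
  have h : q ∈ (scvorDual k).R c d n := by
    have h := act_mem_relD k (c := c) 1 (fun _ => rfl) hq
    have e := Quad.act_of_eq_one (σ := 1) rfl (fun _ => rfl) q
    exact e ▸ h
  exact B.quadEval_eq_zero h isEnum_fin_three hv

end

end SwissCheese
-- From an algebra over the dual presentation to the four operations.
namespace SwissCheese

open Operads Color

section
variable {k : Type u} [Field k] {V : Color → DGVec.{u, w} k} (A : BinAction V (Ed k))

theorem op_l₂_swap {i j : ℤ} {x y : V cl} (hx : x ∈ (V cl).gr i) (hy : y ∈ (V cl).gr j) :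
    A.op (GenD.l₂.el k) x y = -((-1 : k) ^ (i * j) • A.op (GenD.l₂.el k) y x) := by
  have h := A.op_swap (GenD.l₂.el k) hy hx
  rw [Ed_swap_el] at h
  simp only [GenD.sign, GenD.swap, Units.val_neg, Units.val_one, Int.cast_neg, Int.cast_one,
    neg_smul, one_smul, map_neg, LinearMap.neg_apply] at h
  rw [mul_comm i j, ← h, neg_neg]

theorem op_c₂_swap {i j : ℤ} {x y : V cl} (hx : x ∈ (V cl).gr i) (hy : y ∈ (V cl).gr j) :
    A.op (GenD.c₂.el k) x y = -((-1 : k) ^ (i * j) • A.op (GenD.c₂.el k) y x) := by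
  have h := A.op_swap (GenD.c₂.el k) hy hx
  rw [Ed_swap_el] at h
  simp only [GenD.sign, GenD.swap, Units.val_neg, Units.val_one, Int.cast_neg, Int.cast_one,
    neg_smul, one_smul, map_neg, LinearMap.neg_apply] at h
  rw [mul_comm i j, ← h, neg_neg]

theorem op_n₀₂' {i j : ℤ} {x y : V op} (hx : x ∈ (V op).gr i) (hy : y ∈ (V op).gr j) :
    A.op (GenD.n₀₂'.el k) x y = (-1 : k) ^ (i * j) • A.op (GenD.n₀₂.el k) y x := by
  have h := A.op_swap (GenD.n₀₂.el k) hy hx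
  rw [Ed_swap_el] at h
  simp only [GenD.sign, GenD.swap, Units.val_one, Int.cast_one, one_smul] at h
  rw [mul_comm i j, ← h]

theorem op_n₁₁' {i j : ℤ} {x : V op} {y : V cl} (hx : x ∈ (V op).gr i) (hy : y ∈ (V cl).gr j) :
    A.op (GenD.n₁₁'.el k) x y = (-1 : k) ^ (i * j) • A.op (GenD.n₁₁.el k) y x := by
  have h := A.op_swap (GenD.n₁₁.el k) hy hx
  rw [Ed_swap_el] at h
  simp only [GenD.sign, GenD.swap, Units.val_one, Int.cast_one, one_smul] at h
  rw [mul_comm i j, ← h]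

section
variable {a b c d e : Color} {n m m' : ℤ} {x : V a} {y : V b} {z : V c} {i j l : ℤ}
    (hx : x ∈ (V a).gr i) (hy : y ∈ (V b).gr j) (hz : z ∈ (V c).gr l)

theorem tripleEval_l (μ : GenD m e c d) (ν : GenD m' a b e) (hn : m + m' = n) :
    tripleEval A hx hy hz (GenD.l k n μ ν hn) = A.op (μ.el k) (A.op (ν.el k) x y) z :=
  tripleEval_left A hx hy hz _ _ hn

theorem tripleEval_r (μ : GenD m a e d) (ν : GenD m' b c e) (hn : m + m' = n) :
    tripleEval A hx hy hz (GenD.r k n μ ν hn) =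
      (-1 : k) ^ (m' * i) • A.op (μ.el k) x (A.op (ν.el k) y z) :=
  tripleEval_right A hx hy hz _ _ hn

theorem tripleEval_act213 (q : Quad (Ed k) ![b, a, c] d n) :
    tripleEval A hx hy hz (act213 q) = (-1 : k) ^ (i * j) • tripleEval A hy hx hz q :=
  tripleEval_act_swap A hx hy hz _ q

theorem tripleEval_act231 (q : Quad (Ed k) ![c, a, b] d n) :
    tripleEval A hx hy hz (act231 q) = (-1 : k) ^ (l * (i + j)) • tripleEval A hz hx hy q :=
  tripleEval_act_rotate A hx hy hz _ q

theorem tripleEval_act312 (q : Quad (Ed k) ![b, c, a] d n) :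
    tripleEval A hx hy hz (act312 q) = (-1 : k) ^ (i * (j + l)) • tripleEval A hy hz hx q :=
  tripleEval_act_rotate_inv A hx hy hz _ q

end

variable {A}

/-- Each identity is a relator evaluated on homogeneous inputs. Arguments that are not assumed
homogeneous are reached by additivity, since their degrees do not occur in the signs. -/
theorem isLambdaGer_of_satisfies (hA : SatisfiesRelD A) :
    IsLambdaGer (V cl) (A.op (GenD.l₂.el k)) (A.op (GenD.c₂.el k)) where
  bracket_mem hx hy := by
    have h := A.op_mem (GenD.l₂.el k) hx hy
    rwa [zero_add] at h
  times_mem {i j x y} hx hy := by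
    have h := A.op_mem (GenD.c₂.el k) hx hy
    rwa [show -1 + (i + j) = i + j - 1 by ring] at h
  bracket_d y hx := by
    have h := A.op_d (GenD.l₂.el k) y hx
    rwa [zpow_zero, one_smul] at h
  times_d y hx := by
    have h := A.op_d (GenD.c₂.el k) y hx
    rwa [show (-1 : k) ^ (-1 : ℤ) = -1 by norm_num, neg_one_smul] at h
  bracket_antisymm := op_l₂_swap A
  times_antisymm := op_c₂_swap A
  jacobi hx hy hz := by
    have h := hA.tripleEval RelD.l_jacobi hx hy hz
    simpa only [map_add, tripleEval_l, tripleEval_act231, tripleEval_act312] using h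
  times_assoc {i x} y z hx := by
    induction y using (V cl).homogeneous_induction with
    | zero => simp
    | add y y' hy hy' => simp only [map_add, LinearMap.add_apply, smul_add, hy, hy', neg_add]
    | hom j y hy =>
      induction z using (V cl).homogeneous_induction with
      | zero => simp
      | add z z' hz hz' => simp only [map_add, smul_add, hz, hz', neg_add]
      | hom l z hz =>
        have h := hA.tripleEval RelD.c_assoc hx hy hz
        simp only [map_add, tripleEval_l, tripleEval_r] at h
        -- The exponent is `|𝔠₂||x| = -i`, which has the parity of `i`.
        rw [neg_one_zpow_congr (j := i) (by push_cast; grind)] at h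
        exact eq_neg_of_add_eq_zero_left h
  leibniz {i j x y} z hx hy := by
    induction z using (V cl).homogeneous_induction with
    | zero => simp
    | add z z' hz hz' =>
      simp only [map_add, smul_add, hz, hz']
      abel
    | hom l z hz =>
      have h := hA.tripleEval RelD.leibniz hx hy hz
      simp only [map_add, map_sub, tripleEval_l, tripleEval_r, tripleEval_act213, zero_mul,
        zpow_zero, one_smul] at h
      rw [neg_one_zpow_congr (i := -1 * i) (j := i) (by push_cast; grind)] at h
      exact sub_eq_zero.1 h

theorem isAssoc_of_satisfies (hA : SatisfiesRelD A) :
    IsAssoc (V op) (A.op (GenD.n₀₂.el k)) where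
  mul_mem hx hy := by
    have h := A.op_mem (GenD.n₀₂.el k) hx hy
    rwa [zero_add] at h
  mul_d y hx := by
    have h := A.op_d (GenD.n₀₂.el k) y hx
    rwa [zpow_zero, one_smul] at h
  assoc x y z := by
    induction x using (V op).homogeneous_induction with
    | zero => simp
    | add x x' hx hx' => simp only [map_add, LinearMap.add_apply, hx, hx']
    | hom i x hx =>
      induction y using (V op).homogeneous_induction with
      | zero => simp
      | add y y' hy hy' => simp only [map_add, LinearMap.add_apply, hy, hy']
      | hom j y hy =>
        induction z using (V op).homogeneous_induction with
        | zero => simp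
        | add z z' hz hz' => simp only [map_add, hz, hz']
        | hom l z hz =>
          have h := hA.tripleEval RelD.n_assoc hx hy hz
          simp only [map_sub, tripleEval_l, tripleEval_r, zero_mul, zpow_zero, one_smul] at h
          exact (sub_eq_zero.1 h).symm

/-- The operations given by an action of the generators that satisfies the relations. -/
noncomputable def dualTriple (hA : SatisfiesRelD A) : DualTriple (V cl) (V op) where
  bracket := A.op (GenD.l₂.el k)
  times := A.op (GenD.c₂.el k)
  mul := A.op (GenD.n₀₂.el k)
  ρ := A.op (GenD.n₁₁.el k)
  isLambdaGer := isLambdaGer_of_satisfies hA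
  isAssoc := isAssoc_of_satisfies hA
  ρ_mem hx hy := by
    have h := A.op_mem (GenD.n₁₁.el k) hx hy
    rwa [zero_add] at h
  ρ_d y hx := by
    have h := A.op_d (GenD.n₁₁.el k) y hx
    rwa [zpow_zero, one_smul] at h
  ρ_bracket {i j x y} z hx hy := by
    induction z using (V op).homogeneous_induction with
    | zero => simp
    | add z z' hz hz' =>
      simp only [map_add, smul_add, hz, hz']
      abel
    | hom l z hz =>
      have h := hA.tripleEval RelD.lie_action hx hy hz
      simp only [map_sub, tripleEval_l, tripleEval_r, tripleEval_act213, zero_mul,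
        zpow_zero, one_smul] at h
      exact sub_eq_zero.1 h
  ρ_mul {i j x y} z hx hy := by
    induction z using (V op).homogeneous_induction with
    | zero => simp
    | add z z' hz hz' =>
      simp only [map_add, smul_add, hz, hz']
      abel
    | hom l z hz =>
      have h := hA.tripleEval RelD.derivation hx hy hz
      simp only [map_sub, map_add, tripleEval_l, tripleEval_r, tripleEval_act213, zero_mul,
        zpow_zero, one_smul] at h
      rw [mul_comm j i]
      exact sub_eq_zero.1 h
  ρ_times x y z := by
    induction x using (V cl).homogeneous_induction with
    | zero => simp
    | add x x' hx hx' => simp only [map_add, LinearMap.add_apply, hx, hx', add_zero]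
    | hom i x hx =>
      induction y using (V cl).homogeneous_induction with
      | zero => simp
      | add y y' hy hy' => simp only [map_add, LinearMap.add_apply, hy, hy', add_zero]
      | hom j y hy =>
        induction z using (V op).homogeneous_induction with
        | zero => simp
        | add z z' hz hz' => simp only [map_add, hz, hz', add_zero]
        | hom l z hz =>
          have h := hA.tripleEval RelD.kills_product hx hy hz
          rwa [tripleEval_l] at h

end

end SwissCheese
-- From the four operations to an algebra.
namespace Operads

/-- The bilinear map `(x, y) ↦ (-1)^{|x||y|} f(y, x)`. -/
noncomputable def koszulFlip {k : Type u} [Field k] {H A W : DGVec.{u, w} k}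
    (f : H →ₗ[k] A →ₗ[k] W) : A →ₗ[k] H →ₗ[k] W :=
  -- An even `x` gives no sign; an odd `x` gives the sign of `y`, which is the even projection minus
  -- the odd one. This makes the flip bilinear on all inputs.
  f.flip.compl₁₂ (A.parityProj 0) LinearMap.id +
    f.flip.compl₁₂ (A.parityProj 1) (H.parityProj 0 - H.parityProj 1)

theorem koszulFlip_apply {k : Type u} [Field k] {H A W : DGVec.{u, w} k} (f : H →ₗ[k] A →ₗ[k] W)
    {i j : ℤ} {x : A} {y : H} (hx : x ∈ A.gr i) (hy : y ∈ H.gr j) :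
    koszulFlip f x y = (-1 : k) ^ (i * j) • f y x := by
  rw [koszulFlip, LinearMap.add_apply, LinearMap.add_apply, LinearMap.compl₁₂_apply,
    LinearMap.compl₁₂_apply, DGVec.parityProj_apply _ hx, DGVec.parityProj_apply _ hx,
    LinearMap.sub_apply, DGVec.parityProj_apply _ hy, DGVec.parityProj_apply _ hy,
    neg_one_zpow_eq_paritySign, Int.cast_mul]
  have h : ∀ t : ZMod 2, t = 0 ∨ t = 1 := by decide
  rcases h i with hi | hi <;> rcases h j with hj | hj <;> simp [paritySign, hi, hj]

/-- The two terms of the Leibniz rule trade places. Their signs agree because `ij + j ≡ (i - 1)j`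
and `ij ≡ i + i(j - 1)` modulo two. -/
theorem koszulFlip_d {k : Type u} [Field k] {H A : DGVec.{u, w} k} (f : H →ₗ[k] A →ₗ[k] A)
    (hf : ∀ {j : ℤ} {y : H} (x : A), y ∈ H.gr j →
      A.d (f y x) = f (H.d y) x + (-1 : k) ^ j • f y (A.d x))
    {i : ℤ} {x : A} (y : H) (hx : x ∈ A.gr i) :
    A.d (koszulFlip f x y) =
      koszulFlip f (A.d x) y + (-1 : k) ^ i • koszulFlip f x (H.d y) := by
  induction y using H.homogeneous_induction with
  | zero => simp
  | add y y' hy hy' =>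
    simp only [map_add, smul_add, hy, hy']
    abel
  | hom j y hy =>
    rw [koszulFlip_apply f hx hy, koszulFlip_apply f (A.d_mem hx) hy,
      koszulFlip_apply f hx (H.d_mem hy), map_smul, hf x hy, smul_add, smul_smul, smul_smul,
      ← zpow_add₀ (by norm_num), ← zpow_add₀ (by norm_num), add_comm]
    congr 2
    · refine neg_one_zpow_congr ?_
      push_cast
      grind
    · refine neg_one_zpow_congr ?_
      push_cast
      grind

end Operads

namespace SwissCheese

open Operads Color

section
variable {k : Type u} [Field k] {V : Color → DGVec.{u, w} k} (T : DualTriple (V cl) (V op))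

/-- The operation of a basis element. -/
noncomputable def DualTriple.genOp {n : ℤ} {a b d : Color} :
    GenD n a b d → V a →ₗ[k] V b →ₗ[k] V d
  | .l₂ => T.bracket
  | .c₂ => T.times
  | .n₀₂ => T.mul
  | .n₀₂' => koszulFlip T.mul
  | .n₁₁ => T.ρ
  | .n₁₁' => koszulFlip T.ρ

theorem DualTriple.genOp_mem {n : ℤ} {a b d : Color} (g : GenD n a b d) {i j : ℤ} {x : V a}
    {y : V b} (hx : x ∈ (V a).gr i) (hy : y ∈ (V b).gr j) :
    T.genOp g x y ∈ (V d).gr (n + (i + j)) := by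
  cases g with
  | l₂ =>
    rw [zero_add]
    exact T.isLambdaGer.bracket_mem hx hy
  | c₂ =>
    rw [show -1 + (i + j) = i + j - 1 by ring]
    exact T.isLambdaGer.times_mem hx hy
  | n₀₂ =>
    rw [zero_add]
    exact T.isAssoc.mul_mem hx hy
  | n₀₂' =>
    rw [zero_add, add_comm i j, genOp, koszulFlip_apply T.mul hx hy]
    exact Submodule.smul_mem _ _ (T.isAssoc.mul_mem hy hx)
  | n₁₁ =>
    rw [zero_add]
    exact T.ρ_mem hx hy
  | n₁₁' =>
    rw [zero_add, add_comm i j, genOp, koszulFlip_apply T.ρ hx hy]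
    exact Submodule.smul_mem _ _ (T.ρ_mem hy hx)

theorem DualTriple.genOp_swap {n : ℤ} {a b d : Color} (g : GenD n a b d) {i j : ℤ} {x : V a}
    {y : V b} (hx : x ∈ (V a).gr i) (hy : y ∈ (V b).gr j) :
    ((g.sign : ℤ) : k) • T.genOp g.swap y x = (-1 : k) ^ (i * j) • T.genOp g x y := by
  have hs : ∀ v : V d, (-1 : k) ^ (i * j) • (-1 : k) ^ (i * j) • v = v := fun v => by
    rw [smul_smul, ← mul_zpow]
    simp
  cases g with
  | l₂ =>
    have h := T.isLambdaGer.bracket_antisymm hy hx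
    simp only [GenD.sign, GenD.swap, genOp, Units.val_neg, Units.val_one, Int.cast_neg,
      Int.cast_one, neg_smul, one_smul]
    rw [h, neg_neg, mul_comm]
  | c₂ =>
    have h := T.isLambdaGer.times_antisymm hy hx
    simp only [GenD.sign, GenD.swap, genOp, Units.val_neg, Units.val_one, Int.cast_neg,
      Int.cast_one, neg_smul, one_smul]
    rw [h, neg_neg, mul_comm]
  | n₀₂ =>
    simp only [GenD.sign, GenD.swap, genOp, Units.val_one, Int.cast_one, one_smul]
    rw [koszulFlip_apply T.mul hy hx, mul_comm]
  | n₀₂' =>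
    simp only [GenD.sign, GenD.swap, genOp, Units.val_one, Int.cast_one, one_smul]
    rw [koszulFlip_apply T.mul hx hy, hs]
  | n₁₁ =>
    simp only [GenD.sign, GenD.swap, genOp, Units.val_one, Int.cast_one, one_smul]
    rw [koszulFlip_apply T.ρ hy hx, mul_comm]
  | n₁₁' =>
    simp only [GenD.sign, GenD.swap, genOp, Units.val_one, Int.cast_one, one_smul]
    rw [koszulFlip_apply T.ρ hx hy, hs]

theorem DualTriple.genOp_d {n : ℤ} {a b d : Color} (g : GenD n a b d) {i : ℤ} {x : V a}
    (y : V b) (hx : x ∈ (V a).gr i) :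
    (V d).d (T.genOp g x y) = (-1 : k) ^ n •
      (T.genOp g ((V a).d x) y + (-1 : k) ^ i • T.genOp g x ((V b).d y)) := by
  cases g with
  | l₂ =>
    rw [zpow_zero, one_smul]
    exact T.isLambdaGer.bracket_d y hx
  | c₂ =>
    rw [show (-1 : k) ^ (-1 : ℤ) = -1 by norm_num, neg_one_smul]
    exact T.isLambdaGer.times_d y hx
  | n₀₂ =>
    rw [zpow_zero, one_smul]
    exact T.isAssoc.mul_d y hx
  | n₀₂' =>
    rw [zpow_zero, one_smul]
    exact koszulFlip_d T.mul T.isAssoc.mul_d y hx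
  | n₁₁ =>
    rw [zpow_zero, one_smul]
    exact T.ρ_d y hx
  | n₁₁' =>
    rw [zpow_zero, one_smul]
    exact koszulFlip_d T.ρ T.ρ_d y hx

/-- The operation of a linear combination of basis elements. -/
noncomputable def DualTriple.linOp {n : ℤ} {a b d : Color} :
    (GenD n a b d →₀ k) →ₗ[k] V a →ₗ[k] V b →ₗ[k] V d :=
  Finsupp.linearCombination k T.genOp

theorem DualTriple.linOp_single {n : ℤ} {a b d : Color} (g : GenD n a b d) (r : k) :
    T.linOp (Finsupp.single g r) = r • T.genOp g :=
  Finsupp.linearCombination_single k r g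

theorem DualTriple.linOp_mem {n : ℤ} {a b d : Color} (e : GenD n a b d →₀ k) {i j : ℤ} {x : V a}
    {y : V b} (hx : x ∈ (V a).gr i) (hy : y ∈ (V b).gr j) :
    T.linOp e x y ∈ (V d).gr (n + (i + j)) := by
  induction e using Finsupp.induction_linear with
  | zero => simp
  | add e e' h h' =>
    rw [map_add, LinearMap.add_apply, LinearMap.add_apply]
    exact add_mem h h'
  | single g r =>
    rw [linOp_single, LinearMap.smul_apply, LinearMap.smul_apply]
    exact Submodule.smul_mem _ _ (T.genOp_mem g hx hy)

theorem DualTriple.linOp_swap {n : ℤ} {a b d : Color} (e : GenD n a b d →₀ k) {i j : ℤ} {x : V a}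
    {y : V b} (hx : x ∈ (V a).gr i) (hy : y ∈ (V b).gr j) :
    T.linOp (Finsupp.linearCombination k
      (fun g : GenD n a b d => Finsupp.single g.swap (((g.sign : ℤˣ) : ℤ) : k)) e) y x =
        (-1 : k) ^ (i * j) • T.linOp e x y := by
  induction e using Finsupp.induction_linear with
  | zero => simp
  | add e e' h h' => simp only [map_add, LinearMap.add_apply, smul_add, h, h']
  | single g r =>
    rw [Finsupp.linearCombination_single, map_smul, linOp_single, linOp_single,
      LinearMap.smul_apply, LinearMap.smul_apply, LinearMap.smul_apply, LinearMap.smul_apply,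
      LinearMap.smul_apply, LinearMap.smul_apply, T.genOp_swap g hx hy, smul_comm]

theorem DualTriple.linOp_d {n : ℤ} {a b d : Color} (e : GenD n a b d →₀ k) {i : ℤ} {x : V a}
    (y : V b) (hx : x ∈ (V a).gr i) :
    (V d).d (T.linOp e x y) = (-1 : k) ^ n •
      (T.linOp e ((V a).d x) y + (-1 : k) ^ i • T.linOp e x ((V b).d y)) := by
  induction e using Finsupp.induction_linear with
  | zero => simp
  | add e e' h h' =>
    simp only [map_add, LinearMap.add_apply, h, h', smul_add]
    abel
  | single g r =>
    simp only [linOp_single, LinearMap.smul_apply, map_smul, T.genOp_d g y hx, smul_add,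
      smul_comm r]

/-- The action of the generators of the dual operad given by a triple. -/
noncomputable def DualTriple.action : BinAction V (Ed k) where
  op := T.linOp
  op_mem := T.linOp_mem
  op_swap := T.linOp_swap
  op_d := T.linOp_d

theorem DualTriple.action_el {n : ℤ} {a b d : Color} (g : GenD n a b d) :
    T.action.op (g.el k) = T.genOp g :=
  (T.linOp_single g 1).trans (one_smul k _)

/-- The converse reading of the relators: each of the seven, evaluated on homogeneous inputs, is one
axiom of the triple. -/
theorem DualTriple.satisfies_action : SatisfiesRelD T.action := by
  intro c d n q hq v G hv
  cases hq with
  | c_assoc =>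
    refine quadEval_eq_zero_of_triple _ (fun {x y z i j l} hx hy hz => ?_) hv
    simp only [map_add, tripleEval_l, tripleEval_r, action_el, genOp]
    rw [neg_one_zpow_congr (j := i) (by push_cast; grind), T.isLambdaGer.times_assoc y z hx]
    abel
  | l_jacobi =>
    refine quadEval_eq_zero_of_triple _ (fun {x y z i j l} hx hy hz => ?_) hv
    simp only [map_add, tripleEval_l, tripleEval_act231, tripleEval_act312, action_el, genOp]
    exact T.isLambdaGer.jacobi hx hy hz
  | leibniz =>
    refine quadEval_eq_zero_of_triple _ (fun {x y z i j l} hx hy hz => ?_) hv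
    simp only [map_add, map_sub, tripleEval_l, tripleEval_r, tripleEval_act213, zero_mul,
      zpow_zero, one_smul, action_el, genOp]
    rw [neg_one_zpow_congr (i := -1 * i) (j := i) (by push_cast; grind), sub_eq_zero]
    exact T.isLambdaGer.leibniz z hx hy
  | n_assoc =>
    refine quadEval_eq_zero_of_triple _ (fun {x y z i j l} hx hy hz => ?_) hv
    simp only [map_sub, tripleEval_l, tripleEval_r, zero_mul, zpow_zero, one_smul, action_el,
      genOp]
    rw [T.isAssoc.assoc, sub_self]
  | lie_action =>
    refine quadEval_eq_zero_of_triple _ (fun {x y z i j l} hx hy hz => ?_) hv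
    simp only [map_sub, tripleEval_l, tripleEval_r, tripleEval_act213, zero_mul, zpow_zero,
      one_smul, action_el, genOp]
    rw [T.ρ_bracket z hx hy, sub_self]
  | derivation =>
    refine quadEval_eq_zero_of_triple _ (fun {x y z i j l} hx hy hz => ?_) hv
    simp only [map_sub, map_add, tripleEval_l, tripleEval_r, tripleEval_act213, zero_mul,
      zpow_zero, one_smul, action_el, genOp]
    rw [T.ρ_mul z hx hy, mul_comm j i, sub_self]
  | kills_product =>
    refine quadEval_eq_zero_of_triple _ (fun {x y z i j l} hx hy hz => ?_) hv
    rw [tripleEval_l, action_el, action_el]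
    exact T.ρ_times x y z

end

end SwissCheese
-- Bijectivity of the correspondence.
namespace Operads

variable {k : Type u} [Field k] {C : Type} {V : C → DGVec.{u, w} k} {Q : BinaryQuadraticData k C}

theorem BinAction.toBinAction_toAlgebra_op {A : BinAction V Q.E} (hA : A.Satisfies) {a b d : C}
    {n : ℤ} (e : Q.E.M n a b d) (x : V a) (y : V b) :
    (BinAction.toAlgebra hA).toBinAction.op e x y = A.op e x y := by
  induction x using (V a).homogeneous_induction with
  | zero => simp
  | add x x' hx hx' => simp only [map_add, LinearMap.add_apply, hx, hx']
  | hom i x hx =>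
    induction y using (V b).homogeneous_induction with
    | zero => simp
    | add y y' hy hy' => simp only [map_add, hy, hy']
    | hom j y hy =>
      refine (BinAction.presAct_cls hA SwissCheese.stdOrder (Term.gen e)
        (a := pairInputs x y) (G := ![i, j]) ?_).trans ?_
      · intro t
        fin_cases t <;> assumption
      · exact one_smul k _

end Operads

namespace SwissCheese

open Operads Color

section
variable {k : Type u} [Field k] {V : Color → DGVec.{u, w} k}

theorem op_eq_of_el {A A' : BinAction V (Ed k)}
    (h : ∀ {n : ℤ} {a b d : Color} (g : GenD n a b d) (x : V a) (y : V b),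
      A.op (g.el k) x y = A'.op (g.el k) x y) {n : ℤ} {a b d : Color} (e : (Ed k).M n a b d)
    (x : V a) (y : V b) : A.op e x y = A'.op e x y := by
  have key : ∀ φ φ' : (GenD n a b d →₀ k) →ₗ[k] V a →ₗ[k] V b →ₗ[k] V d,
      (∀ g, φ (Finsupp.single g 1) = φ' (Finsupp.single g 1)) → φ = φ' :=
    fun φ φ' h => Finsupp.lhom_ext' fun g => LinearMap.ext_ring (h g)
  have h' := key A.op A'.op fun g => by
    ext x y
    exact h g x y
  exact congrArg (fun φ : (GenD n a b d →₀ k) →ₗ[k] V a →ₗ[k] V b →ₗ[k] V d => φ e x y) h'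

/-- On homogeneous inputs the primed operations are Koszul flips of the unprimed ones, and
additivity extends the agreement to all inputs. -/
theorem op_el_eq_of_basic {A A' : BinAction V (Ed k)}
    (hl : A.op (GenD.l₂.el k) = A'.op (GenD.l₂.el k))
    (hc : A.op (GenD.c₂.el k) = A'.op (GenD.c₂.el k))
    (hm : A.op (GenD.n₀₂.el k) = A'.op (GenD.n₀₂.el k))
    (hr : A.op (GenD.n₁₁.el k) = A'.op (GenD.n₁₁.el k)) {n : ℤ} {a b d : Color}
    (g : GenD n a b d) (x : V a) (y : V b) : A.op (g.el k) x y = A'.op (g.el k) x y := by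
  cases g with
  | l₂ => rw [hl]
  | c₂ => rw [hc]
  | n₀₂ => rw [hm]
  | n₁₁ => rw [hr]
  | n₀₂' =>
    induction x using (V op).homogeneous_induction with
    | zero => simp
    | add x x' hx hx' => simp only [map_add, LinearMap.add_apply, hx, hx']
    | hom i x hx =>
      induction y using (V op).homogeneous_induction with
      | zero => simp
      | add y y' hy hy' => simp only [map_add, hy, hy']
      | hom j y hy => rw [op_n₀₂' A hx hy, op_n₀₂' A' hx hy, hm]
  | n₁₁' =>
    induction x using (V op).homogeneous_induction with
    | zero => simp
    | add x x' hx hx' => simp only [map_add, LinearMap.add_apply, hx, hx']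
    | hom i x hx =>
      induction y using (V cl).homogeneous_induction with
      | zero => simp
      | add y y' hy hy' => simp only [map_add, hy, hy']
      | hom j y hy => rw [op_n₁₁' A hx hy, op_n₁₁' A' hx hy, hr]

theorem DualTriple.ext {H A : DGVec.{u, w} k} {T T' : DualTriple H A}
    (hb : T.bracket = T'.bracket) (ht : T.times = T'.times) (hm : T.mul = T'.mul)
    (hρ : T.ρ = T'.ρ) : T = T' := by
  obtain ⟨b, t, m, ρ, _, _, _, _, _, _, _⟩ := T
  obtain ⟨b', t', m', ρ', _, _, _, _, _, _, _⟩ := T'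
  obtain rfl : b = b' := hb
  obtain rfl : t = t' := ht
  obtain rfl : m = m' := hm
  obtain rfl : ρ = ρ' := hρ
  rfl

/-- The triple of an algebra over the Koszul dual operad. -/
noncomputable def algebraToTriple (B : OperadAlgebra (scvor k).koszulDual.operad V) :
    DualTriple (V cl) (V op) :=
  dualTriple (satisfiesRelD_toBinAction (OperadAlgebra.comap (dualIso k) B))

theorem comap_op (B : OperadAlgebra (scvor k).koszulDual.operad V) {n : ℤ} {a b d : Color}
    (e : (Ed k).M n a b d) (x : V a) (y : V b) :
    (OperadAlgebra.comap (dualIso k) B).toBinAction.op e x y =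
      B.act stdOrder ((scvor k).koszulDual.gen ((toDual k).map e)) (pair x y) := by
  have h : pairInputs x y = pair x y := by
    funext i
    fin_cases i <;> rfl
  rw [← h, ← dualIso_gen]
  rfl

theorem algebraToTriple_injective :
    Function.Injective (algebraToTriple (k := k) (V := V)) := by
  intro B B' h
  have h₁ : OperadAlgebra.comap (dualIso k) B = OperadAlgebra.comap (dualIso k) B' :=
    OperadAlgebra.ext_of_gen (op_eq_of_el (op_el_eq_of_basic (congrArg DualTriple.bracket h)
      (congrArg DualTriple.times h) (congrArg DualTriple.mul h) (congrArg DualTriple.ρ h)))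
  refine OperadAlgebra.ext_of_act fun L p => ?_
  obtain ⟨p, rfl⟩ := (dualIso k).equiv.surjective p
  exact congrArg (fun B : OperadAlgebra (scvorDual k).operad V => B.act L p) h₁

theorem algebraToTriple_surjective :
    Function.Surjective (algebraToTriple (k := k) (V := V)) := by
  intro T
  have hA : BinAction.Satisfies (Q := scvorDual k) T.action :=
    BinAction.satisfies_generated T.action T.satisfies_action
  -- The algebra is built over the explicit presentation, where the relations are the axioms of `T`,
  -- and then carried to the Koszul dual.
  set B := OperadAlgebra.comap (dualIsoInv k) (BinAction.toAlgebra hA) with hB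
  have key : ∀ {n : ℤ} {a b d : Color} (g : GenD n a b d),
      (OperadAlgebra.comap (dualIso k) B).toBinAction.op (g.el k) = T.genOp g := by
    intro n a b d g
    ext x y
    rw [← T.action_el]
    refine Eq.trans ?_ (BinAction.toBinAction_toAlgebra_op hA (g.el k) x y)
    -- That the two isomorphisms are inverse to each other is needed on generators only.
    have h : (dualIsoInv k).equiv ((dualIso k).equiv ((scvorDual k).gen (g.el k))) =
        (scvorDual k).gen (g.el k) := by
      rw [dualIso_gen, dualIsoInv_gen]
    exact congrArg (fun p => (BinAction.toAlgebra hA).act stdOrder p (pairInputs x y)) h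
  exact ⟨B, DualTriple.ext (key GenD.l₂) (key GenD.c₂) (key GenD.n₀₂) (key GenD.n₁₁)⟩

end

end SwissCheese

open Operads SwissCheese in
theorem mainTheorem8 (k : Type u) [Field k] [CharZero k] :
    -- `(sc^vor)^! = F(E_v^∨, R_v^⊥)` has the presentation `F(E_{v^!}, R_{v^!})`, under which
    -- `𝔩₂, 𝔠₂, 𝔫₀₂, 𝔫₁₁` are the elements dual to `f₂, g₂, e₀₂, e₁₁`
    (∃ Φ : ColoredOperad.Iso (scvorDual k).operad (scvor k).koszulDual.operad,
      Φ.equiv ((scvorDual k).gen (GenD.l₂.el k)) =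
        (scvor k).koszulDual.gen (𝔩₂ k) ∧
      Φ.equiv ((scvorDual k).gen (GenD.c₂.el k)) =
        (scvor k).koszulDual.gen (𝔠₂ k) ∧
      Φ.equiv ((scvorDual k).gen (GenD.n₀₂.el k)) =
        (scvor k).koszulDual.gen (𝔫₀₂ k) ∧
      Φ.equiv ((scvorDual k).gen (GenD.n₁₁.el k)) =
        (scvor k).koszulDual.gen (𝔫₁₁ k)) ∧
    -- evaluation at the generators identifies the algebras over `(sc^vor)^!` on a pair
    -- `(H, A) = (V cl, V op)` with the triples `(H, A, ρ)`
    (∀ V : Color → DGVec.{u, w} k,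
      ∃ Ψ : OperadAlgebra (scvor k).koszulDual.operad V ≃ DualTriple (V Color.cl) (V Color.op),
        ∀ B : OperadAlgebra (scvor k).koszulDual.operad V,
          (∀ x y : V Color.cl, (Ψ B).bracket x y =
            B.act stdOrder ((scvor k).koszulDual.gen (𝔩₂ k))
              (pair x y)) ∧
          (∀ x y : V Color.cl, (Ψ B).times x y =
            B.act stdOrder ((scvor k).koszulDual.gen (𝔠₂ k))
              (pair x y)) ∧
          (∀ a b : V Color.op, (Ψ B).mul a b =
            B.act stdOrder ((scvor k).koszulDual.gen (𝔫₀₂ k))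
              (pair a b)) ∧
          (∀ (h : V Color.cl) (a : V Color.op), (Ψ B).ρ h a =
            B.act stdOrder ((scvor k).koszulDual.gen (𝔫₁₁ k))
              (pair h a))) := by
  refine ⟨⟨dualIso k, ?_, ?_, ?_, ?_⟩, fun V => ⟨Equiv.ofBijective algebraToTriple
    ⟨algebraToTriple_injective, algebraToTriple_surjective⟩, fun B => ⟨?_, ?_, ?_, ?_⟩⟩⟩
  · rw [dualIso_gen, toDual_l₂]
  · rw [dualIso_gen, toDual_c₂]
  · rw [dualIso_gen, toDual_n₀₂]
  · rw [dualIso_gen, toDual_n₁₁]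
  · intro x y
    rw [← toDual_l₂]
    exact comap_op B (GenD.l₂.el k) x y
  · intro x y
    rw [← toDual_c₂]
    exact comap_op B (GenD.c₂.el k) x y
  · intro x y
    rw [← toDual_n₀₂]
    exact comap_op B (GenD.n₀₂.el k) x y
  · intro x y
    rw [← toDual_n₁₁]
    exact comap_op B (GenD.n₁₁.el k) x y
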